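/- For $c\in\mathbb C$ let $f_c(z)=z^2+c$. For a periodic orbit $\mathcal O$ of $f_{c_0}$ let $|\mathcal O|$ be its period (its number of points); $\mathcal O$ is repelling if its multiplier $(f_{c_0}^{\circ|\mathcal O|})'(z)$, $z\in\mathcal O$, has modulus greater than $1$. If $\mathcal O$ is repelling, a point of $\mathcal O$ continues analytically, for $c$ near $c_0$, to a point $z(c)$ with $f_c^{\circ|\mathcal O|}(z(c))=z(c)$. Put $$\rho_{\mathcal O}(c)=(f_c^{\circ|\mathcal O|})'(z(c)),\qquad \nu_{\mathcal O}(c)=\frac{\rho_{\mathcal O}'(c)}{|\mathcal O|\,\rho_{\mathcal O}(c)};$$ these are analytic functions near $c_0$ that do not depend on the choice of the point of $\mathcal O$. **Averaging Lemma.** Let $\alpha\in[0,1]$, let $c_0\in\mathbb C$, and let $\mathcal O_1\ne\mathcal O_2$ be repelling periodic orbits of $f_{c_0}$; if $c_0=-2$, assume that neither of them is the fixed point $\{2\}$. Then there exist a connected open neighborhood $U$ of $c_0$ and a sequence $(\mathcal O_j)_{j\ge 3}$ of pairwise distinct repelling periodic orbits of $f_{c_0}$ such that all the maps $\nu_{\mathcal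 O_j}$, $j\ge 1$, are defined and analytic in $U$, and $$\nu_{\mathcal O_j}\longrightarrow \alpha\,\nu_{\mathcal O_1}+(1-\alpha)\,\nu_{\mathcal O_2}\qquad (j\to\infty)\quad\text{uniformly in } U.$$ If moreover $|\mathcal O_1|$ and $|\mathcal O_2|$ are relatively prime, then $U$ and the sequence can be chosen so that in addition $|\mathcal O_j|=j$ for every $j\ge 3$, with the single exception of $j=3$ when $c_0=-7/4$ (the map $f_{-7/4}$ has no repelling orbit of period $3$). -/

import Mathlib

open Set Filter Topology

/-- The quadratic family `f_c(z) = z ^ 2 + c`. -/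
def quadMap (c z : ℂ) : ℂ := z ^ 2 + c

/-- `O` is a periodic orbit of `f_c`: the (finite) set of all iterates of a periodic point.
Its period `|O|` is the number of its points, `O.ncard`. -/
def IsPeriodicOrbit (c : ℂ) (O : Set ℂ) : Prop :=
  ∃ z ∈ Function.periodicPts (quadMap c), O = range (fun k : ℕ => (quadMap c)^[k] z)

/-- A periodic orbit of `f_c` is repelling if its multiplier, the derivative of `f_c^{|O|}` at any
of its points, has modulus greater than one. -/
def IsRepellingOrbit (c : ℂ) (O : Set ℂ) : Prop :=
  IsPeriodicOrbit c O ∧ ∀ z ∈ O, 1 < ‖deriv ((quadMap c)^[O.ncard]) z‖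

/-- `ρ` is, on the neighbourhood `U` of `c₀`, the multiplier map of the periodic orbit `O`
of `f_{c₀}`: a point of `O` continues analytically over `U` to a point `z c` with
`f_c^{|O|} (z c) = z c`, and `ρ c` is the derivative of `f_c^{|O|}` at `z c`.
When the multiplier of `O` is not one and `U` is open and connected, the implicit function theorem
and the identity theorem show that the values of `ρ` on `U` are determined by `c₀`, `O`, `U`. -/
def IsMultiplierMap (c₀ : ℂ) (O : Set ℂ) (U : Set ℂ) (ρ : ℂ → ℂ) : Prop :=
  ∃ z : ℂ → ℂ, AnalyticOnNhd ℂ z U ∧ z c₀ ∈ O ∧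
    ∀ c ∈ U, (quadMap c)^[O.ncard] (z c) = z c ∧ ρ c = deriv ((quadMap c)^[O.ncard]) (z c)

/-- The map `ν_O = ρ_O' / (|O| ρ_O)` is defined and analytic on the neighbourhood `U` of `c₀`,
and `ν` is equal to it there. -/
def IsNuMap (c₀ : ℂ) (O : Set ℂ) (U : Set ℂ) (ν : ℂ → ℂ) : Prop :=
  AnalyticOnNhd ℂ ν U ∧
    ∃ ρ : ℂ → ℂ, IsMultiplierMap c₀ O U ρ ∧
      ∀ c ∈ U, ρ c ≠ 0 ∧ ν c = deriv ρ c / ((O.ncard : ℂ) * ρ c)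

/-- The terms `O 3, O 4, …` are pairwise distinct repelling periodic orbits of `f_{c₀}`, all the
maps `ν_{O₁}`, `ν_{O₂}` and `ν_{O j}` are defined and analytic on `U`, and the `ν_{O j}` converge
to `α ν_{O₁} + (1 - α) ν_{O₂}` uniformly on `U`. -/
def IsAveragingSequence (α : ℝ) (c₀ : ℂ) (O₁ O₂ : Set ℂ) (U : Set ℂ) (O : ℕ → Set ℂ) : Prop :=
  (∀ j, 3 ≤ j → IsRepellingOrbit c₀ (O j)) ∧
  InjOn O (Ici 3) ∧
  ∃ (ν₁ ν₂ : ℂ → ℂ) (ν : ℕ → ℂ → ℂ),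
    IsNuMap c₀ O₁ U ν₁ ∧ IsNuMap c₀ O₂ U ν₂ ∧
    (∀ j, 3 ≤ j → IsNuMap c₀ (O j) U (ν j)) ∧
    TendstoUniformlyOn ν (fun c => (α : ℂ) * ν₁ c + (1 - (α : ℂ)) * ν₂ c) atTop U

/-! ### Iterates and multipliers -/

/-! A periodic orbit that turns `a` times around `O₁`, passes to `O₂`, turns `b` times around it and
comes back, with transits of fixed total length `ℓ`, has period `N = a |O₁| + b |O₂| + ℓ` and
multiplier `ρ` comparable to `ρ₁ ^ a * ρ₂ ^ b`, with constants independent of `a`, `b` and of `c` in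
a disc about `c₀`. The holomorphic quotient `ρ / (ρ₁ ^ a * ρ₂ ^ b)` is thus bounded above and below,
and Cauchy's estimate bounds its logarithmic derivative `N ν - a |O₁| ν₁ - b |O₂| ν₂`. Dividing by
`N`, with `a |O₁| / N` close to `α`, gives uniform convergence with error `O(1/N)`. This is
`exists_shadowing_orbits` combined with `exists_proportional_representation`.

The orbits are fixed points of compositions of contracting inverse branches (a horseshoe). The
comparison of multipliers is bounded distortion, `IsInverseBranch.exists_distortion`. The transits
come from `exists_connecting_point`: near a point of one orbit there is a point that lands on the
other orbit without meeting the critical point. It rests on two facts. Iterates of a neighbourhood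
of a repelling periodic point cannot avoid two given points (`exists_iterate_mem_pair`); this is
proved not by Montel's theorem but by taking limits of `2⁻ⁿ log (f_c^n - y)`. And a repelling orbit
has a suitable preimage off the forward orbit of the critical value, unless it is the fixed point
`2` of `f_{-2}` (`exists_noncritical_preimage`).

Exactness of the period `N` is read off the itinerary: a proper divisor of `N` is at most `N / 2`,
so it suffices that one of the two winding stretches fills half of the orbit. By symmetry one may
take `α ≥ 1/2` and let `O₁` be that orbit.

If the periods are coprime, all large `N` are attained, and finitely many `j` remain, for which any
repelling orbit of period `j` will do (`exists_isRepellingOrbit`). For `n ≥ 4`: without such an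
orbit, the product of all `n`-periodic points forces `f_c^n(0)` to be tiny; then a trap around the
critical orbit contains at most `n` of these points, everything outside it is repelling, and
counting the `2 ^ n` roots of `f_c^n(z) - z` gives a contradiction. Period three is an explicit
computation with the two multipliers. -/

lemma hasDerivAt_quadMap (c z : ℂ) : HasDerivAt (quadMap c) (2 * z) z := by
  have h := (hasDerivAt_pow 2 z).add_const c
  simp only [Nat.cast_ofNat, Nat.add_one_sub_one, pow_one] at h
  exact h

lemma hasDerivAt_iterate_quadMap (c z : ℂ) (n : ℕ) :
    HasDerivAt ((quadMap c)^[n]) (∏ i ∈ Finset.range n, 2 * (quadMap c)^[i] z) z := by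
  induction n with
  | zero => simpa using hasDerivAt_id z
  | succ n ih =>
    rw [Finset.prod_range_succ, Function.iterate_succ', mul_comm]
    exact (hasDerivAt_quadMap c _).comp z ih

lemma deriv_iterate_quadMap (c z : ℂ) (n : ℕ) :
    deriv ((quadMap c)^[n]) z = ∏ i ∈ Finset.range n, 2 * (quadMap c)^[i] z :=
  (hasDerivAt_iterate_quadMap c z n).deriv

lemma differentiable_iterate_quadMap (c : ℂ) (n : ℕ) : Differentiable ℂ ((quadMap c)^[n]) :=
  fun z => (hasDerivAt_iterate_quadMap c z n).differentiableAt

lemma deriv_iterate_add_quadMap (c z : ℂ) (m n : ℕ) :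
    deriv ((quadMap c)^[m + n]) z =
      deriv ((quadMap c)^[m]) ((quadMap c)^[n] z) * deriv ((quadMap c)^[n]) z := by
  simp only [deriv_iterate_quadMap]
  rw [add_comm m n, Finset.prod_range_add, mul_comm]
  congr 1
  refine Finset.prod_congr rfl fun i _ => ?_
  rw [add_comm n i, Function.iterate_add_apply]

lemma contDiff_iterate_quadMap (n : ℕ) :
    ContDiff ℂ ⊤ (fun p : ℂ × ℂ => (quadMap p.1)^[n] p.2) := by
  induction n with
  | zero => simpa using contDiff_snd
  | succ n ih =>
    simp only [Function.iterate_succ', Function.comp_apply]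
    simp only [quadMap] at ih ⊢
    fun_prop

lemma contDiff_deriv_iterate_quadMap (n : ℕ) :
    ContDiff ℂ ⊤ (fun p : ℂ × ℂ => deriv ((quadMap p.1)^[n]) p.2) := by
  simp only [deriv_iterate_quadMap]
  exact contDiff_prod fun i _ => contDiff_const.mul (contDiff_iterate_quadMap i)

/-! ### Periodic orbits -/

/-- The forward orbit of `z` under `f_c`. -/
def orbitSet (c z : ℂ) : Set ℂ := range fun k : ℕ => (quadMap c)^[k] z

lemma ncard_orbitSet {c z : ℂ} (hz : z ∈ Function.periodicPts (quadMap c)) :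
    (orbitSet c z).ncard = Function.minimalPeriod (quadMap c) z := by
  have h : orbitSet c z =
      (fun k : ℕ => (quadMap c)^[k] z) '' Iio (Function.minimalPeriod (quadMap c) z) := by
    apply Subset.antisymm
    · rintro _ ⟨k, rfl⟩
      exact ⟨k % Function.minimalPeriod (quadMap c) z,
        Nat.mod_lt _ (Function.minimalPeriod_pos_of_mem_periodicPts hz),
        Function.iterate_mod_minimalPeriod_eq⟩
    · rintro _ ⟨k, -, rfl⟩
      exact ⟨k, rfl⟩
  rw [h, Function.iterate_injOn_Iio_minimalPeriod.ncard_image]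
  simp [← Finset.coe_Iio, ncard_coe_finset]

lemma isPeriodicOrbit_orbitSet {c z : ℂ} (hz : z ∈ Function.periodicPts (quadMap c)) :
    IsPeriodicOrbit c (orbitSet c z) := ⟨z, hz, rfl⟩

lemma mem_orbitSet_self (c z : ℂ) : z ∈ orbitSet c z := ⟨0, rfl⟩

lemma IsPeriodicOrbit.eq_orbitSet {c z : ℂ} {O : Set ℂ} (hO : IsPeriodicOrbit c O) (hz : z ∈ O) :
    z ∈ Function.periodicPts (quadMap c) ∧ O = orbitSet c z := by
  obtain ⟨w, ⟨n, hn, hw⟩, rfl⟩ := hO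
  obtain ⟨k, rfl⟩ := hz
  refine ⟨⟨n, hn, hw.apply_iterate k⟩, Subset.antisymm ?_ ?_⟩
  · rintro _ ⟨l, rfl⟩
    refine ⟨l + (n * k - k), ?_⟩
    simp only [← Function.iterate_add_apply]
    have h1 : l + (n * k - k) + k = l + n * k := by
      have : k ≤ n * k := Nat.le_mul_of_pos_left k hn
      omega
    rw [h1, Function.iterate_add_apply, (hw.mul_const k).eq]
  · rintro _ ⟨l, rfl⟩
    exact ⟨l + k, by simp only [Function.iterate_add_apply]⟩

lemma IsPeriodicOrbit.ncard_eq {c z : ℂ} {O : Set ℂ} (hO : IsPeriodicOrbit c O) (hz : z ∈ O) :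
    O.ncard = Function.minimalPeriod (quadMap c) z := by
  obtain ⟨h1, h2⟩ := hO.eq_orbitSet hz
  rw [h2, ncard_orbitSet h1]

lemma IsPeriodicOrbit.ncard_pos {c : ℂ} {O : Set ℂ} (hO : IsPeriodicOrbit c O) : 0 < O.ncard := by
  obtain ⟨z, hz, rfl⟩ := hO
  have := ncard_orbitSet hz
  rw [orbitSet] at this
  rw [this]
  exact Function.minimalPeriod_pos_of_mem_periodicPts hz

lemma IsPeriodicOrbit.iterate_ncard {c z : ℂ} {O : Set ℂ} (hO : IsPeriodicOrbit c O) (hz : z ∈ O) :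
    (quadMap c)^[O.ncard] z = z := by
  rw [hO.ncard_eq hz, Function.iterate_minimalPeriod]

lemma IsPeriodicOrbit.iterate_mem {c z : ℂ} {O : Set ℂ} (hO : IsPeriodicOrbit c O) (hz : z ∈ O)
    (k : ℕ) : (quadMap c)^[k] z ∈ O := by
  rw [(hO.eq_orbitSet hz).2]; exact ⟨k, rfl⟩

/-- Points on the same cycle have the same multiplier. -/
lemma deriv_iterate_cycle {c z : ℂ} {n : ℕ} (hz : (quadMap c)^[n] z = z) (k : ℕ) :
    deriv ((quadMap c)^[n]) ((quadMap c)^[k] z) = deriv ((quadMap c)^[n]) z := by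
  induction k with
  | zero => rfl
  | succ k ih =>
    rw [← ih, Function.iterate_succ_apply']
    set w := (quadMap c)^[k] z
    have hw : (quadMap c)^[n] w = w := by
      rw [← Function.iterate_add_apply, add_comm, Function.iterate_add_apply, hz]
    have h1 := Finset.prod_range_succ (fun i => 2 * (quadMap c)^[i] w) n
    have h2 := Finset.prod_range_succ' (fun i => 2 * (quadMap c)^[i] w) n
    rw [h1, hw] at h2
    simp only [deriv_iterate_quadMap, ← Function.iterate_succ_apply]
    -- The products along the orbits of `w` and of its image differ by one factor `2 * w` at each
    -- end. It cancels unless `w = 0`, and then both products vanish.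
    rcases eq_or_ne w 0 with h0 | h0
    · rcases n with _ | n
      · simp
      · have e1 : ∏ i ∈ Finset.range (n + 1), 2 * (quadMap c)^[i] w = 0 :=
          Finset.prod_eq_zero (Finset.mem_range.2 n.succ_pos) (by simp [h0])
        have e2 : ∏ i ∈ Finset.range (n + 1), 2 * (quadMap c)^[i.succ] w = 0 :=
          Finset.prod_eq_zero (Finset.self_mem_range_succ n) (by rw [hw, h0, mul_zero])
        rw [e1, e2]
    · refine mul_right_cancel₀ (mul_ne_zero two_ne_zero h0) ?_
      simpa using h2.symm

lemma isRepellingOrbit_orbitSet {c z : ℂ} {n : ℕ} (hn : 0 < n)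
    (hz : Function.minimalPeriod (quadMap c) z = n)
    (h1 : 1 < ‖deriv ((quadMap c)^[n]) z‖) :
    IsRepellingOrbit c (orbitSet c z) ∧ (orbitSet c z).ncard = n := by
  have hp : z ∈ Function.periodicPts (quadMap c) :=
    Function.minimalPeriod_pos_iff_mem_periodicPts.1 (hz ▸ hn)
  have hc : (orbitSet c z).ncard = n := by rw [ncard_orbitSet hp, hz]
  refine ⟨⟨isPeriodicOrbit_orbitSet hp, ?_⟩, hc⟩
  rw [hc]
  rintro _ ⟨k, rfl⟩
  simp only
  rwa [deriv_iterate_cycle]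
  rw [← hz, Function.iterate_minimalPeriod]

lemma IsRepellingOrbit.ne_zero {c z : ℂ} {O : Set ℂ} (hO : IsRepellingOrbit c O) (hz : z ∈ O) :
    z ≠ 0 := by
  rintro rfl
  have h := hO.2 0 hz
  rw [deriv_iterate_quadMap, Finset.prod_eq_zero (i := 0)] at h
  · simp at h; linarith
  · exact Finset.mem_range.2 hO.1.ncard_pos
  · simp

/-- Two periodic orbits with a common point coincide. -/
lemma IsPeriodicOrbit.eq_of_mem {c z : ℂ} {O O' : Set ℂ} (hO : IsPeriodicOrbit c O)
    (hO' : IsPeriodicOrbit c O') (hz : z ∈ O) (hz' : z ∈ O') : O = O' := by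
  rw [(hO.eq_orbitSet hz).2, (hO'.eq_orbitSet hz').2]

/-! ### Holomorphic logarithms on discs -/

/-- A zero-free holomorphic function on a disc has a holomorphic logarithm with a prescribed value
at the centre. -/
lemma exists_differentiableOn_log {g : ℂ → ℂ} {p : ℂ} {r : ℝ} (hr : 0 < r)
    (hg : DifferentiableOn ℂ g (Metric.ball p r)) (h0 : ∀ z ∈ Metric.ball p r, g z ≠ 0)
    {w : ℂ} (hw : Complex.exp w = g p) :
    ∃ L : ℂ → ℂ, DifferentiableOn ℂ L (Metric.ball p r) ∧ L p = w ∧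
      ∀ z ∈ Metric.ball p r, Complex.exp (L z) = g z := by
  have hq : DifferentiableOn ℂ (fun z => deriv g z / g z) (Metric.ball p r) :=
    (hg.deriv Metric.isOpen_ball).div hg h0
  obtain ⟨L, hL0, hL⟩ := hq.isExactOn_ball.with_val_at p w
  refine ⟨L, fun z hz => (hL z hz).differentiableAt.differentiableWithinAt, hL0, fun z hz => ?_⟩
  have hp : p ∈ Metric.ball p r := Metric.mem_ball_self hr
  have hder : ∀ z ∈ Metric.ball p r,
      HasDerivAt (fun z => Complex.exp (L z) / g z) 0 z := fun z hz => by
    have hgz := (hg.differentiableAt (Metric.isOpen_ball.mem_nhds hz)).hasDerivAt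
    convert! (hL z hz).cexp.div hgz (h0 z hz) using 1
    have := h0 z hz
    field_simp
    ring
  have hconst : Complex.exp (L z) / g z = Complex.exp (L p) / g p := by
    refine Metric.isOpen_ball.is_const_of_deriv_eq_zero (convex_ball p r).isPreconnected
      (fun z hz => (hder z hz).differentiableAt.differentiableWithinAt)
      (fun z hz => (hder z hz).deriv) hz hp
  rw [hL0, hw, div_self (h0 p hp), div_eq_one_iff_eq (h0 z hz)] at hconst
  exact hconst

/-! ### Expansion from a trapping region -/

/-- The values `‖h'(0)‖` for holomorphic maps `h` from the unit disc to `Ω` with `h 0 = z`. -/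
def discDerivs (Ω : Set ℂ) (z : ℂ) : Set ℝ :=
  {s | ∃ h : ℂ → ℂ, DifferentiableOn ℂ h (Metric.ball 0 1) ∧ MapsTo h (Metric.ball 0 1) Ω ∧
    h 0 = z ∧ s = ‖deriv h 0‖}

lemma discDerivs_le {Ω : Set ℂ} {R : ℝ} (hb : Ω ⊆ Metric.ball 0 R) {z : ℂ} {s : ℝ}
    (hs : s ∈ discDerivs Ω z) : s ≤ 2 * R := by
  obtain ⟨h, hd, hm, -, rfl⟩ := hs
  have hsub : Metric.closedBall (0 : ℂ) (1 / 2) ⊆ Metric.ball 0 1 :=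
    Metric.closedBall_subset_ball (by norm_num)
  have := Complex.norm_deriv_le_of_forall_mem_sphere_norm_le (c := 0) (R := 1 / 2) (C := R)
    (f := h) (by norm_num) ((hd.mono hsub).diffContOnCl_ball subset_rfl) (fun w hw => by
      have := hb (hm (hsub (Metric.sphere_subset_closedBall hw)))
      rw [mem_ball_zero_iff] at this
      exact this.le)
  linarith

lemma zero_mem_discDerivs {Ω : Set ℂ} {z : ℂ} (hz : z ∈ Ω) : 0 ∈ discDerivs Ω z :=
  ⟨fun _ => z, differentiableOn_const _, fun _ _ => hz, rfl, by simp⟩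

/-- Lifting a disc through `f_c`, with room to spare. -/
lemma exists_lift_discDerivs {c : ℂ} {Ω : Set ℂ} {δ : ℝ} (hδ : 0 < δ) (hc : c ∉ Ω)
    (hthick : Metric.thickening δ (quadMap c ⁻¹' Ω) ⊆ Ω) {z : ℂ} (hz : quadMap c z ∈ Ω)
    {s : ℝ} (hs : s ∈ discDerivs Ω (quadMap c z)) :
    ∃ t ∈ discDerivs Ω z, s / ‖2 * z‖ + δ / 2 ≤ t := by
  obtain ⟨h, hd, hm, h0, rfl⟩ := hs
  have hz0 : z ≠ 0 := by
    rintro rfl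
    simp [quadMap] at hz
    exact hc hz
  have hO : (0 : ℂ) ∈ Metric.ball (0 : ℂ) 1 := Metric.mem_ball_self one_pos
  obtain ⟨L, hLd, hL0, hL⟩ := exists_differentiableOn_log (g := fun w => h w - c) (p := 0)
    (w := 2 * Complex.log z) one_pos
    (hd.sub_const c) (fun w hw h => hc (by rw [← sub_eq_zero.1 h]; exact hm hw))
    (by
      rw [h0, two_mul, Complex.exp_add, Complex.exp_log hz0, quadMap]; ring)
  set k : ℂ → ℂ := fun w => Complex.exp (L w / 2) with hk
  have hkd : DifferentiableOn ℂ k (Metric.ball 0 1) := (hLd.div_const 2).cexp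
  have hk2 : ∀ w ∈ Metric.ball (0 : ℂ) 1, quadMap c (k w) = h w := fun w hw => by
    have := hL w hw
    rw [quadMap, hk, ← Complex.exp_nat_mul]
    rw [show ((2 : ℕ) : ℂ) * (L w / 2) = L w by push_cast; ring, this]; ring
  have hk0 : k 0 = z := by
    simp only [hk]
    rw [hL0, mul_div_cancel_left₀ _ two_ne_zero, Complex.exp_log hz0]
  have hkder : HasDerivAt k (deriv k 0) 0 :=
    (hkd.differentiableAt (Metric.isOpen_ball.mem_nhds hO)).hasDerivAt
  have hder : deriv h 0 = 2 * z * deriv k 0 := by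
    have e1 : h =ᶠ[𝓝 0] fun w => quadMap c (k w) := by
      filter_upwards [Metric.isOpen_ball.mem_nhds hO] with w hw using (hk2 w hw).symm
    rw [e1.deriv_eq]
    have := (hasDerivAt_quadMap c (k 0)).comp 0 hkder
    rw [hk0] at this
    exact this.deriv
  obtain ⟨u, hu, hu2⟩ : ∃ u : ℂ, ‖u‖ = 1 ∧ ‖deriv k 0 + (δ / 2 : ℝ) * u‖ = ‖deriv k 0‖ + δ / 2 := by
    by_cases h0 : deriv k 0 = 0
    · exact ⟨1, by simp, by rw [h0]; simp [abs_of_pos hδ]⟩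
    · have hn : (‖deriv k 0‖ : ℂ) ≠ 0 := by simpa using h0
      refine ⟨deriv k 0 / ‖deriv k 0‖, by simp [h0], ?_⟩
      have : deriv k 0 + (δ / 2 : ℝ) * (deriv k 0 / ‖deriv k 0‖)
          = deriv k 0 * (((1 + δ / 2 / ‖deriv k 0‖ : ℝ)) : ℂ) := by push_cast; field_simp
      rw [this, norm_mul, Complex.norm_real, Real.norm_of_nonneg (by positivity)]
      have hn' : ‖deriv k 0‖ ≠ 0 := by simpa using h0
      field_simp
  have hkder2 : HasDerivAt (fun w => k w + (δ / 2 : ℝ) * u * w)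
      (deriv k 0 + (δ / 2 : ℝ) * u) 0 := by
    have := hkder.add ((hasDerivAt_id (0 : ℂ)).const_mul (((δ / 2 : ℝ) : ℂ) * u))
    rw [mul_one] at this
    exact this
  -- The lift `k` takes values in the preimage of `Ω`, so it may be perturbed by less than `δ`
  -- without leaving `Ω`. The linear term is aligned with `deriv k 0`, which makes the derivative
  -- grow by exactly `δ / 2`.
  refine ⟨‖deriv k 0‖ + δ / 2, ⟨fun w => k w + (δ / 2 : ℝ) * u * w, ?_, ?_, ?_, ?_⟩, ?_⟩
  · exact hkd.add (by fun_prop)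
  · intro w hw
    refine hthick (Metric.mem_thickening_iff.2 ⟨k w, ?_, ?_⟩)
    · rw [mem_preimage, hk2 w hw]; exact hm hw
    · rw [dist_eq_norm, add_sub_cancel_left, norm_mul, norm_mul, hu, Complex.norm_real,
        Real.norm_of_nonneg (by positivity)]
      rw [mem_ball_zero_iff] at hw
      nlinarith [norm_nonneg w]
  · simp [hk0]
  · rw [hkder2.deriv, hu2]
  · rw [hder, norm_mul, mul_div_cancel_left₀]
    simpa using hz0

/-- If `Ω` is bounded and open, does not contain the critical value, and its preimage is
relatively compact in `Ω`, then all cycles in `Ω` are repelling. -/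
lemma one_lt_norm_deriv_of_closure_preimage_subset {c : ℂ} {R : ℝ} {Ω : Set ℂ} (hΩ : IsOpen Ω)
    (hb : Ω ⊆ Metric.ball 0 R) (hc : c ∉ Ω) (hpre : closure (quadMap c ⁻¹' Ω) ⊆ Ω)
    {z : ℂ} {n : ℕ} (hn : 0 < n) (hz : z ∈ Ω) (hper : (quadMap c)^[n] z = z) :
    1 < ‖deriv ((quadMap c)^[n]) z‖ := by
  have hcomp : IsCompact (closure (quadMap c ⁻¹' Ω)) :=
    Metric.isCompact_of_isClosed_isBounded isClosed_closure
      (Metric.isBounded_ball.subset (hpre.trans hb))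
  obtain ⟨δ, hδ, hthick⟩ := hcomp.exists_thickening_subset_open hΩ hpre
  rw [Metric.thickening_closure] at hthick
  have hpre' : ∀ w, quadMap c w ∈ Ω → w ∈ Ω := fun w hw => hpre (subset_closure hw)
  have hback : ∀ m w, (quadMap c)^[m] w ∈ Ω → w ∈ Ω := by
    intro m
    induction m with
    | zero => intro w hw; exact hw
    | succ m ih => intro w hw; exact hpre' w (ih _ hw)
  -- `Ω` is backward invariant, and going on for `n * k - k` steps from the `k`-th point leads back
  -- to `z`.
  have horb : ∀ k, (quadMap c)^[k] z ∈ Ω := fun k => by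
    refine hback (n * k - k) _ ?_
    rw [← Function.iterate_add_apply, Nat.sub_add_cancel (Nat.le_mul_of_pos_left k hn)]
    have : Function.IsPeriodicPt (quadMap c) n z := hper
    rw [(this.mul_const k).eq]
    exact hz
  -- `S` is the reciprocal of the Kobayashi density of `Ω`, up to normalisation. The compact
  -- inclusion of the preimage yields a definite gain `δ / 2` at each step.
  set S : ℂ → ℝ := fun w => sSup (discDerivs Ω w) with hS
  have hbdd : ∀ w, BddAbove (discDerivs Ω w) := fun w => ⟨2 * R, fun s hs => discDerivs_le hb hs⟩
  have hR : 0 < R := by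
    have := hb hz
    rw [mem_ball_zero_iff] at this
    exact (norm_nonneg z).trans_lt this
  have hSle : ∀ w ∈ Ω, S w ≤ 2 * R := fun w hw =>
    csSup_le ⟨0, zero_mem_discDerivs hw⟩ fun s hs => discDerivs_le hb hs
  have hS0 : ∀ w ∈ Ω, 0 ≤ S w := fun w hw => le_csSup (hbdd w) (zero_mem_discDerivs hw)
  have hne0 : ∀ w, quadMap c w ∈ Ω → w ≠ 0 := by
    rintro w hw rfl
    exact hc (by simpa [quadMap] using hw)
  have hstep : ∀ w, quadMap c w ∈ Ω → S (quadMap c w) / ‖2 * w‖ + δ / 2 ≤ S w := by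
    intro w hw
    have h2w : 0 < ‖2 * w‖ := by simpa using hne0 w hw
    rw [← le_sub_iff_add_le, div_le_iff₀ h2w]
    refine csSup_le ⟨0, zero_mem_discDerivs hw⟩ fun s hs => ?_
    obtain ⟨t, ht, hst⟩ := exists_lift_discDerivs hδ hc hthick hw hs
    rw [← div_le_iff₀ h2w, le_sub_iff_add_le]
    exact hst.trans (le_csSup (hbdd w) ht)
  have hpos : ∀ k, 0 < S ((quadMap c)^[k] z) := fun k => by
    have h1 := horb (k + 1)
    rw [Function.iterate_succ_apply'] at h1
    have := hstep _ h1
    have := div_nonneg (hS0 _ h1) (norm_nonneg (2 * (quadMap c)^[k] z))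
    linarith
  -- Since `S ≤ 2 * R`, the additive gain becomes a multiplicative one. Around the cycle `S` returns
  -- to its value, so the multiplier has modulus at least `θ⁻ⁿ`.
  set θ : ℝ := 1 - δ / 2 / (2 * R) with hθ
  have hstep' : ∀ k, S ((quadMap c)^[k + 1] z) ≤
      ‖2 * (quadMap c)^[k] z‖ * θ * S ((quadMap c)^[k] z) := fun k => by
    have h1 := horb (k + 1)
    rw [Function.iterate_succ_apply'] at h1 ⊢
    have h2 := hstep _ h1
    set w := (quadMap c)^[k] z
    have h2w : 0 < ‖2 * w‖ := by simpa using hne0 w h1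
    rw [← le_sub_iff_add_le, div_le_iff₀ h2w] at h2
    refine h2.trans ?_
    have h3 : S w / (2 * R) ≤ 1 := (div_le_one (by positivity)).2 (hSle w (horb k))
    have h4 : S w - δ / 2 ≤ θ * S w := by
      have : θ * S w = S w - δ / 2 * (S w / (2 * R)) := by rw [hθ]; ring
      rw [this]
      nlinarith
    nlinarith
  have hθ1 : θ < 1 := by
    have : 0 < δ / 2 / (2 * R) := by positivity
    linarith
  have hθ0 : 0 < θ := by
    have h1 := hstep' 0
    have h2 := hpos 0
    have h3 := hpos (0 + 1)
    by_contra hneg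
    push Not at hneg
    have : ‖2 * (quadMap c)^[0] z‖ * θ * S ((quadMap c)^[0] z) ≤ 0 := by
      have := mul_nonneg (norm_nonneg (2 * (quadMap c)^[0] z)) h2.le
      nlinarith
    linarith
  have hall : ∀ k, S ((quadMap c)^[k] z) ≤
      (∏ i ∈ Finset.range k, ‖2 * (quadMap c)^[i] z‖) * θ ^ k * S z := by
    intro k
    induction k with
    | zero => simp
    | succ k ih =>
      refine (hstep' k).trans ?_
      rw [Finset.prod_range_succ, pow_succ]
      calc _ ≤ ‖2 * (quadMap c)^[k] z‖ * θ *
            ((∏ i ∈ Finset.range k, ‖2 * (quadMap c)^[i] z‖) * θ ^ k * S z) := by gcongr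
        _ = _ := by ring
  have hfin := hall n
  rw [hper, ← norm_prod, ← deriv_iterate_quadMap] at hfin
  have h1 : 1 ≤ ‖deriv ((quadMap c)^[n]) z‖ * θ ^ n := by
    have := hpos 0
    simp only [Function.iterate_zero, id] at this
    exact le_of_mul_le_mul_right (by linarith) this
  have h2 : θ ^ n < 1 := pow_lt_one₀ hθ0.le hθ1 hn.ne'
  have h3 : 0 < θ ^ n := pow_pos hθ0 n
  by_contra hle
  push Not at hle
  nlinarith

/-! ### The polynomial of `n`-periodic points -/

/-- The polynomial `z ^ 2 + c`. -/
noncomputable def quadPoly (c : ℂ) : Polynomial ℂ := Polynomial.X ^ 2 + Polynomial.C c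

/-- The polynomial `f_c^n(z) - z`. -/
noncomputable def periodPoly (c : ℂ) (n : ℕ) : Polynomial ℂ :=
  (quadPoly c).comp^[n] Polynomial.X - Polynomial.X

lemma eval_iterate_quadPoly (c z : ℂ) (n : ℕ) :
    ((quadPoly c).comp^[n] Polynomial.X).eval z = (quadMap c)^[n] z := by
  rw [Polynomial.iterate_comp_eval, Polynomial.eval_X]
  congr 2
  ext z
  simp [quadPoly, quadMap]

lemma eval_periodPoly (c z : ℂ) (n : ℕ) :
    (periodPoly c n).eval z = (quadMap c)^[n] z - z := by
  rw [periodPoly, Polynomial.eval_sub, eval_iterate_quadPoly, Polynomial.eval_X]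

lemma natDegree_iterate_quadPoly (c : ℂ) (n : ℕ) :
    ((quadPoly c).comp^[n] Polynomial.X).natDegree = 2 ^ n := by
  rw [Polynomial.natDegree_iterate_comp, quadPoly, Polynomial.natDegree_X_pow_add_C,
    Polynomial.natDegree_X, mul_one]

lemma monic_iterate_quadPoly (c : ℂ) (n : ℕ) :
    ((quadPoly c).comp^[n] Polynomial.X).Monic := by
  induction n with
  | zero => exact Polynomial.monic_X
  | succ n ih =>
    rw [Function.iterate_succ_apply']
    refine (Polynomial.monic_X_pow_add_C c two_ne_zero).comp ih ?_
    rw [natDegree_iterate_quadPoly]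
    positivity

lemma natDegree_periodPoly (c : ℂ) {n : ℕ} (hn : 0 < n) : (periodPoly c n).natDegree = 2 ^ n := by
  rw [periodPoly, Polynomial.natDegree_sub_eq_left_of_natDegree_lt, natDegree_iterate_quadPoly]
  rw [natDegree_iterate_quadPoly, Polynomial.natDegree_X]
  exact Nat.one_lt_two_pow hn.ne'

lemma monic_periodPoly (c : ℂ) {n : ℕ} (hn : 0 < n) : (periodPoly c n).Monic := by
  refine (monic_iterate_quadPoly c n).sub_of_left (Polynomial.degree_lt_degree ?_)
  rw [natDegree_iterate_quadPoly, Polynomial.natDegree_X]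
  exact Nat.one_lt_two_pow hn.ne'

lemma mem_roots_periodPoly {c z : ℂ} {n : ℕ} (hn : 0 < n) :
    z ∈ (periodPoly c n).roots ↔ (quadMap c)^[n] z = z := by
  rw [Polynomial.mem_roots (monic_periodPoly c hn).ne_zero, Polynomial.IsRoot.def, eval_periodPoly,
    sub_eq_zero]

lemma eval_derivative_periodPoly (c z : ℂ) (n : ℕ) :
    (periodPoly c n).derivative.eval z = deriv ((quadMap c)^[n]) z - 1 := by
  rw [periodPoly, Polynomial.derivative_sub, Polynomial.derivative_X, Polynomial.eval_sub,
    Polynomial.eval_one, ← Polynomial.deriv]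
  congr 2
  ext w
  exact eval_iterate_quadPoly c w n

lemma rootMultiplicity_periodPoly_eq_one {c z : ℂ} {n : ℕ} (hn : 0 < n)
    (hz : (quadMap c)^[n] z = z) (h1 : deriv ((quadMap c)^[n]) z ≠ 1) :
    (periodPoly c n).rootMultiplicity z = 1 := by
  have hne := (monic_periodPoly c hn).ne_zero
  refine le_antisymm ?_ ?_
  · by_contra hlt
    push Not at hlt
    have := ((Polynomial.one_lt_rootMultiplicity_iff_isRoot hne).1 hlt).2
    rw [Polynomial.IsRoot.def, eval_derivative_periodPoly, sub_eq_zero] at this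
    exact h1 this
  · exact (Polynomial.rootMultiplicity_pos hne).2 (by
      rw [Polynomial.IsRoot.def, eval_periodPoly, hz, sub_self])

/-- A difference of squares: `f_c^n(f_c z) - f_c z = (f_c^n z) ^ 2 - z ^ 2`. At a nonzero periodic
point the second factor is `2 * z`, so it does not affect multiplicities. -/
lemma periodPoly_comp_quadPoly (c : ℂ) (n : ℕ) :
    (periodPoly c n).comp (quadPoly c) =
      periodPoly c n * ((quadPoly c).comp^[n] Polynomial.X + Polynomial.X) := by
  refine Polynomial.funext fun z => ?_
  have hq : (quadPoly c).eval z = quadMap c z := by simp [quadPoly, quadMap]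
  rw [Polynomial.eval_comp, hq, eval_periodPoly, Polynomial.eval_mul, eval_periodPoly,
    Polynomial.eval_add, eval_iterate_quadPoly, Polynomial.eval_X, ← Function.iterate_succ_apply,
    Function.iterate_succ_apply']
  simp only [quadMap]
  ring

/-- The multiplicity of `f_c^n(z) - z` is constant along cycles. -/
lemma rootMultiplicity_periodPoly_apply {c z : ℂ} {n : ℕ} (hn : 0 < n) (hz0 : z ≠ 0)
    (hz : (quadMap c)^[n] z = z) :
    (periodPoly c n).rootMultiplicity (quadMap c z) = (periodPoly c n).rootMultiplicity z := by
  set P := periodPoly c n with hP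
  have hne : P ≠ 0 := (monic_periodPoly c hn).ne_zero
  set w := quadMap c z with hw
  set m := P.rootMultiplicity w with hm
  obtain ⟨Q, hQ, hQw⟩ := Polynomial.exists_eq_pow_rootMultiplicity_mul_and_not_dvd P hne w
  have hcomp : P.comp (quadPoly c) = (Polynomial.X - Polynomial.C z) ^ m *
      ((Polynomial.X + Polynomial.C z) ^ m * Q.comp (quadPoly c)) := by
    conv_lhs => rw [hQ]
    rw [Polynomial.mul_comp, Polynomial.pow_comp, Polynomial.sub_comp, Polynomial.X_comp,
      Polynomial.C_comp, ← mul_assoc, ← mul_pow]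
    congr 2
    rw [hw, quadMap, quadPoly]
    simp only [Polynomial.C_add, Polynomial.C_pow]
    ring
  have hqe : (quadPoly c).eval z = w := by simp [quadPoly, hw, quadMap]
  have h2 : ¬ ((Polynomial.X + Polynomial.C z) ^ m * Q.comp (quadPoly c)).IsRoot z := by
    rw [Polynomial.IsRoot.def, Polynomial.eval_mul, Polynomial.eval_comp, hqe, mul_eq_zero, not_or]
    refine ⟨?_, fun h => hQw (Polynomial.dvd_iff_isRoot.2 h)⟩
    simp only [Polynomial.eval_pow, Polynomial.eval_add, Polynomial.eval_X, Polynomial.eval_C]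
    exact pow_ne_zero _ (by rw [← two_mul]; exact mul_ne_zero two_ne_zero hz0)
  have h3 : ¬ ((quadPoly c).comp^[n] Polynomial.X + Polynomial.X).IsRoot z := by
    rw [Polynomial.IsRoot.def, Polynomial.eval_add, eval_iterate_quadPoly, hz, Polynomial.eval_X,
      ← two_mul]
    exact mul_ne_zero two_ne_zero hz0
  have e1 : (P.comp (quadPoly c)).rootMultiplicity z = m := by
    have hne2 : (Polynomial.X - Polynomial.C z) ^ m *
        ((Polynomial.X + Polynomial.C z) ^ m * Q.comp (quadPoly c)) ≠ 0 := by
      refine mul_ne_zero (pow_ne_zero _ (Polynomial.X_sub_C_ne_zero z)) fun h => h2 ?_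
      rw [h]; exact Polynomial.eval_zero
    rw [hcomp, Polynomial.rootMultiplicity_mul hne2, Polynomial.rootMultiplicity_X_sub_C_pow,
      Polynomial.rootMultiplicity_eq_zero h2, add_zero]
  have e2 : (P.comp (quadPoly c)).rootMultiplicity z = P.rootMultiplicity z := by
    have hne2 : P * ((quadPoly c).comp^[n] Polynomial.X + Polynomial.X) ≠ 0 := by
      refine mul_ne_zero hne fun h => h3 ?_
      rw [h]; exact Polynomial.eval_zero
    rw [hP, periodPoly_comp_quadPoly, ← hP, Polynomial.rootMultiplicity_mul hne2,
      Polynomial.rootMultiplicity_eq_zero h3, add_zero]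
  rw [← e1, e2]

/-- The product of the norms of the `n`-periodic points. -/
lemma prod_norm_roots_periodPoly (c : ℂ) {n : ℕ} (hn : 0 < n) :
    ∏ z ∈ (periodPoly c n).roots.toFinset, ‖2 * z‖ ^ (periodPoly c n).rootMultiplicity z =
      2 ^ (2 ^ n) * ‖(quadMap c)^[n] 0‖ := by
  classical
  have hs : (periodPoly c n).Splits := IsAlgClosed.splits _
  have h1 := hs.eval_eq_prod_roots 0
  rw [(monic_periodPoly c hn).leadingCoeff, one_mul, eval_periodPoly, sub_zero,
    Finset.prod_multiset_map_count] at h1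
  have h2 : ∑ z ∈ (periodPoly c n).roots.toFinset, (periodPoly c n).rootMultiplicity z = 2 ^ n := by
    rw [← natDegree_periodPoly c hn, hs.natDegree_eq_card_roots,
      ← Multiset.toFinset_sum_count_eq]
    exact Finset.sum_congr rfl fun z _ => (Polynomial.count_roots _).symm
  rw [h1, norm_prod, ← h2, ← Finset.prod_pow_eq_pow_sum, ← Finset.prod_mul_distrib]
  refine Finset.prod_congr rfl fun z _ => ?_
  rw [Polynomial.count_roots, norm_pow, ← mul_pow, zero_sub, norm_neg, norm_mul, Complex.norm_two]

/-- Averaging over cycles: a product over non-repelling periodic points is at most one. -/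
lemma prod_norm_le_one_of_nonrepelling {c : ℂ} {n : ℕ} (hn : 0 < n) (S : Finset ℂ) (m : ℂ → ℕ)
    (hS : ∀ z ∈ S, (quadMap c)^[n] z = z) (hSf : ∀ z ∈ S, quadMap c z ∈ S)
    (hm : ∀ z ∈ S, m (quadMap c z) = m z)
    (h1 : ∀ z ∈ S, ‖deriv ((quadMap c)^[n]) z‖ ≤ 1) : ∏ z ∈ S, ‖2 * z‖ ^ m z ≤ 1 := by
  have hinj : InjOn (quadMap c) S := by
    intro x hx y hy hxy
    rw [← hS x hx, ← hS y hy, ← Nat.sub_add_cancel hn, Function.iterate_succ_apply,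
      Function.iterate_succ_apply, hxy]
  have hsurj : SurjOn (quadMap c) S S := Finset.surjOn_of_injOn_of_card_le _ hSf hinj le_rfl
  have hprod : ∀ i, ∏ z ∈ S, ‖2 * (quadMap c)^[i] z‖ ^ m z = ∏ z ∈ S, ‖2 * z‖ ^ m z := by
    intro i
    induction i with
    | zero => rfl
    | succ i ih =>
      rw [← ih]
      refine Finset.prod_nbij (quadMap c) hSf hinj hsurj fun z hz => ?_
      rw [hm z hz, Function.iterate_succ_apply]
  -- Each multiplier is a product of `n` factors `2 * f_c^i(z)`. As `f_c` permutes `S` and preserves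
  -- `m`, every `i` contributes the same product.
  have hpow : (∏ z ∈ S, ‖2 * z‖ ^ m z) ^ n = ∏ z ∈ S, ‖deriv ((quadMap c)^[n]) z‖ ^ m z := by
    simp only [deriv_iterate_quadMap, norm_prod, ← Finset.prod_pow (Finset.range n)]
    rw [Finset.prod_comm, Finset.prod_congr rfl fun i _ => hprod i,
      Finset.prod_const, Finset.card_range]
  have hle : (∏ z ∈ S, ‖2 * z‖ ^ m z) ^ n ≤ 1 := by
    rw [hpow]
    exact Finset.prod_le_one (fun _ _ => by positivity)
      fun z hz => pow_le_one₀ (norm_nonneg _) (h1 z hz)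
  exact (pow_le_one_iff_of_nonneg (by positivity) hn.ne').1 hle

/-! ### Elementary bounds -/

lemma norm_le_two_of_periodic {c z : ℂ} (hc : ‖c‖ ≤ 2) {n : ℕ} (hn : 0 < n)
    (hz : (quadMap c)^[n] z = z) : ‖z‖ ≤ 2 := by
  by_contra h
  push Not at h
  have hstep : ∀ w : ℂ, 2 < ‖w‖ → ‖w‖ < ‖quadMap c w‖ := fun w hw => by
    have h1 : ‖w‖ ^ 2 ≤ ‖quadMap c w‖ + ‖c‖ := by
      have := norm_sub_le (quadMap c w) c
      rwa [quadMap, add_sub_cancel_right, norm_pow] at this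
    nlinarith
  have hind : ∀ k, ‖z‖ < ‖(quadMap c)^[k + 1] z‖ := by
    intro k
    induction k with
    | zero => simpa using hstep z h
    | succ k ih =>
      rw [Function.iterate_succ_apply']
      exact ih.trans (hstep _ (h.trans ih))
  have := hind (n - 1)
  rw [Nat.sub_add_cancel hn, hz] at this
  exact lt_irrefl _ this

lemma two_lt_norm_iterate {c w : ℂ} (hc : ‖c‖ ≤ 2) (hw : 2 < ‖w‖) (k : ℕ) :
    2 < ‖(quadMap c)^[k] w‖ := by
  induction k with
  | zero => exact hw
  | succ k ih =>
    rw [Function.iterate_succ_apply']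
    set v := (quadMap c)^[k] w
    have h1 : ‖v‖ ^ 2 ≤ ‖quadMap c v‖ + ‖c‖ := by
      have := norm_sub_le (quadMap c v) c
      rwa [quadMap, add_sub_cancel_right, norm_pow] at this
    nlinarith

/-- If `|c| > 2`, all cycles are repelling. -/
lemma one_lt_norm_deriv_of_two_lt {c z : ℂ} (hc : 2 < ‖c‖) {n : ℕ} (hn : 0 < n)
    (hz : (quadMap c)^[n] z = z) : 1 < ‖deriv ((quadMap c)^[n]) z‖ := by
  have hzc : z ∈ Metric.ball (0 : ℂ) ‖c‖ := by
    rw [mem_ball_zero_iff]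
    by_contra h
    push Not at h
    have hstep : ∀ w : ℂ, ‖c‖ ≤ ‖w‖ → ‖w‖ < ‖quadMap c w‖ := fun w hw => by
      have h1 : ‖w‖ ^ 2 ≤ ‖quadMap c w‖ + ‖c‖ := by
        have := norm_sub_le (quadMap c w) c
        rwa [quadMap, add_sub_cancel_right, norm_pow] at this
      nlinarith
    have hind : ∀ k, ‖z‖ < ‖(quadMap c)^[k + 1] z‖ := by
      intro k
      induction k with
      | zero => simpa using hstep z h
      | succ k ih =>
        rw [Function.iterate_succ_apply']
        exact ih.trans (hstep _ (h.trans ih.le))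
    have := hind (n - 1)
    rw [Nat.sub_add_cancel hn, hz] at this
    exact lt_irrefl _ this
  -- The critical value lies on the boundary of this disc, and points of the closed preimage satisfy
  -- `‖w‖ ^ 2 ≤ 2 * ‖c‖ < ‖c‖ ^ 2`.
  refine one_lt_norm_deriv_of_closure_preimage_subset (Ω := Metric.ball 0 ‖c‖) Metric.isOpen_ball
    subset_rfl (by simp) ?_ hn hzc hz
  intro w hw
  have hcl : IsClosed {w : ℂ | ‖quadMap c w‖ ≤ ‖c‖} :=
    isClosed_le (by unfold quadMap; fun_prop) continuous_const
  have hsub : quadMap c ⁻¹' Metric.ball 0 ‖c‖ ⊆ {w : ℂ | ‖quadMap c w‖ ≤ ‖c‖} := fun w hw => by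
    rw [mem_preimage, mem_ball_zero_iff] at hw
    exact hw.le
  have h2 : ‖quadMap c w‖ ≤ ‖c‖ := closure_minimal hsub hcl hw
  have h1 : ‖w‖ ^ 2 ≤ ‖quadMap c w‖ + ‖c‖ := by
    have := norm_sub_le (quadMap c w) c
    rwa [quadMap, add_sub_cancel_right, norm_pow] at this
  rw [mem_ball_zero_iff]
  nlinarith [norm_nonneg w]

/-! ### A nearly periodic critical orbit -/

/-- If `f_c^n(0)` is very small, there is one attracting cycle near the critical orbit, and all
other cycles are repelling. -/
lemma exists_finset_attracting {c : ℂ} (hc : ‖c‖ ≤ 2) {n : ℕ} (hn : 2 ≤ n) {q r η : ℝ}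
    (hq : 4 ≤ q) (hr : 0 < r) (hrη : r ^ 2 < η) (h1 : ‖(quadMap c)^[n] 0‖ + η * q ^ (n - 1) ≤ r)
    (h2 : 4 + 2 * (η * q ^ (n - 1)) ≤ q) (h3 : 2 * r * q ^ (n - 1) < 1) :
    ∃ T : Finset ℂ, T.card ≤ n ∧ ∀ z, (quadMap c)^[n] z = z →
      1 < ‖deriv ((quadMap c)^[n]) z‖ ∨ (z ∈ T ∧ ‖deriv ((quadMap c)^[n]) z‖ < 1) := by
  classical
  have hη : 0 < η := (sq_nonneg r).trans_lt hrη
  have hq1 : 1 ≤ q := by linarith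
  have hηq : ∀ i, 0 < η * q ^ i := fun i => by positivity
  have hηle : ∀ i, i ≤ n - 1 → η * q ^ i ≤ η * q ^ (n - 1) := fun i hi => by gcongr
  have hr1 : r < 1 := by
    have : 1 ≤ q ^ (n - 1) := one_le_pow₀ hq1
    nlinarith
  have horb : ∀ i, i ≤ n → ‖(quadMap c)^[i] 0‖ ≤ 2 := fun i hi => by
    by_contra h
    push Not at h
    have := two_lt_norm_iterate hc h (n - i)
    rw [← Function.iterate_add_apply, Nat.sub_add_cancel hi] at this
    linarith [hηq (n - 1)]
  -- Radii of discs about the critical orbit. Squaring sends the disc of radius `r` about `0` into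
  -- one of radius `η > r ^ 2` about `c`. Each later step multiplies the radius by at most `q`, and
  -- by `h1` the last image lies in the first disc.
  set ρ : ℕ → ℝ := fun i => if i = 0 then r else η * q ^ (i - 1) with hρ
  have hρpos : ∀ i, 0 < ρ i := fun i => by
    simp only [hρ]; split_ifs
    · exact hr
    · exact hηq _
  -- one step of the critical orbit
  have hstep : ∀ i, i < n → ∀ z ∈ Metric.closedBall ((quadMap c)^[i] 0) (ρ i),
      quadMap c z ∈ Metric.ball ((quadMap c)^[i + 1] 0) (η * q ^ i) := by
    intro i hi z hz
    rw [mem_closedBall_iff_norm] at hz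
    rw [mem_ball_iff_norm, Function.iterate_succ_apply']
    rcases Nat.eq_zero_or_pos i with rfl | hpos
    · simp only [Function.iterate_zero, id, sub_zero, hρ, if_true] at hz
      have : quadMap c z - quadMap c 0 = z ^ 2 := by simp [quadMap]
      rw [Function.iterate_zero, id, this, norm_pow, pow_zero, mul_one]
      nlinarith [norm_nonneg z]
    · set w := (quadMap c)^[i] 0 with hw
      have hw2 := horb i hi.le
      rw [← hw] at hw2
      have hρi : ρ i = η * q ^ (i - 1) := by simp [hρ, hpos.ne']
      rw [hρi] at hz
      have hfac : quadMap c z - quadMap c w = (z - w) * ((z - w) + 2 * w) := by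
        simp only [quadMap]; ring
      have hle := hηle (i - 1) (by omega)
      have hqi : q ^ i = q ^ (i - 1) * q := by rw [← pow_succ, Nat.sub_add_cancel hpos]
      have h5 : ‖(z - w) + 2 * w‖ < q := by
        have := norm_add_le (z - w) (2 * w)
        rw [norm_mul, Complex.norm_two] at this
        linarith [hηq (n - 1), hηq (i - 1)]
      rw [hfac, norm_mul, hqi, ← mul_assoc]
      exact (mul_le_mul_of_nonneg_right hz (norm_nonneg _)).trans_lt
        (mul_lt_mul_of_pos_left h5 (hηq _))
  have hlast : ∀ z ∈ Metric.ball ((quadMap c)^[n] 0) (η * q ^ (n - 1)), z ∈ Metric.ball 0 r := by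
    intro z hz
    rw [mem_ball_iff_norm] at hz
    rw [mem_ball_zero_iff]
    have := norm_le_norm_add_norm_sub' z ((quadMap c)^[n] 0)
    linarith
  set K : ℕ → Set ℂ := fun i => Metric.closedBall ((quadMap c)^[i] 0) (ρ i) with hK
  have hK0 : K 0 = Metric.closedBall 0 r := by simp [hK, hρ]
  have hstepK : ∀ i, i < n → ∀ z ∈ K i, quadMap c z ∈ interior (K ((i + 1) % n)) := by
    intro i hi z hz
    have h5 := hstep i hi z hz
    rcases Nat.lt_or_ge (i + 1) n with h | h
    · rw [Nat.mod_eq_of_lt h]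
      refine Metric.ball_subset_interior_closedBall ?_
      simpa [hρ] using h5
    · have hin : i + 1 = n := by omega
      rw [hin, Nat.mod_self, hK0]
      refine Metric.ball_subset_interior_closedBall (hlast _ ?_)
      have : i = n - 1 := by omega
      rw [hin] at h5
      rwa [← this]
  set L : Set ℂ := ⋃ i ∈ Finset.range n, K i with hL
  have hKL : ∀ i, i < n → K i ⊆ L := fun i hi =>
    subset_iUnion₂_of_subset i (Finset.mem_range.2 hi) subset_rfl
  have hLmem : ∀ z, z ∈ L → ∃ i, i < n ∧ z ∈ K i := fun z hz => by
    simp only [hL, mem_iUnion, Finset.mem_range] at hz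
    obtain ⟨i, hi, hz⟩ := hz
    exact ⟨i, hi, hz⟩
  have hLint : ∀ z ∈ L, quadMap c z ∈ interior L := fun z hz => by
    obtain ⟨i, hi, hz⟩ := hLmem z hz
    exact interior_mono (hKL _ (Nat.mod_lt _ (by omega))) (hstepK i hi z hz)
  have hLcl : IsClosed L :=
    (Finset.finite_toSet _).isClosed_biUnion fun i _ => Metric.isClosed_closedBall
  -- periodic points off the trap
  have hout : ∀ z, (quadMap c)^[n] z = z → z ∉ L → 1 < ‖deriv ((quadMap c)^[n]) z‖ := by
    intro z hz hzL
    -- The trap `L` is mapped into its own interior, so the preimage of its complement is relatively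
    -- compact in the complement. The critical value is in `L`, being the centre of the disc with
    -- index `1`.
    refine one_lt_norm_deriv_of_closure_preimage_subset (Ω := Metric.ball 0 3 \ L) (R := 3)
      (Metric.isOpen_ball.sdiff hLcl) sdiff_subset ?_ ?_ (by omega) ⟨?_, hzL⟩ hz
    · rintro ⟨-, hcL⟩
      refine hcL (hKL 1 (by omega) ?_)
      have : c = (quadMap c)^[1] 0 := by simp [quadMap]
      simp only [hK]
      rw [← this]
      exact Metric.mem_closedBall_self (hρpos 1).le
    · intro w hw
      have hcont : Continuous (quadMap c) := by unfold quadMap; fun_prop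
      have hcl : IsClosed (quadMap c ⁻¹' (Metric.closedBall 0 3 \ interior L)) :=
        (Metric.isClosed_closedBall.sdiff isOpen_interior).preimage hcont
      have hw' := closure_minimal (preimage_mono (sdiff_subset_sdiff Metric.ball_subset_closedBall
        interior_subset)) hcl hw
      refine ⟨?_, fun hwL => hw'.2 (hLint w hwL)⟩
      have h6 := hw'.1
      rw [mem_closedBall_zero_iff] at h6
      have h7 : ‖w‖ ^ 2 ≤ ‖quadMap c w‖ + ‖c‖ := by
        have := norm_sub_le (quadMap c w) c
        rwa [quadMap, add_sub_cancel_right, norm_pow] at this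
      rw [mem_ball_zero_iff]
      nlinarith [norm_nonneg w]
    · rw [mem_ball_zero_iff]
      linarith [norm_le_two_of_periodic hc (by omega) hz]
  -- tracking the critical orbit
  have htrack : ∀ z ∈ Metric.closedBall (0 : ℂ) r, ∀ i, i < n →
      (quadMap c)^[i + 1] z ∈ Metric.closedBall ((quadMap c)^[i + 1] 0) (η * q ^ i) := by
    intro z hz i
    induction i with
    | zero =>
      intro hi
      refine Metric.ball_subset_closedBall (hstep 0 hi z ?_)
      rwa [← hK0] at hz
    | succ i ih =>
      intro hi
      rw [Function.iterate_succ_apply' _ (i + 1) z]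
      refine Metric.ball_subset_closedBall (hstep (i + 1) hi _ ?_)
      simpa [hρ] using ih (by omega)
  have hnorm : ∀ z ∈ Metric.closedBall (0 : ℂ) r, ∀ i, i + 1 < n →
      2 * ‖(quadMap c)^[i + 1] z‖ ≤ q := by
    intro z hz i hi
    have h5 := htrack z hz i (by omega)
    rw [mem_closedBall_iff_norm] at h5
    have h6 := norm_le_norm_add_norm_sub' ((quadMap c)^[i + 1] z) ((quadMap c)^[i + 1] 0)
    linarith [horb (i + 1) hi.le, hηle i (by omega)]
  have hcontr : ∀ z ∈ Metric.closedBall (0 : ℂ) r, ∀ w ∈ Metric.closedBall (0 : ℂ) r, ∀ i, i < n →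
      ‖(quadMap c)^[i + 1] z - (quadMap c)^[i + 1] w‖ ≤ 2 * r * q ^ i * ‖z - w‖ := by
    intro z hz w hw i
    induction i with
    | zero =>
      intro _
      rw [mem_closedBall_zero_iff] at hz hw
      have : quadMap c z - quadMap c w = (z + w) * (z - w) := by simp only [quadMap]; ring
      simp only [zero_add, Function.iterate_one, pow_zero, mul_one]
      rw [this, norm_mul]
      gcongr
      linarith [norm_add_le z w]
    | succ i ih =>
      intro hi
      rw [Function.iterate_succ_apply' _ (i + 1), Function.iterate_succ_apply' _ (i + 1)]
      have hz2 := hnorm z hz i hi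
      have hw2 := hnorm w hw i hi
      have ih' := ih (by omega)
      set a := (quadMap c)^[i + 1] z
      set b := (quadMap c)^[i + 1] w
      have : quadMap c a - quadMap c b = (a + b) * (a - b) := by simp only [quadMap]; ring
      rw [this, norm_mul, pow_succ]
      calc ‖a + b‖ * ‖a - b‖ ≤ q * (2 * r * q ^ i * ‖z - w‖) := by
            gcongr
            linarith [norm_add_le a b]
        _ = _ := by ring
  -- By `h3` the `n`-th iterate contracts distances in the disc about `0`, so it has at most one
  -- fixed point there. Every `n`-periodic point of the trap lies on the orbit of that point.
  have huniq : ∀ z ∈ Metric.closedBall (0 : ℂ) r, ∀ w ∈ Metric.closedBall (0 : ℂ) r,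
      (quadMap c)^[n] z = z → (quadMap c)^[n] w = w → z = w := by
    intro z hz w hw hzn hwn
    have h5 := hcontr z hz w hw (n - 1) (by omega)
    rw [Nat.sub_add_cancel (by omega), hzn, hwn] at h5
    by_contra hne
    have : 0 < ‖z - w‖ := norm_sub_pos_iff.2 hne
    nlinarith
  have hatt : ∀ z ∈ Metric.closedBall (0 : ℂ) r, ‖deriv ((quadMap c)^[n]) z‖ < 1 := by
    intro z hz
    obtain ⟨k, rfl⟩ : ∃ k, n = k + 1 := ⟨n - 1, by omega⟩
    rw [deriv_iterate_quadMap, norm_prod, Finset.prod_range_succ']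
    have h5 : ∏ i ∈ Finset.range k, ‖2 * (quadMap c)^[i + 1] z‖ ≤ q ^ k := by
      refine (Finset.prod_le_prod (fun _ _ => norm_nonneg _) (g := fun _ => q) fun i hi => ?_).trans
        (by simp)
      rw [norm_mul, Complex.norm_two]
      exact hnorm z hz i (by simpa using hi)
    have h6 : ‖2 * (quadMap c)^[0] z‖ ≤ 2 * r := by
      rw [mem_closedBall_zero_iff] at hz
      simpa using hz
    calc _ ≤ q ^ k * (2 * r) := by gcongr
      _ < 1 := by rw [mul_comm]; simpa using h3
  -- periodic points in the trap
  have henter : ∀ d i, i + d = n → 0 < d → ∀ z ∈ K i,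
      (quadMap c)^[d] z ∈ Metric.closedBall 0 r := by
    intro d
    induction d with
    | zero => intro i _ h; exact absurd h (lt_irrefl 0)
    | succ d ih =>
      intro i hi _ z hz
      have h5 := interior_subset (hstepK i (by omega) z hz)
      rw [Function.iterate_succ_apply]
      rcases Nat.eq_zero_or_pos d with rfl | hd
      · rw [show i + 1 = n by omega, Nat.mod_self, hK0] at h5
        exact h5
      · rw [Nat.mod_eq_of_lt (by omega)] at h5
        exact ih (i + 1) (by omega) hd _ h5
  have hret : ∀ z, (quadMap c)^[n] z = z → z ∈ L → ∃ i, i < n ∧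
      ∃ w ∈ Metric.closedBall (0 : ℂ) r, (quadMap c)^[n] w = w ∧ z = (quadMap c)^[i] w := by
    intro z hz hzL
    obtain ⟨i, hi, hzi⟩ := hLmem z hzL
    refine ⟨i, hi, (quadMap c)^[n - i] z, henter (n - i) i (by omega) (by omega) z hzi, ?_, ?_⟩
    · rw [← Function.iterate_add_apply, add_comm, Function.iterate_add_apply, hz]
    · rw [← Function.iterate_add_apply, Nat.add_sub_cancel' hi.le, hz]
  by_cases hp : ∃ p ∈ Metric.closedBall (0 : ℂ) r, (quadMap c)^[n] p = p
  · obtain ⟨p, hpr, hpn⟩ := hp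
    refine ⟨(Finset.range n).image fun i => (quadMap c)^[i] p,
      Finset.card_image_le.trans (by simp), fun z hz => ?_⟩
    by_cases hzL : z ∈ L
    · right
      obtain ⟨i, hi, w, hw, hwn, rfl⟩ := hret z hz hzL
      obtain rfl := huniq w hw p hpr hwn hpn
      refine ⟨Finset.mem_image.2 ⟨i, Finset.mem_range.2 hi, rfl⟩, ?_⟩
      rw [deriv_iterate_cycle hwn]
      exact hatt w hw
    · exact Or.inl (hout z hz hzL)
  · refine ⟨∅, by simp, fun z hz => Or.inl (hout z hz fun hzL => hp ?_)⟩
    obtain ⟨-, -, w, hw, hwn, -⟩ := hret z hz hzL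
    exact ⟨w, hw, hwn⟩

/-! ### Repelling cycles of period at least four -/

/-- The periodic points whose period is a proper divisor of `n`. -/
noncomputable def lowPts (c : ℂ) (n : ℕ) : Finset ℂ :=
  n.properDivisors.biUnion fun d => (periodPoly c d).roots.toFinset

lemma mem_lowPts {c z : ℂ} {n : ℕ} :
    z ∈ lowPts c n ↔ ∃ d ∈ n.properDivisors, (quadMap c)^[d] z = z := by
  simp only [lowPts, Finset.mem_biUnion, Multiset.mem_toFinset]
  refine exists_congr fun d => and_congr_right fun hd => ?_
  exact mem_roots_periodPoly (Nat.pos_of_mem_properDivisors hd)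

/-- Proper divisors of `n` are at most `n / 2`, and period `d` contributes at most `2 ^ d` points.
The bound is the sum of a geometric series. -/
lemma card_lowPts_le (c : ℂ) (n : ℕ) : (lowPts c n).card + 2 ≤ 2 ^ (n / 2 + 1) := by
  have h1 : (lowPts c n).card ≤ ∑ d ∈ n.properDivisors, 2 ^ d := by
    refine Finset.card_biUnion_le.trans (Finset.sum_le_sum fun d hd => ?_)
    refine (Multiset.toFinset_card_le _).trans ((Polynomial.card_roots' _).trans ?_)
    rw [natDegree_periodPoly c (Nat.pos_of_mem_properDivisors hd)]
  have h2 : n.properDivisors ⊆ Finset.Ico 1 (n / 2 + 1) := by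
    intro d hd
    obtain ⟨⟨k, hk⟩, hlt⟩ := Nat.mem_properDivisors.1 hd
    have hpos := Nat.pos_of_mem_properDivisors hd
    have hk2 : 2 ≤ k := by
      by_contra h
      interval_cases k <;> omega
    rw [Finset.mem_Ico]
    refine ⟨hpos, Nat.lt_succ_of_le ((Nat.le_div_iff_mul_le two_pos).2 ?_)⟩
    rw [hk]; gcongr
  have h3 := Finset.sum_le_sum_of_subset (f := fun d => 2 ^ d) h2
  have h4 : ∀ m : ℕ, ∑ d ∈ Finset.Ico 1 (m + 1), 2 ^ d + 2 = 2 ^ (m + 1) := by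
    intro m
    induction m with
    | zero => simp
    | succ m ih =>
      rw [Finset.sum_Ico_succ_top (by omega), pow_succ 2 (m + 1)]
      omega
  have := h4 (n / 2)
  omega

/-- Without repelling cycles of exact period `n`, the critical point is nearly `n`-periodic. -/
lemma norm_iterate_zero_le_of_no_repelling {c : ℂ} {n : ℕ} (hn : 0 < n)
    (hno : ∀ z, Function.minimalPeriod (quadMap c) z = n → ‖deriv ((quadMap c)^[n]) z‖ ≤ 1) :
    2 ^ (2 ^ n) * ‖(quadMap c)^[n] 0‖ ≤ ∏ z ∈ lowPts c n, max 1 ‖2 * z‖ := by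
  classical
  have hone : 1 ≤ ∏ z ∈ lowPts c n, max 1 ‖2 * z‖ :=
    Finset.one_le_prod fun z _ => le_max_left _ _
  -- When the critical point is itself `n`-periodic, constancy of multiplicities along cycles is not
  -- available, but the left-hand side is zero.
  rcases eq_or_ne ((quadMap c)^[n] 0) 0 with h0 | h0
  · rw [h0, norm_zero, mul_zero]; linarith
  set P := periodPoly c n with hP
  set S := P.roots.toFinset with hS
  have hSmem : ∀ z, z ∈ S ↔ (quadMap c)^[n] z = z := fun z => by
    rw [hS, Multiset.mem_toFinset, hP, mem_roots_periodPoly hn]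
  rw [← prod_norm_roots_periodPoly c hn, ← hP, ← hS,
    ← Finset.prod_filter_mul_prod_filter_not S (fun z => ‖deriv ((quadMap c)^[n]) z‖ ≤ 1)]
  have hA : ∏ z ∈ S with ‖deriv ((quadMap c)^[n]) z‖ ≤ 1, ‖2 * z‖ ^ P.rootMultiplicity z ≤ 1 := by
    refine prod_norm_le_one_of_nonrepelling (c := c) hn _ _ (fun z hz => ?_) (fun z hz => ?_)
      (fun z hz => ?_) fun z hz => ?_
    all_goals rw [Finset.mem_filter, hSmem] at hz
    · exact hz.1
    · rw [Finset.mem_filter, hSmem, ← Function.iterate_succ_apply, Function.iterate_succ_apply',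
        hz.1]
      exact ⟨rfl, by simpa using (deriv_iterate_cycle hz.1 1).symm ▸ hz.2⟩
    · refine rootMultiplicity_periodPoly_apply hn ?_ hz.1
      rintro rfl
      exact h0 hz.1
    · exact hz.2
  -- Repelling `n`-periodic points have smaller exact period by hypothesis. They are simple roots
  -- because their multiplier is not one.
  have hB : ∏ z ∈ S with ¬ ‖deriv ((quadMap c)^[n]) z‖ ≤ 1, ‖2 * z‖ ^ P.rootMultiplicity z ≤
      ∏ z ∈ lowPts c n, max 1 ‖2 * z‖ := by
    have hsub : S.filter (fun z => ¬ ‖deriv ((quadMap c)^[n]) z‖ ≤ 1) ⊆ lowPts c n := by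
      intro z hz
      rw [Finset.mem_filter, hSmem] at hz
      have hdvd : Function.minimalPeriod (quadMap c) z ∣ n :=
        Function.IsPeriodicPt.minimalPeriod_dvd hz.1
      refine mem_lowPts.2 ⟨Function.minimalPeriod (quadMap c) z, Nat.mem_properDivisors.2
        ⟨hdvd, lt_of_le_of_ne (Nat.le_of_dvd hn hdvd) fun h => hz.2 (hno z h)⟩,
        Function.iterate_minimalPeriod⟩
    rw [← Finset.prod_sdiff hsub]
    have h1 : ∏ z ∈ S with ¬ ‖deriv ((quadMap c)^[n]) z‖ ≤ 1, ‖2 * z‖ ^ P.rootMultiplicity z ≤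
        ∏ z ∈ S with ¬ ‖deriv ((quadMap c)^[n]) z‖ ≤ 1, max 1 ‖2 * z‖ := by
      refine Finset.prod_le_prod (fun _ _ => by positivity) fun z hz => ?_
      rw [Finset.mem_filter, hSmem] at hz
      rw [hP, rootMultiplicity_periodPoly_eq_one hn hz.1, pow_one]
      · exact le_max_right _ _
      · intro h
        exact hz.2 (by rw [h]; simp)
    refine h1.trans (le_mul_of_one_le_left (Finset.prod_nonneg fun _ _ => by positivity) ?_)
    exact Finset.one_le_prod fun z _ => le_max_left _ _
  calc _ ≤ 1 * ∏ z ∈ lowPts c n, max 1 ‖2 * z‖ := by gcongr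
    _ = _ := one_mul _

/-- If at most `n` of the `n`-periodic points are attracting and the others are repelling, there is
a repelling cycle of exact period `n`. -/
lemma exists_repelling_of_forall {c : ℂ} {n : ℕ} (hn : 4 ≤ n) {T : Finset ℂ} (hT : T.card ≤ n)
    (hall : ∀ z, (quadMap c)^[n] z = z →
      1 < ‖deriv ((quadMap c)^[n]) z‖ ∨ (z ∈ T ∧ ‖deriv ((quadMap c)^[n]) z‖ < 1)) :
    ∃ z, Function.minimalPeriod (quadMap c) z = n ∧ 1 < ‖deriv ((quadMap c)^[n]) z‖ := by
  classical
  by_contra! hno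
  have hn0 : 0 < n := by omega
  -- No multiplier equals one, so all roots are simple. The `2 ^ n` points are too many to be
  -- covered by `T` and the points of lower period.
  have hcard : (periodPoly c n).roots.toFinset.card = 2 ^ n := by
    rw [← natDegree_periodPoly c hn0, (IsAlgClosed.splits (periodPoly c n)).natDegree_eq_card_roots,
      Multiset.toFinset_card_of_nodup]
    refine Multiset.nodup_iff_count_le_one.2 fun z => ?_
    rw [Polynomial.count_roots]
    by_cases hz : (quadMap c)^[n] z = z
    · refine (rootMultiplicity_periodPoly_eq_one hn0 hz fun h => ?_).le
      rcases hall z hz with h' | ⟨-, h'⟩ <;> simp [h] at h'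
    · rw [Polynomial.rootMultiplicity_eq_zero]
      · exact zero_le_one
      · rwa [Polynomial.IsRoot.def, eval_periodPoly, sub_eq_zero]
  have hsub : (periodPoly c n).roots.toFinset ⊆ T ∪ lowPts c n := by
    intro z hz
    rw [Multiset.mem_toFinset, mem_roots_periodPoly hn0] at hz
    rcases hall z hz with h' | ⟨h', -⟩
    · refine Finset.mem_union_right _ (mem_lowPts.2 ⟨Function.minimalPeriod (quadMap c) z,
        Nat.mem_properDivisors.2 ⟨Function.IsPeriodicPt.minimalPeriod_dvd hz, ?_⟩,
        Function.iterate_minimalPeriod⟩)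
      refine lt_of_le_of_ne (Nat.le_of_dvd hn0 (Function.IsPeriodicPt.minimalPeriod_dvd hz))
        fun h => ?_
      exact absurd h' (not_lt.2 (hno z h))
    · exact Finset.mem_union_left _ h'
  have h4 := (Finset.card_le_card hsub).trans (Finset.card_union_le _ _)
  rw [hcard] at h4
  have h5 := card_lowPts_le c n
  have h6 : n + 2 ^ (n / 2 + 1) < 2 ^ n + 2 := by
    have h7 : 2 ^ (n / 2 + 1) ≤ 2 ^ (n - 1) := Nat.pow_le_pow_right (by norm_num) (by omega)
    have h8 : 2 ^ n = 2 * 2 ^ (n - 1) := by rw [← pow_succ', Nat.sub_add_cancel hn0]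
    have h9 : n - 1 < 2 ^ (n - 1) := Nat.lt_two_pow_self
    omega
  omega

lemma max_norm_mul_le {a b : ℂ} (ha : ‖a‖ ≤ 2) (hb : ‖b‖ ≤ 2) {B : ℝ} (hB : 4 ≤ B)
    (hab : ‖2 * a‖ * ‖2 * b‖ ≤ B) : max 1 ‖2 * a‖ * max 1 ‖2 * b‖ ≤ B := by
  rw [norm_mul, norm_mul, Complex.norm_two] at *
  rcases max_cases 1 (2 * ‖a‖) with ⟨h1, -⟩ | ⟨h1, -⟩ <;>
    rcases max_cases 1 (2 * ‖b‖) with ⟨h2, -⟩ | ⟨h2, -⟩ <;> rw [h1, h2] <;> linarith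

/-- The fixed points are `a`, `1 - a` with product `c`; the points of period two are `b`, `-1 - b`.
The relation `a * (1 - a) = c` saves a factor two over the bound `4 ^ 4`, which is just too weak:
with `q ≥ 4` and `‖f_c^4(0)‖ = 1 / 256`, no `r` satisfies the hypotheses of
`exists_finset_attracting`. -/
lemma prod_lowPts_four_le {c : ℂ} (hc : ‖c‖ ≤ 2) :
    ∏ z ∈ lowPts c 4, max 1 ‖2 * z‖ ≤ 128 := by
  classical
  obtain ⟨s, hs⟩ := IsAlgClosed.exists_eq_mul_self (1 - 4 * c)
  obtain ⟨t, ht⟩ := IsAlgClosed.exists_eq_mul_self (-3 - 4 * c)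
  set a := (1 + s) / 2 with ha
  set b := (-1 + t) / 2 with hb
  have hprod1 : a * (1 - a) = c := by rw [ha]; linear_combination (1 / 4) * hs
  have hprod2 : b * (-1 - b) = c + 1 := by rw [hb]; linear_combination (1 / 4) * ht
  have hfix : ∀ z : ℂ, z * z - z + c = 0 → ‖z‖ ≤ 2 := fun z hz =>
    norm_le_two_of_periodic hc (n := 1) one_pos (by
      simp only [Function.iterate_one, quadMap]; linear_combination hz)
  have hper : ∀ z : ℂ, z * z + z + c + 1 = 0 → ‖z‖ ≤ 2 := fun z hz =>
    norm_le_two_of_periodic hc (n := 2) two_pos (by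
      simp only [Function.iterate_succ, Function.iterate_zero, Function.comp, id, quadMap]
      linear_combination (z * z - z + c) * hz)
  have ha2 := hfix a (by linear_combination -hprod1)
  have ha2' := hfix (1 - a) (by linear_combination -hprod1)
  have hb2 := hper b (by linear_combination -hprod2)
  have hb2' := hper (-1 - b) (by linear_combination -hprod2)
  have hsub : lowPts c 4 ⊆ ({a, 1 - a} ∪ {b, -1 - b} : Finset ℂ) := by
    intro z hz
    obtain ⟨d, hd, hdz⟩ := mem_lowPts.1 hz
    have h2 : (quadMap c)^[2] z = z := by
      have hd2 : d ∣ 2 := by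
        have : Nat.properDivisors 4 = {1, 2} := by decide
        rw [this] at hd
        simp only [Finset.mem_insert, Finset.mem_singleton] at hd
        rcases hd with rfl | rfl <;> norm_num
      have : Function.IsPeriodicPt (quadMap c) d z := hdz
      exact this.trans_dvd hd2
    simp only [Function.iterate_succ, Function.iterate_zero, Function.comp, id, quadMap] at h2
    have h3 : ((z - a) * (z - (1 - a))) * ((z - b) * (z - (-1 - b))) = 0 := by
      have e1 : (z - a) * (z - (1 - a)) = z * z - z + c := by linear_combination hprod1
      have e2 : (z - b) * (z - (-1 - b)) = z * z + z + c + 1 := by linear_combination hprod2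
      rw [e1, e2]
      linear_combination h2
    simp only [mul_eq_zero, sub_eq_zero] at h3
    simp only [Finset.mem_union, Finset.mem_insert, Finset.mem_singleton]
    exact h3
  have hone : ∀ z : ℂ, 1 ≤ max 1 ‖2 * z‖ := fun z => le_max_left _ _
  have hmono : ∀ A B : Finset ℂ, A ⊆ B →
      ∏ z ∈ A, max 1 ‖2 * z‖ ≤ ∏ z ∈ B, max 1 ‖2 * z‖ := fun A B hAB => by
    rw [← Finset.prod_sdiff hAB]
    exact le_mul_of_one_le_left (Finset.prod_nonneg fun _ _ => by positivity)
      (Finset.one_le_prod fun z _ => hone z)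
  have hunion : ∀ A B : Finset ℂ, ∏ z ∈ A ∪ B, max 1 ‖2 * z‖ ≤
      (∏ z ∈ A, max 1 ‖2 * z‖) * ∏ z ∈ B, max 1 ‖2 * z‖ := fun A B => by
    rw [← Finset.prod_union_inter]
    exact le_mul_of_one_le_right (Finset.prod_nonneg fun _ _ => by positivity)
      (Finset.one_le_prod fun z _ => hone z)
  have hpair : ∀ x y : ℂ, ∏ z ∈ ({x, y} : Finset ℂ), max 1 ‖2 * z‖ ≤
      max 1 ‖2 * x‖ * max 1 ‖2 * y‖ := fun x y => by
    have := hunion {x} {y}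
    simpa using this
  have hA : max 1 ‖2 * a‖ * max 1 ‖2 * (1 - a)‖ ≤ 8 := by
    refine max_norm_mul_le ha2 ha2' (by norm_num) ?_
    rw [← norm_mul, show 2 * a * (2 * (1 - a)) = 4 * c by linear_combination 4 * hprod1, norm_mul]
    norm_num
    linarith
  have hB : max 1 ‖2 * b‖ * max 1 ‖2 * (-1 - b)‖ ≤ 16 := by
    refine max_norm_mul_le hb2 hb2' (by norm_num) ?_
    rw [norm_mul, norm_mul, Complex.norm_two]
    nlinarith [norm_nonneg b, norm_nonneg (-1 - b)]
  calc _ ≤ _ := hmono _ _ hsub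
    _ ≤ _ := hunion _ _
    _ ≤ (max 1 ‖2 * a‖ * max 1 ‖2 * (1 - a)‖) * (max 1 ‖2 * b‖ * max 1 ‖2 * (-1 - b)‖) := by
      gcongr
      · exact hpair _ _
      · exact hpair _ _
    _ ≤ 8 * 16 := by gcongr
    _ = 128 := by norm_num

/-- Comparison of exponents: up to `2 ^ (n / 2 + 2)` is lost on points of lower period, and about `3
* n` is kept to make `f_c^n(0)` of order `8⁻ⁿ`. It fails for `n = 4`, which is treated separately.
-/
lemma three_mul_add_le_two_pow {n : ℕ} (hn : 5 ≤ n) : 3 * n + 2 ^ (n / 2 + 2) ≤ 2 ^ n + 2 := by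
  obtain ⟨k, rfl | rfl⟩ := Nat.even_or_odd' n
  · have h2k : 2 * k / 2 = k := by omega
    have hk : 2 * k + 2 ≤ 2 ^ k := by
      have : ∀ m, 2 * (m + 3) + 2 ≤ 2 ^ (m + 3) := fun m => by
        induction m with
        | zero => norm_num
        | succ m ih => rw [show m + 1 + 3 = m + 3 + 1 by ring, pow_succ]; omega
      have h := this (k - 3)
      rwa [Nat.sub_add_cancel (by omega)] at h
    rw [h2k, pow_add, two_mul k, pow_add]
    have h8 : 8 ≤ 2 ^ k := by omega
    nlinarith
  · have h2k : (2 * k + 1) / 2 = k := by omega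
    have hk : 2 * k ≤ 2 ^ k := by
      have : ∀ m, 2 * (m + 2) ≤ 2 ^ (m + 2) := fun m => by
        induction m with
        | zero => norm_num
        | succ m ih => rw [show m + 1 + 2 = m + 2 + 1 by ring, pow_succ]; omega
      have h := this (k - 2)
      rwa [Nat.sub_add_cancel (by omega)] at h
    rw [h2k, show 2 ^ (2 * k + 1) = 2 ^ k * 2 ^ k * 2 by ring, show 2 ^ (k + 2) = 2 ^ k * 4 by ring]
    have h4 : 4 ≤ 2 ^ k := by omega
    nlinarith

/-- Every `f_c` has a repelling cycle of each exact period `n ≥ 4`. -/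
lemma exists_repelling_of_four_le (c : ℂ) {n : ℕ} (hn : 4 ≤ n) :
    ∃ z, Function.minimalPeriod (quadMap c) z = n ∧ 1 < ‖deriv ((quadMap c)^[n]) z‖ := by
  by_contra! hno
  have hc : ‖c‖ ≤ 2 := by
    by_contra! hc
    obtain ⟨z, hz, hz1⟩ := exists_repelling_of_forall (by omega) (T := ∅) (n := n) (by simp)
      fun z hz => Or.inl (one_lt_norm_deriv_of_two_lt hc (by omega) hz)
    exact absurd hz1 (not_lt.2 (hno z hz))
  have hsmall := norm_iterate_zero_le_of_no_repelling (by omega) hno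
  refine absurd hno ?_
  push Not
  rcases eq_or_lt_of_le hn with rfl | hn5
  · have h128 := hsmall.trans (prod_lowPts_four_le hc)
    -- Here `‖f_c^4(0)‖ ≤ 128 / 2 ^ 16 < 0.002`, and `η` is slightly larger than `r ^ 2 = 0.000016`.
    obtain ⟨T, hT, hall⟩ := exists_finset_attracting hc (by norm_num : 2 ≤ 4) (q := 4.1) (r := 0.004) (η := 0.0000165)
      (by norm_num) (by norm_num) (by norm_num) (by norm_num at h128 ⊢; linarith) (by norm_num)
      (by norm_num)
    exact exists_repelling_of_forall le_rfl hT hall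
  · have hlow : ∏ z ∈ lowPts c n, max 1 ‖2 * z‖ ≤ 4 ^ (lowPts c n).card := by
      refine (Finset.prod_le_prod (fun _ _ => by positivity) (g := fun _ => 4)
        fun z hz => ?_).trans (by simp)
      obtain ⟨d, hd, hdz⟩ := mem_lowPts.1 hz
      have := norm_le_two_of_periodic hc (Nat.pos_of_mem_properDivisors hd) hdz
      rw [norm_mul, Complex.norm_two]
      exact max_le (by norm_num) (by linarith)
    have hcard := card_lowPts_le c n
    have hnum := three_mul_add_le_two_pow hn5
    have hpow : (4 : ℝ) ^ (lowPts c n).card * 2 ^ (3 * n - 2) ≤ 2 ^ (2 ^ n) := by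
      rw [show (4 : ℝ) = 2 ^ 2 by norm_num, ← pow_mul, ← pow_add]
      refine pow_le_pow_right₀ (by norm_num) ?_
      rw [pow_succ] at hcard
      rw [pow_add] at hnum
      omega
    have h8 : (2 : ℝ) ^ (3 * n - 2) * 4 = 8 ^ n := by
      rw [show (8 : ℝ) = 2 ^ 3 by norm_num, ← pow_mul, show (4 : ℝ) = 2 ^ 2 by norm_num, ← pow_add,
        Nat.sub_add_cancel (by omega)]
    have hε : ‖(quadMap c)^[n] 0‖ * 8 ^ n ≤ 4 := by
      have h5 := hsmall.trans hlow
      have h6 : (0 : ℝ) < 2 ^ (2 ^ n) := by positivity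
      rw [← h8]
      have h7 : (0 : ℝ) < 2 ^ (3 * n - 2) := by positivity
      have h9 : 2 ^ (2 ^ n) * (‖(quadMap c)^[n] 0‖ * 2 ^ (3 * n - 2)) ≤ 2 ^ (2 ^ n) * 1 := by
        calc _ = 2 ^ (2 ^ n) * ‖(quadMap c)^[n] 0‖ * 2 ^ (3 * n - 2) := by ring
          _ ≤ 4 ^ (lowPts c n).card * 2 ^ (3 * n - 2) := by gcongr
          _ ≤ _ := by rw [mul_one]; exact hpow
      have := le_of_mul_le_mul_left h9 h6
      linarith
    have h85 : (10 : ℝ) * 5 ^ n ≤ 8 ^ n := by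
      have : ∀ m, (10 : ℝ) * 5 ^ (m + 5) ≤ 8 ^ (m + 5) := fun m => by
        induction m with
        | zero => norm_num
        | succ m ih =>
          rw [show m + 1 + 5 = m + 5 + 1 by ring, pow_succ (5 : ℝ) (m + 5), pow_succ (8 : ℝ) (m + 5)]
          nlinarith [pow_pos (show (0 : ℝ) < 8 by norm_num) (m + 5)]
      have h := this (n - 5)
      rwa [Nat.sub_add_cancel (by omega)] at h
    have h5n : (5 : ℝ) ^ n = 5 ^ (n - 1) * 5 := by rw [← pow_succ, Nat.sub_add_cancel (by omega)]
    set x : ℝ := 5 ^ (n - 1) with hx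
    have hx1 : 125 ≤ x := by
      have : (5 : ℝ) ^ 3 ≤ 5 ^ (n - 1) := pow_le_pow_right₀ (by norm_num) (by omega)
      rw [hx]; linarith
    suffices hatt : ∃ T : Finset ℂ, T.card ≤ n ∧ ∀ z, (quadMap c)^[n] z = z →
        1 < ‖deriv ((quadMap c)^[n]) z‖ ∨ (z ∈ T ∧ ‖deriv ((quadMap c)^[n]) z‖ < 1) by
      obtain ⟨T, hT, hall⟩ := hatt
      exact exists_repelling_of_forall hn hT hall
    -- With `x = 5 ^ (n - 1)`, the choice `r = 1 / (5 * x)` makes the contraction factor `2 * r * x`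
    -- equal to `2 / 5`. The bound `4 * 8⁻ⁿ` for `f_c^n(0)` is then below `3 / 5 * r`, leaving `2 /
    -- 5 * r` for the last radius.
    refine exists_finset_attracting hc (by omega : 2 ≤ n) (q := 5) (r := 1 / (5 * x))
      (η := 2 * (1 / (5 * x)) ^ 2) (by norm_num) (by positivity) ?_ ?_ ?_ ?_
    · have : 0 < (1 / (5 * x)) ^ 2 := by positivity
      linarith
    · have h10 : ‖(quadMap c)^[n] 0‖ ≤ 3 / 5 * (1 / (5 * x)) := by
        rw [h5n] at h85
        have : ‖(quadMap c)^[n] 0‖ * (10 * (x * 5)) ≤ 4 :=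
          (mul_le_mul_of_nonneg_left h85 (norm_nonneg _)).trans hε
        rw [mul_one_div, le_div_iff₀ (by positivity)]
        linarith
      have : 2 * (1 / (5 * x)) ^ 2 * x = 2 / 5 * (1 / (5 * x)) := by field_simp
      rw [← hx]
      linarith
    · rw [← hx]
      have : 2 * (1 / (5 * x)) ^ 2 * x = 2 / 25 * (1 / x) := by field_simp; norm_num
      rw [this]
      have : 1 / x ≤ 1 := by rw [div_le_one (by positivity)]; linarith
      linarith
    · rw [← hx]
      have : 2 * (1 / (5 * x)) * x = 2 / 5 := by field_simp
      rw [this]; norm_num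

/-! ### Repelling cycles of period three -/

/-- Each root `s` of `s ^ 2 + s + 2 + c` is the sum of the points of a cycle of period dividing
three, with multiplier `8 (c s + c + 1)`. -/
lemma norm_multiplier_three_le {c s : ℂ} (hs : s ^ 2 + s + 2 + c = 0)
    (hno : ∀ z, Function.minimalPeriod (quadMap c) z = 3 → ‖deriv ((quadMap c)^[3]) z‖ ≤ 1) :
    ‖8 * (c * s + c + 1)‖ ≤ 1 := by
  -- The roots of this cubic form the cycle: their elementary symmetric functions are `s`, `c - 1 -
  -- s` and `c * s + c + 1`.
  obtain ⟨z, hz⟩ : ∃ z : ℂ, z ^ 3 - s * z ^ 2 + (c - 1 - s) * z - (c * s + c + 1) = 0 := by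
    have hdeg : (Polynomial.X ^ 3 - Polynomial.C s * Polynomial.X ^ 2 +
        Polynomial.C (c - 1 - s) * Polynomial.X - Polynomial.C (c * s + c + 1)).degree = 3 := by
      compute_degree!
    obtain ⟨z, hz⟩ := IsAlgClosed.exists_root _ (by rw [hdeg]; norm_num)
    refine ⟨z, ?_⟩
    simpa only [Polynomial.IsRoot.def, Polynomial.eval_sub, Polynomial.eval_add,
      Polynomial.eval_mul, Polynomial.eval_pow, Polynomial.eval_X, Polynomial.eval_C] using hz
  have h2 : quadMap c (quadMap c z) = s - z - quadMap c z := by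
    simp only [quadMap]
    linear_combination (z + s) * hz + (z ^ 2 + z + c) * hs
  have h3 : (quadMap c)^[3] z = z := by
    simp only [Function.iterate_succ, Function.iterate_zero, Function.comp, id]
    rw [h2]
    simp only [quadMap]
    linear_combination (z + 2 + s) * hz + (z ^ 2 + z + 1 + c) * hs
  have hder : deriv ((quadMap c)^[3]) z = 8 * (c * s + c + 1) := by
    rw [deriv_iterate_quadMap, Finset.prod_range_succ, Finset.prod_range_succ,
      Finset.prod_range_one]
    simp only [Function.iterate_succ, Function.iterate_zero, Function.comp, id]
    rw [h2]
    simp only [quadMap]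
    linear_combination (-8) * ((z ^ 2 + (1 + s) * z - 1) * hz + (z ^ 3 + z ^ 2 + c * z) * hs)
  rw [← hder]
  have hdvd : Function.minimalPeriod (quadMap c) z ∣ 3 := Function.IsPeriodicPt.minimalPeriod_dvd h3
  rcases (Nat.dvd_prime Nat.prime_three).1 hdvd with h | h
  · have hfix : quadMap c z = z := Function.minimalPeriod_eq_one_iff_isFixedPt.1 h
    rw [hfix] at h2
    have hs3 : s = 3 * z := by linear_combination (-1) * (h2 - hfix)
    have hc : c = z - z ^ 2 := by rw [quadMap] at hfix; linear_combination hfix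
    have hq : 8 * z ^ 2 + 4 * z + 2 = 0 := by
      rw [hs3, hc] at hs
      linear_combination hs
    have h8 : 8 * z ^ 3 = 1 := by linear_combination (z - 1 / 2) * hq
    rw [deriv_iterate_quadMap, Finset.prod_range_succ, Finset.prod_range_succ,
      Finset.prod_range_one]
    simp only [Function.iterate_succ, Function.iterate_zero, Function.comp, id, hfix]
    rw [show 2 * z * (2 * z) * (2 * z) = 1 by linear_combination h8]
    simp
  · exact hno z h

/-- Unless `c = -7/4`, the map `f_c` has a repelling cycle of exact period three. -/
lemma exists_repelling_three {c : ℂ} (hc : c ≠ -7 / 4) :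
    ∃ z, Function.minimalPeriod (quadMap c) z = 3 ∧ 1 < ‖deriv ((quadMap c)^[3]) z‖ := by
  by_contra! hno
  obtain ⟨d, hd⟩ := IsAlgClosed.exists_eq_mul_self (-7 - 4 * c)
  have h1 := norm_multiplier_three_le (s := (-1 + d) / 2) (by linear_combination (-1 / 4) * hd) hno
  have h2 := norm_multiplier_three_le (s := (-1 - d) / 2) (by linear_combination (-1 / 4) * hd) hno
  set l₁ := 8 * (c * ((-1 + d) / 2) + c + 1) with hl₁
  set l₂ := 8 * (c * ((-1 - d) / 2) + c + 1) with hl₂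
  set t := c + 2 with ht
  have hsum : l₁ + l₂ = 8 * t := by rw [hl₁, hl₂, ht]; ring
  have htn : ‖t‖ ≤ 1 / 4 := by
    have := norm_add_le l₁ l₂
    rw [hsum, norm_mul] at this
    norm_num at this
    linarith
  set B := t ^ 2 - 15 / 4 * t + 65 / 16 with hB
  set a := 1 - l₁ with ha
  set b := 1 - l₂ with hb
  set u := 1 / 4 - t with hu
  have hu0 : u ≠ 0 := fun h => hc (by rw [hu, ht] at h; linear_combination -h)
  have hab : a + b = 8 * u := by rw [ha, hb, hu]; linear_combination -hsum
  have hprod : a * b = 8 * u * (1 - 8 * B) := by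
    rw [ha, hb, hl₁, hl₂, hu, hB, ht]
    linear_combination (16 * c ^ 2) * hd
  have hBre : 1 / 8 < B.re := by
    have e : B.re = 65 / 16 - (15 / 4 * t - t ^ 2).re := by
      rw [hB, show t ^ 2 - 15 / 4 * t + 65 / 16 = ((65 / 16 : ℝ) : ℂ) - (15 / 4 * t - t ^ 2) by
        push_cast; ring, Complex.sub_re, Complex.ofReal_re]
    have h5 : (15 / 4 * t - t ^ 2).re ≤ 15 / 4 * ‖t‖ + ‖t‖ ^ 2 := by
      refine (Complex.re_le_norm _).trans ((norm_sub_le _ _).trans ?_)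
      rw [norm_mul, norm_pow]
      norm_num
    rw [e]
    nlinarith [norm_nonneg t]
  have hB0 : (1 - 8 * B).re < 0 := by
    simp only [Complex.sub_re, Complex.one_re, Complex.mul_re, Complex.re_ofNat, Complex.im_ofNat,
      zero_mul, sub_zero]
    linarith
  have hBne : 1 - 8 * B ≠ 0 := fun h => by rw [h] at hB0; simp at hB0
  have hab0 : a * b ≠ 0 := by
    rw [hprod]
    exact mul_ne_zero (mul_ne_zero (by norm_num) hu0) hBne
  have ha0 : a ≠ 0 := left_ne_zero_of_mul hab0
  have hb0 : b ≠ 0 := right_ne_zero_of_mul hab0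
  -- The factor `8 * u`, nonzero exactly when `c ≠ -7/4`, cancels. For `‖l‖ ≤ 1` the number `1 / (1
  -- - l)` has nonnegative real part, so the left side does too, whereas `1 - 8 * B` has negative
  -- real part because `‖t‖ ≤ 1 / 4`.
  have hinv : a⁻¹ + b⁻¹ = (1 - 8 * B)⁻¹ := by
    rw [inv_add_inv ha0 hb0, hab, hprod]
    field_simp
  have hre : ∀ l : ℂ, ‖l‖ ≤ 1 → 0 ≤ ((1 - l)⁻¹).re := fun l hl => by
    rw [Complex.inv_re]
    refine div_nonneg ?_ (Complex.normSq_nonneg _)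
    rw [Complex.sub_re, Complex.one_re]
    linarith [Complex.re_le_norm l]
  have h7 : 0 ≤ ((1 - 8 * B)⁻¹).re := by
    rw [← hinv, Complex.add_re]
    exact add_nonneg (hre _ h1) (hre _ h2)
  rw [Complex.inv_re] at h7
  have := div_neg_of_neg_of_pos hB0 (Complex.normSq_pos.2 hBne)
  linarith

/-- Every `f_c` has a repelling orbit of each period `n ≥ 3`, except for `c = -7/4`, `n = 3`. -/
lemma exists_isRepellingOrbit (c : ℂ) {n : ℕ} (hn : 3 ≤ n) (h : ¬ (c = -7 / 4 ∧ n = 3)) :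
    ∃ O, IsRepellingOrbit c O ∧ O.ncard = n := by
  obtain ⟨z, hz, hz1⟩ : ∃ z, Function.minimalPeriod (quadMap c) z = n ∧
      1 < ‖deriv ((quadMap c)^[n]) z‖ := by
    rcases eq_or_lt_of_le hn with rfl | h4
    · exact exists_repelling_three fun hc => h ⟨hc, rfl⟩
    · exact exists_repelling_of_four_le c h4
  exact ⟨_, isRepellingOrbit_orbitSet (by omega) hz hz1⟩

/-! ### Limits of bounded holomorphic functions along ultrafilters -/

/-- A uniformly bounded sequence of holomorphic functions on a disc converges to a holomorphic
function on the concentric disc of half the radius, along any ultrafilter. -/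
lemma exists_differentiableOn_tendsto_ultrafilter (𝒰 : Ultrafilter ℕ) {F : ℕ → ℂ → ℂ} {p : ℂ}
    {r B : ℝ} (hr : 0 < r) (hF : ∀ n, DifferentiableOn ℂ (F n) (Metric.ball p r))
    (hB : ∀ n, ∀ x ∈ Metric.ball p r, ‖F n x‖ ≤ B) :
    ∃ L : ℂ → ℂ, DifferentiableOn ℂ L (Metric.ball p (r / 2)) ∧
      ∀ x ∈ Metric.ball p (r / 2), Tendsto (fun n => F n x) 𝒰 (𝓝 (L x)) := by
  have hsub : Metric.ball p (r / 2) ⊆ Metric.ball p r := Metric.ball_subset_ball (by linarith)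
  have hlim : ∀ x ∈ Metric.ball p (r / 2), ∃ l, Tendsto (fun n => F n x) 𝒰 (𝓝 l) := by
    intro x hx
    have hmem : ∀ n, F n x ∈ Metric.closedBall (0 : ℂ) B := fun n => by
      rw [mem_closedBall_zero_iff]; exact hB n x (hsub hx)
    obtain ⟨l, -, hl⟩ := (isCompact_closedBall (0 : ℂ) B).ultrafilter_le_nhds
      (𝒰.map fun n => F n x) (by
        rw [le_principal_iff]
        exact Filter.mem_map.2 (Filter.univ_mem' hmem))
    exact ⟨l, hl⟩
  choose! L hL using hlim
  have hB0 : 0 ≤ B := (norm_nonneg _).trans (hB 0 p (Metric.mem_ball_self hr))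
  set Λ : ℝ := B / (r / 4) with hΛ
  have hΛ0 : 0 ≤ Λ := by positivity
  have hder : ∀ n, ∀ x ∈ Metric.ball p (r / 2), ‖deriv (F n) x‖ ≤ Λ := by
    intro n x hx
    have hsub2 : Metric.closedBall x (r / 4) ⊆ Metric.ball p r := by
      refine Metric.closedBall_subset_ball' ?_
      rw [Metric.mem_ball] at hx
      linarith
    exact Complex.norm_deriv_le_of_forall_mem_sphere_norm_le (by positivity)
      (((hF n).mono hsub2).diffContOnCl_ball subset_rfl) fun w hw =>
        hB n w (hsub2 (Metric.sphere_subset_closedBall hw))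
  -- The Cauchy estimate makes the family uniformly Lipschitz, which upgrades pointwise convergence
  -- along the ultrafilter to locally uniform convergence.
  have hlip : ∀ n, ∀ x ∈ Metric.ball p (r / 2), ∀ y ∈ Metric.ball p (r / 2),
      ‖F n y - F n x‖ ≤ Λ * ‖y - x‖ := fun n x hx y hy =>
    (convex_ball p (r / 2)).norm_image_sub_le_of_norm_deriv_le
      (fun z hz => (hF n).differentiableAt (Metric.isOpen_ball.mem_nhds (hsub hz)))
      (fun z hz => hder n z hz) hx hy
  have hlipL : ∀ x ∈ Metric.ball p (r / 2), ∀ y ∈ Metric.ball p (r / 2),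
      ‖L y - L x‖ ≤ Λ * ‖y - x‖ := fun x hx y hy =>
    le_of_tendsto ((hL y hy).sub (hL x hx)).norm (Eventually.of_forall fun n => hlip n x hx y hy)
  refine ⟨L, ?_, hL⟩
  refine TendstoLocallyUniformlyOn.differentiableOn (φ := (𝒰 : Filter ℕ)) (F := F) ?_
    (Eventually.of_forall fun n => (hF n).mono hsub) Metric.isOpen_ball
  rw [Metric.tendstoLocallyUniformlyOn_iff]
  intro ε hε x hx
  refine ⟨Metric.ball x (ε / (3 * (Λ + 1))) ∩ Metric.ball p (r / 2),
    inter_mem (mem_nhdsWithin_of_mem_nhds (Metric.ball_mem_nhds x (by positivity)))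
      self_mem_nhdsWithin, ?_⟩
  filter_upwards [Metric.tendsto_nhds.1 (hL x hx) (ε / 3) (by positivity)] with n hn y hy
  rw [dist_eq_norm] at hn ⊢
  have hyx : ‖y - x‖ ≤ ε / (3 * (Λ + 1)) := (mem_ball_iff_norm.1 hy.1).le
  have h1 : Λ * ‖y - x‖ ≤ ε / 3 := by
    calc Λ * ‖y - x‖ ≤ (Λ + 1) * (ε / (3 * (Λ + 1))) := by gcongr; linarith
      _ = ε / 3 := by field_simp
  have h2 := hlip n x hx y hy.2
  have h3 := hlipL x hx y hy.2
  calc ‖L y - F n y‖ = ‖(L y - L x) - (F n x - L x) - (F n y - F n x)‖ := by congr 1; ring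
    _ ≤ ‖L y - L x‖ + ‖F n x - L x‖ + ‖F n y - F n x‖ :=
      (norm_sub_le _ _).trans (add_le_add_left (norm_sub_le _ _) _)
    _ < ε := by linarith

/-- Borel–Carathéodory on a disc with arbitrary centre. -/
lemma norm_le_of_re_le {F : ℂ → ℂ} {p : ℂ} {r M B : ℝ} (hr : 0 < r) (hM : 0 < M)
    (hF : DifferentiableOn ℂ F (Metric.ball p r)) (hre : ∀ x ∈ Metric.ball p r, (F x).re ≤ M)
    (hp : ‖F p‖ ≤ B) {x : ℂ} (hx : x ∈ Metric.ball p (r / 2)) : ‖F x‖ ≤ 2 * M + 3 * B := by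
  have hmaps : MapsTo (fun w => p + w) (Metric.ball 0 r) (Metric.ball p r) := fun w hw => by
    rw [mem_ball_iff_norm, add_sub_cancel_left]
    exact mem_ball_zero_iff.1 hw
  have hx' : ‖x - p‖ < r / 2 := mem_ball_iff_norm.1 hx
  have h := Complex.borelCaratheodory (f := fun w => F (p + w)) (z := x - p) hM
    (hF.comp (by fun_prop) hmaps) (fun w hw => hre _ (hmaps hw)) hr
    (by rw [mem_ball_zero_iff]; linarith)
  simp only [add_sub_cancel, add_zero] at h
  refine h.trans (add_le_add ?_ ?_)
  · rw [div_le_iff₀ (by linarith)]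
    nlinarith [norm_nonneg (x - p)]
  · rw [div_le_iff₀ (by linarith)]
    have h0 := norm_nonneg (F p)
    have h1 : ‖F p‖ * (r + ‖x - p‖) ≤ ‖F p‖ * (3 * (r - ‖x - p‖)) := by gcongr; linarith
    nlinarith

/-! ### Neighbourhoods of repelling periodic points -/

/-- Potential-theoretic core: two limits of normalised logarithms cannot coexist. -/
lemma false_of_limit_logs {L L' : ℂ → ℂ} {p : ℂ} {r : ℝ} (hr : 0 < r)
    (hL : DifferentiableOn ℂ L (Metric.ball p r)) (hL' : DifferentiableOn ℂ L' (Metric.ball p r))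
    (h0 : L p = 0) (h0' : L' p = 0)
    (hmax : ∀ x ∈ Metric.ball p r, 0 ≤ (L x).re ∨ 0 ≤ (L' x).re)
    (heq : ∀ x ∈ Metric.ball p r, 0 < (L x).re → (L' x).re = (L x).re)
    {e : ℂ} (he : e ∈ Metric.ball p r) (hpos : 0 < (L e).re) : False := by
  have hp : p ∈ Metric.ball p r := Metric.mem_ball_self hr
  have hconn : IsPreconnected (Metric.ball p r) := (convex_ball p r).isPreconnected
  have hana : AnalyticOnNhd ℂ L (Metric.ball p r) := hL.analyticOnNhd Metric.isOpen_ball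
  have hanad : AnalyticOnNhd ℂ (fun x => L x - L' x) (Metric.ball p r) :=
    (hL.sub hL').analyticOnNhd Metric.isOpen_ball
  have hnhds : {x | 0 < (L x).re} ∩ Metric.ball p r ∈ 𝓝 e := by
    refine inter_mem ?_ (Metric.isOpen_ball.mem_nhds he)
    have hc : ContinuousAt (fun x => (L x).re) e :=
      Complex.continuous_re.continuousAt.comp (hana e he).continuousAt
    exact hc.eventually (lt_mem_nhds hpos)
  obtain ⟨δ, hδ, hδs⟩ := Metric.mem_nhds_iff.1 hnhds
  -- Near `e` the difference `L - L'` has zero real part, so it is constant; by the identity theorem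
  -- it is the same constant on the whole disc, and its value at `p` is `0`.
  obtain ⟨k, hk⟩ := AnalyticOnNhd.eq_const_of_re_eq_const (c₀ := 0)
    (hanad.mono fun x hx => (hδs hx).2)
    (fun x hx => by
      rw [Complex.sub_re, heq x (hδs hx).2 (hδs hx).1, sub_self])
    Metric.isOpen_ball ((convex_ball e δ).isConnected ⟨e, Metric.mem_ball_self hδ⟩)
  have hall := hanad.eqOn_of_preconnected_of_eventuallyEq (analyticOnNhd_const (v := k)) hconn he
    (by filter_upwards [Metric.ball_mem_nhds e hδ] with x hx using hk x hx)
  have hk0 : k = 0 := by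
    have := hall hp
    simp only [h0, h0', sub_zero] at this
    exact this.symm
  have hLL : ∀ x ∈ Metric.ball p r, L x = L' x := fun x hx => by
    have := hall hx
    simp only [hk0] at this
    exact sub_eq_zero.1 this
  have hnn : ∀ x ∈ Metric.ball p r, 0 ≤ (L x).re := fun x hx => by
    rcases hmax x hx with h | h
    · exact h
    · rwa [hLL x hx]
  -- Now `L = L'` has nonnegative real part and vanishes at `p`. The open mapping theorem leaves
  -- only a constant, which `0 < (L e).re` excludes.
  rcases hana.is_constant_or_isOpen hconn with ⟨w, hw⟩ | hopen
  · rw [hw e he, ← hw p hp, h0] at hpos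
    exact lt_irrefl _ hpos
  · have h1 := (hopen _ subset_rfl Metric.isOpen_ball).mem_nhds ⟨p, hp, h0⟩
    obtain ⟨ε, hε, hεs⟩ := Metric.mem_nhds_iff.1 h1
    obtain ⟨x, hx, hxe⟩ := hεs (show ((-(ε / 2) : ℝ) : ℂ) ∈ Metric.ball 0 ε by
      rw [mem_ball_zero_iff, Complex.norm_real, norm_neg, Real.norm_of_nonneg (by positivity)]
      linarith)
    have := hnn x hx
    rw [hxe, Complex.ofReal_re] at this
    linarith

lemma deriv_iterate_mul_quadMap {c z : ℂ} {n : ℕ} (hz : (quadMap c)^[n] z = z) (k : ℕ) :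
    deriv ((quadMap c)^[k * n]) z = deriv ((quadMap c)^[n]) z ^ k := by
  induction k with
  | zero => simp
  | succ k ih =>
    rw [Nat.succ_mul, deriv_iterate_add_quadMap, hz, ih, pow_succ]

/-- Orbits of points of large modulus escape at a definite rate. -/
lemma le_norm_iterate_of_large {c w : ℂ} {C : ℝ} (hC : ‖c‖ + 1 ≤ C) (hw : C + 2 ≤ ‖w‖) (k : ℕ) :
    2 ^ (2 ^ k) + C ≤ ‖(quadMap c)^[k] w‖ := by
  induction k with
  | zero => simp; linarith
  | succ k ih =>
    rw [Function.iterate_succ_apply']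
    set v := (quadMap c)^[k] w
    have h1 : ‖v‖ ^ 2 ≤ ‖quadMap c v‖ + ‖c‖ := by
      have := norm_sub_le (quadMap c v) c
      rwa [quadMap, add_sub_cancel_right, norm_pow] at this
    have h2 : (1 : ℝ) ≤ 2 ^ (2 ^ k) := one_le_pow₀ (by norm_num)
    have h3 : (2 : ℝ) ^ (2 ^ (k + 1)) = (2 ^ (2 ^ k)) ^ 2 := by rw [← pow_mul, pow_succ]
    rw [h3]
    have h4 : (2 ^ (2 ^ k) + C) ^ 2 ≤ ‖v‖ ^ 2 :=
      pow_le_pow_left₀ (by linarith [norm_nonneg c]) ih 2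
    nlinarith [norm_nonneg c]

/-- The summand `C` makes the induction close and also leaves room to subtract a point `y` with `‖c‖
+ ‖y‖ ≤ C`, so that `log ‖f_c^n(x) - y‖ ≤ 2 ^ n * log Q`. -/
lemma norm_iterate_add_le {c x : ℂ} {C Q : ℝ} (hC : ‖c‖ ≤ C) (hQ : C + 1 + ‖x‖ ≤ Q) (k : ℕ) :
    ‖(quadMap c)^[k] x‖ + C ≤ Q ^ (2 ^ k) := by
  have hc0 := norm_nonneg c
  have hx0 := norm_nonneg x
  induction k with
  | zero => simp; linarith
  | succ k ih =>
    rw [Function.iterate_succ_apply', pow_succ, pow_mul]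
    set v := (quadMap c)^[k] x
    set s := Q ^ (2 ^ k)
    have h1 : ‖quadMap c v‖ ≤ ‖v‖ ^ 2 + ‖c‖ := by
      have := norm_add_le (v ^ 2) c
      rwa [norm_pow] at this
    have h2 : C + 1 ≤ s := by
      calc C + 1 ≤ Q := by linarith
        _ ≤ s := le_self_pow₀ (by linarith) (by positivity)
    have h3 : ‖v‖ ^ 2 ≤ (s - C) ^ 2 := by
      gcongr
      linarith
    nlinarith

/-- Every neighbourhood of a repelling periodic point contains an escaping point. -/
lemma exists_norm_iterate_ge {c z : ℂ} {n : ℕ} (hz : (quadMap c)^[n] z = z)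
    (h1 : 1 < ‖deriv ((quadMap c)^[n]) z‖) {ρ : ℝ} (hρ : 0 < ρ) (R : ℝ) :
    ∃ x ∈ Metric.ball z ρ, ∃ k, R ≤ ‖(quadMap c)^[k] x‖ := by
  by_contra! h
  -- If all iterates were bounded on the disc, Cauchy's estimate would bound all powers of the
  -- multiplier.
  have hbound : ∀ k, ‖deriv ((quadMap c)^[n]) z‖ ^ k ≤ R / (ρ / 2) := fun k => by
    rw [← norm_pow, ← deriv_iterate_mul_quadMap hz]
    refine Complex.norm_deriv_le_of_forall_mem_sphere_norm_le (by positivity)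
      (differentiable_iterate_quadMap c _).diffContOnCl fun w hw => (h w ?_ _).le
    exact Metric.sphere_subset_closedBall.trans (Metric.closedBall_subset_ball (by linarith)) hw
  obtain ⟨k, hk⟩ := pow_unbounded_of_one_lt (R / (ρ / 2)) h1
  exact absurd (hbound k) (not_le.2 hk)

/-- Normalised holomorphic logarithms of `f_c^n - y`. -/
lemma exists_normalized_log {c p y : ℂ} {r C Q : ℝ} (hr : 0 < r) (hC : ‖c‖ + ‖y‖ ≤ C)
    (hQ : C + 1 + ‖p‖ + r ≤ Q) {N : ℕ} (hN : 0 < N) (hp : (quadMap c)^[N] p = p)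
    (hy : ∀ x ∈ Metric.ball p r, ∀ n, (quadMap c)^[n] x ≠ y) :
    ∃ (F : ℕ → ℂ → ℂ) (B : ℝ), (∀ n, DifferentiableOn ℂ (F n) (Metric.ball p (r / 2))) ∧
      (∀ n, ∀ x ∈ Metric.ball p (r / 2), ‖F n x‖ ≤ B) ∧
      Tendsto (fun n => F n p) atTop (𝓝 0) ∧
      ∀ n, ∀ x ∈ Metric.ball p (r / 2), (F n x).re = Real.log ‖(quadMap c)^[n] x - y‖ / 2 ^ n := by
  have hpm : p ∈ Metric.ball p r := Metric.mem_ball_self hr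
  have hc0 := norm_nonneg c
  have hy0 := norm_nonneg y
  have hp0 := norm_nonneg p
  have hlog : ∀ n : ℕ, ∃ L : ℂ → ℂ, DifferentiableOn ℂ L (Metric.ball p r) ∧
      L p = Complex.log ((quadMap c)^[n] p - y) ∧
      ∀ x ∈ Metric.ball p r, Complex.exp (L x) = (quadMap c)^[n] x - y := fun n =>
    exists_differentiableOn_log hr
      ((differentiable_iterate_quadMap c n).differentiableOn.sub_const y)
      (fun x hx => sub_ne_zero.2 (hy x hx n))
      (Complex.exp_log (sub_ne_zero.2 (hy p hpm n)))
  choose L hLd hLp hL using hlog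
  set B₀ : ℝ := ∑ i ∈ Finset.range N, ‖Complex.log ((quadMap c)^[i] p - y)‖ with hB₀
  -- The branch is normalised by the principal logarithm at the periodic point `p`, where only `N`
  -- values occur. Together with an upper bound for the real part, this feeds Borel–Carathéodory.
  have hLB : ∀ n, ‖L n p‖ ≤ B₀ := fun n => by
    have hper : Function.IsPeriodicPt (quadMap c) N p := hp
    rw [hLp, ← hper.iterate_mod_apply n]
    exact Finset.single_le_sum (f := fun i => ‖Complex.log ((quadMap c)^[i] p - y)‖)
      (fun _ _ => norm_nonneg _) (Finset.mem_range.2 (Nat.mod_lt n hN))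
  have hre : ∀ n, ∀ x ∈ Metric.ball p r,
      (L n x / 2 ^ n).re = Real.log ‖(quadMap c)^[n] x - y‖ / 2 ^ n := fun n x hx => by
    rw [← hL n x hx, Complex.norm_exp, Real.log_exp,
      show (2 : ℂ) ^ n = ((2 ^ n : ℝ) : ℂ) by push_cast; rfl, Complex.div_ofReal_re]
  have hQ1 : 1 < Q := by linarith
  have hM : 0 < Real.log Q := Real.log_pos hQ1
  have hpow : ∀ n : ℕ, (0 : ℝ) < 2 ^ n := fun n => by positivity
  refine ⟨fun n x => L n x / 2 ^ n, 2 * Real.log Q + 3 * B₀, fun n => ?_, fun n x hx => ?_, ?_, ?_⟩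
  · exact ((hLd n).mono (Metric.ball_subset_ball (by linarith))).div_const _
  · refine norm_le_of_re_le hr hM ((hLd n).div_const _) (fun x hx => ?_) ?_ hx
    · rw [hre n x hx, div_le_iff₀ (hpow n)]
      have hxn : ‖x‖ ≤ ‖p‖ + r := by
        have := norm_le_norm_add_norm_sub' x p
        have := mem_ball_iff_norm.1 hx
        linarith
      have h1 := norm_iterate_add_le (c := c) (x := x) (C := C) (Q := Q) (by linarith) (by linarith) n
      have h2 : ‖(quadMap c)^[n] x - y‖ ≤ Q ^ (2 ^ n) := by
        have := norm_sub_le ((quadMap c)^[n] x) y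
        linarith
      have h3 := Real.log_le_log (norm_pos_iff.2 (sub_ne_zero.2 (hy x hx n))) h2
      rw [Real.log_pow] at h3
      push_cast at h3
      linarith
    · rw [norm_div, norm_pow, Complex.norm_two]
      exact (div_le_self (norm_nonneg _) (one_le_pow₀ (by norm_num))).trans (hLB n)
  · refine squeeze_zero_norm (a := fun n => B₀ / 2 ^ n) (fun n => ?_) ?_
    · rw [norm_div, norm_pow, Complex.norm_two]
      have := hLB n
      gcongr
    · exact tendsto_const_nhds.div_atTop (tendsto_pow_atTop_atTop_of_one_lt (by norm_num))
  · exact fun n x hx => hre n x (Metric.ball_subset_ball (by linarith) hx)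

/-- The iterates of any neighbourhood of a repelling periodic point `z` cannot avoid two points
off the orbit of `z`. -/
lemma exists_iterate_mem_pair {c z y y' : ℂ} {N : ℕ} (hN : 0 < N) (hz : (quadMap c)^[N] z = z)
    (h1 : 1 < ‖deriv ((quadMap c)^[N]) z‖) (hyy' : y ≠ y') {r : ℝ} (hr : 0 < r) :
    ∃ x ∈ Metric.ball z r, ∃ n, (quadMap c)^[n] x = y ∨ (quadMap c)^[n] x = y' := by
  by_contra! hav
  set C : ℝ := ‖c‖ + ‖y‖ + ‖y'‖ + 1 with hC
  set Q : ℝ := C + 1 + ‖z‖ + r with hQ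
  have hyn := norm_nonneg y
  have hyn' := norm_nonneg y'
  obtain ⟨F, B, hFd, hFB, hF0, hFre⟩ := exists_normalized_log (y := y) hr (C := C) (by linarith)
    hQ.ge hN hz fun x hx n => (hav x hx n).1
  obtain ⟨F', B', hFd', hFB', hF0', hFre'⟩ := exists_normalized_log (y := y') hr (C := C)
    (by linarith) hQ.ge hN hz fun x hx n => (hav x hx n).2
  set 𝒰 : Ultrafilter ℕ := hyperfilter ℕ
  have h𝒰 : (𝒰 : Filter ℕ) ≤ atTop := Nat.hyperfilter_le_atTop
  have hr2 : 0 < r / 2 := by positivity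
  obtain ⟨L, hLd, hL⟩ := exists_differentiableOn_tendsto_ultrafilter 𝒰 hr2 hFd hFB
  obtain ⟨L', hLd', hL'⟩ := exists_differentiableOn_tendsto_ultrafilter 𝒰 hr2 hFd' hFB'
  have hr4 : 0 < r / 2 / 2 := by positivity
  have hzm : z ∈ Metric.ball z (r / 2 / 2) := Metric.mem_ball_self hr4
  have hsub : Metric.ball z (r / 2 / 2) ⊆ Metric.ball z (r / 2) :=
    Metric.ball_subset_ball (by linarith)
  have hreL : ∀ x ∈ Metric.ball z (r / 2 / 2), Tendsto
      (fun n : ℕ => Real.log ‖(quadMap c)^[n] x - y‖ / 2 ^ n) 𝒰 (𝓝 (L x).re) := fun x hx => by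
    refine ((Complex.continuous_re.tendsto _).comp (hL x hx)).congr fun n => ?_
    exact hFre n x (hsub hx)
  have hreL' : ∀ x ∈ Metric.ball z (r / 2 / 2), Tendsto
      (fun n : ℕ => Real.log ‖(quadMap c)^[n] x - y'‖ / 2 ^ n) 𝒰 (𝓝 (L' x).re) := fun x hx => by
    refine ((Complex.continuous_re.tendsto _).comp (hL' x hx)).congr fun n => ?_
    exact hFre' n x (hsub hx)
  have h2n : Tendsto (fun n : ℕ => (2 : ℝ) ^ n) atTop atTop :=
    tendsto_pow_atTop_atTop_of_one_lt (by norm_num)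
  have hdiv0 : ∀ a : ℝ, Tendsto (fun n : ℕ => a / 2 ^ n) 𝒰 (𝓝 0) := fun a =>
    (tendsto_const_nhds.div_atTop h2n).mono_left h𝒰
  set d : ℝ := ‖y - y'‖ with hd
  have hdpos : 0 < d := norm_pos_iff.2 (sub_ne_zero.2 hyy')
  have htri : ∀ w : ℂ, d ≤ ‖w - y‖ + ‖w - y'‖ := fun w => by
    have := norm_sub_le (w - y') (w - y)
    rw [sub_sub_sub_cancel_left] at this
    linarith
  have htri1 : ∀ w : ℂ, ‖w - y'‖ ≤ ‖w - y‖ + d := fun w => by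
    have := norm_add_le (w - y) (y - y')
    rwa [sub_add_sub_cancel] at this
  have htri2 : ∀ w : ℂ, ‖w - y‖ ≤ ‖w - y'‖ + d := fun w => by
    have := norm_sub_le (w - y') (y - y')
    rwa [sub_sub_sub_cancel_right] at this
  obtain ⟨e, he, k, hk⟩ := exists_norm_iterate_ge hz h1 hr4 (C + 2)
  refine false_of_limit_logs hr4 hLd hLd' (tendsto_nhds_unique (hL z hzm) (hF0.mono_left h𝒰))
    (tendsto_nhds_unique (hL' z hzm) (hF0'.mono_left h𝒰)) (fun x hx => ?_) (fun x hx hpos => ?_)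
    he ?_
  -- An iterate cannot be close to both `y` and `y'`: one of the distances is at least `d / 2`, so
  -- both limits cannot be negative.
  · by_contra! hneg
    have hlim := (hreL x hx).max (hreL' x hx)
    have hge : ∀ n : ℕ, Real.log (d / 2) / 2 ^ n ≤
        max (Real.log ‖(quadMap c)^[n] x - y‖ / 2 ^ n)
          (Real.log ‖(quadMap c)^[n] x - y'‖ / 2 ^ n) := fun n => by
      have h3 := htri ((quadMap c)^[n] x)
      rcases le_or_gt (d / 2) ‖(quadMap c)^[n] x - y‖ with h | h
      · exact le_max_of_le_left (by gcongr)
      · refine le_max_of_le_right ?_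
        have : d / 2 ≤ ‖(quadMap c)^[n] x - y'‖ := by linarith
        gcongr
    have := le_of_tendsto_of_tendsto (hdiv0 (Real.log (d / 2))) hlim (Eventually.of_forall hge)
    exact absurd this (not_le.2 (max_lt hneg.1 hneg.2))
  -- Where the limit is positive the distance to `y` is eventually at least `2 * d`. The distances
  -- to `y` and `y'` then differ by a factor at most two, which is invisible after division by `2 ^
  -- n`.
  · have hdiff : Tendsto (fun n : ℕ => Real.log ‖(quadMap c)^[n] x - y'‖ / 2 ^ n -
        Real.log ‖(quadMap c)^[n] x - y‖ / 2 ^ n) 𝒰 (𝓝 0) := by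
      refine squeeze_zero_norm' (a := fun n : ℕ => Real.log 2 / 2 ^ n) ?_ (hdiv0 _)
      have h4 : ∀ᶠ n : ℕ in 𝒰, (L x).re / 2 < Real.log ‖(quadMap c)^[n] x - y‖ / 2 ^ n :=
        (hreL x hx).eventually (lt_mem_nhds (by linarith))
      have h5 : ∀ᶠ n : ℕ in 𝒰, Real.log (2 * d) / ((L x).re / 2) ≤ 2 ^ n :=
        (h2n.eventually_ge_atTop _).filter_mono h𝒰
      filter_upwards [h4, h5] with n h4 h5
      have hxr : x ∈ Metric.ball z r := Metric.ball_subset_ball (by linarith) hx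
      set w := (quadMap c)^[n] x
      have hw : 0 < ‖w - y‖ := norm_pos_iff.2 (sub_ne_zero.2 (hav x hxr n).1)
      have hw' : 0 < ‖w - y'‖ := norm_pos_iff.2 (sub_ne_zero.2 (hav x hxr n).2)
      have h2p : (0 : ℝ) < 2 ^ n := by positivity
      rw [div_le_iff₀ (by positivity)] at h5
      rw [lt_div_iff₀ h2p] at h4
      have h6 : 2 * d ≤ ‖w - y‖ := by
        rw [← Real.log_le_log_iff (by positivity) hw]
        linarith
      have h7 := Real.log_le_log hw' (show ‖w - y'‖ ≤ 2 * ‖w - y‖ by linarith [htri1 w])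
      have h8 := Real.log_le_log hw (show ‖w - y‖ ≤ 2 * ‖w - y'‖ by linarith [htri2 w])
      rw [Real.log_mul two_ne_zero hw.ne'] at h7
      rw [Real.log_mul two_ne_zero hw'.ne'] at h8
      rw [← sub_div, Real.norm_eq_abs, abs_div, abs_of_pos h2p]
      gcongr
      rw [abs_le]
      constructor <;> linarith
    have := tendsto_nhds_unique hdiff ((hreL' x hx).sub (hreL x hx))
    linarith
  · have h9 : ∀ m, k ≤ m → Real.log 2 / 2 ^ k ≤ Real.log ‖(quadMap c)^[m] e - y‖ / 2 ^ m := by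
      intro m hm
      obtain ⟨i, rfl⟩ := Nat.exists_eq_add_of_le' hm
      have h10 := le_norm_iterate_of_large (c := c) (C := C) (by linarith) hk i
      rw [← Function.iterate_add_apply] at h10
      have h11 : (2 : ℝ) ^ (2 ^ i) ≤ ‖(quadMap c)^[i + k] e - y‖ := by
        have := norm_sub_norm_le ((quadMap c)^[i + k] e) y
        have := norm_nonneg c
        linarith
      have h12 := Real.log_le_log (by positivity) h11
      rw [Real.log_pow] at h12
      push_cast at h12
      rw [pow_add, div_le_div_iff₀ (by positivity) (by positivity)]
      nlinarith [pow_pos (show (0 : ℝ) < 2 by norm_num) k]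
    have h13 := ge_of_tendsto (hreL e he)
      (((eventually_ge_atTop k).filter_mono h𝒰).mono fun m hm => h9 m hm)
    have : 0 < Real.log 2 / 2 ^ k := by have := Real.log_pos (one_lt_two); positivity
    linarith

/-! ### Connecting orbits -/

lemma IsPeriodicOrbit.injOn {c : ℂ} {O : Set ℂ} (hO : IsPeriodicOrbit c O) :
    InjOn (quadMap c) O := by
  intro x hx y hy hxy
  rw [← hO.iterate_ncard hx, ← hO.iterate_ncard hy, ← Nat.sub_add_cancel hO.ncard_pos,
    Function.iterate_succ_apply, Function.iterate_succ_apply, hxy]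

lemma quadMap_neg (c z : ℂ) : quadMap c (-z) = quadMap c z := by simp [quadMap]

/-- A repelling orbit has a preimage that is not on the forward orbit of the critical value and
reaches the orbit without meeting the critical point; the only exception is the fixed point `2`
of `f_{-2}`. -/
lemma exists_noncritical_preimage {c : ℂ} {O : Set ℂ} (hO : IsRepellingOrbit c O)
    (hexc : c = -2 → O ≠ {2}) :
    ∃ (y : ℂ) (m : ℕ), (quadMap c)^[m] y ∈ O ∧ deriv ((quadMap c)^[m]) y ≠ 0 ∧
      ∀ i, (quadMap c)^[i] c ≠ y := by
  classical
  have hper := hO.1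
  by_cases hcrit : ∃ i, (quadMap c)^[i] c ∈ O
  swap
  · push Not at hcrit
    obtain ⟨z, -, rfl⟩ := id hper
    exact ⟨z, 0, ⟨0, rfl⟩, by simp, fun i hi => hcrit i (hi ▸ ⟨0, rfl⟩)⟩
  -- First entry time of the orbit of the critical value into `O`. The orbit stays in `O`
  -- afterwards, so it enters only once, at the image of the point `a'` below.
  set i₀ := Nat.find hcrit with hi₀
  have hmem : (quadMap c)^[i₀] c ∈ O := Nat.find_spec hcrit
  have hmin : ∀ i, i < i₀ → (quadMap c)^[i] c ∉ O := fun i hi => Nat.find_min hcrit hi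
  have hlater : ∀ i, i₀ ≤ i → (quadMap c)^[i] c ∈ O := fun i hi => by
    rw [← Nat.sub_add_cancel hi, Function.iterate_add_apply]
    exact hper.iterate_mem hmem _
  obtain ⟨a', ha', haa⟩ : ∃ a' ∈ O, quadMap c a' = (quadMap c)^[i₀] c := by
    refine ⟨_, hper.iterate_mem hmem (O.ncard - 1), ?_⟩
    rw [← Function.iterate_succ_apply' (quadMap c), Nat.succ_eq_add_one, Nat.sub_add_cancel hper.ncard_pos,
      hper.iterate_ncard hmem]
  by_cases hw : ∃ w ∈ O, w ≠ a'
  -- For `w ≠ a'` in `O`, the point `-w` is off `O` and maps to a point of `O` other than the entry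
  -- point, so the critical value never visits it.
  · obtain ⟨w, hwO, hwa⟩ := hw
    have hw0 : w ≠ 0 := hO.ne_zero hwO
    have hfw : quadMap c w ∈ O := hper.iterate_mem hwO 1
    have hnegO : -w ∉ O := fun h => hw0 (by
      have := hper.injOn h hwO (quadMap_neg c w)
      exact self_eq_neg.1 this.symm)
    refine ⟨-w, 1, ?_, ?_, fun i hi => ?_⟩
    · rwa [Function.iterate_one, quadMap_neg]
    · rw [Function.iterate_one, (hasDerivAt_quadMap c (-w)).deriv]
      simpa using hw0
    · have h1 : i < i₀ := by
        by_contra h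
        exact hnegO (hi ▸ hlater i (not_lt.1 h))
      have h2 : (quadMap c)^[i + 1] c = quadMap c w := by
        rw [Function.iterate_succ_apply', hi, quadMap_neg]
      have h3 : i + 1 = i₀ := by
        by_contra h
        exact hmin (i + 1) (by omega) (h2 ▸ hfw)
      rw [← h3, h2] at haa
      exact hwa (hper.injOn ha' hwO haa).symm
  · push Not at hw
    have hOa : O = {a'} := Subset.antisymm (fun w hwO => hw w hwO) (singleton_subset_iff.2 ha')
    have hfix : quadMap c a' = a' := hw _ (hper.iterate_mem ha' 1)
    have ha0 : a' ≠ 0 := hO.ne_zero ha'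
    have hi₀pos : i₀ ≠ 0 := by
      intro h
      rw [h, Function.iterate_zero, id] at haa
      rw [quadMap] at haa
      exact ha0 (by simpa using haa)
    have hneg : (quadMap c)^[i₀ - 1] c = -a' := by
      have h1 : quadMap c ((quadMap c)^[i₀ - 1] c) = quadMap c a' := by
        rw [← Function.iterate_succ_apply' (quadMap c), haa, Nat.succ_eq_add_one,
          Nat.sub_add_cancel (Nat.pos_of_ne_zero hi₀pos)]
      set b := (quadMap c)^[i₀ - 1] c with hb
      simp only [quadMap, add_left_inj, sq_eq_sq_iff_eq_or_eq_neg] at h1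
      rcases h1 with h1 | h1
      · exact absurd (h1 ▸ ha') (hmin _ (by omega))
      · exact h1
    have hnegO : -a' ∉ O := by
      rw [← hneg]
      exact hmin _ (by omega)
    rcases Nat.lt_or_ge i₀ 2 with hlt | hge
    -- Here `c = -a'` with `a'` fixed, which forces `a' = 2` and `c = -2`, the excluded case.
    · exfalso
      have h1 : i₀ = 1 := by omega
      rw [h1] at hneg
      simp only [Nat.sub_self, Function.iterate_zero, id] at hneg
      have h2 : a' * (a' - 2) = 0 := by
        rw [quadMap, hneg] at hfix
        linear_combination hfix
      rcases mul_eq_zero.1 h2 with h3 | h3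
      · exact ha0 h3
      · have h4 : a' = 2 := sub_eq_zero.1 h3
        exact hexc (by rw [hneg, h4]) (by rw [hOa, h4])
    -- The critical value passes through `b`, then `-a'`, then `a'`. The other preimage `-b` of
    -- `-a'` is not visited, and `b ≠ 0` because otherwise `c = -a'` would enter `O` too early.
    · set b := (quadMap c)^[i₀ - 2] c with hb
      have hfb : quadMap c b = -a' := by
        rw [hb, ← Function.iterate_succ_apply' (quadMap c), ← hneg]
        congr 2
        omega
      have hb0 : b ≠ 0 := by
        intro h
        have hca : c = -a' := by rw [← hfb, h, quadMap]; simp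
        refine hmin 1 (by omega) ?_
        rw [Function.iterate_one]
        nth_rewrite 2 [hca]
        rw [quadMap_neg, hfix]
        exact ha'
      have hf2 : (quadMap c)^[2] (-b) = a' := by
        rw [Function.iterate_succ_apply, Function.iterate_one, quadMap_neg, hfb, quadMap_neg, hfix]
      refine ⟨-b, 2, ?_, ?_, fun i hi => ?_⟩
      · rw [hf2]; exact ha'
      · rw [deriv_iterate_quadMap, Finset.prod_range_succ, Finset.prod_range_one,
          Function.iterate_zero, id, Function.iterate_one, quadMap_neg, hfb]
        simp [hb0, ha0]
      · have h1 : (quadMap c)^[i + 1] c = -a' := by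
          rw [Function.iterate_succ_apply', hi, quadMap_neg, hfb]
        have h2 : (quadMap c)^[i + 2] c = a' := by
          rw [Function.iterate_succ_apply', h1, quadMap_neg, hfix]
        have h3 : i + 1 < i₀ := by
          by_contra h
          exact hnegO (h1 ▸ hlater _ (not_lt.1 h))
        have h4 : i = i₀ - 2 := by
          by_contra h
          exact hmin (i + 2) (by omega) (h2 ▸ ha')
        rw [h4, ← hb] at hi
        exact hb0 (self_eq_neg.1 hi)

/-- Arbitrarily close to a repelling periodic point there are points that land on a given
non-exceptional repelling orbit without meeting the critical point. -/
lemma exists_connecting_point {c z₁ z₂ : ℂ} {N : ℕ} {O : Set ℂ} (hN : 0 < N)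
    (hz₁ : (quadMap c)^[N] z₁ = z₁) (h1 : 1 < ‖deriv ((quadMap c)^[N]) z₁‖)
    (hO : IsRepellingOrbit c O) (hexc : c = -2 → O ≠ {2}) (hz₂ : z₂ ∈ O) {r : ℝ} (hr : 0 < r) :
    ∃ w ∈ Metric.ball z₁ r, ∃ m, (quadMap c)^[m] w = z₂ ∧ deriv ((quadMap c)^[m]) w ≠ 0 := by
  obtain ⟨y, m, hym, hyd, hyc⟩ := exists_noncritical_preimage hO hexc
  -- The second target is a preimage of the first, so hitting either one leads to `y`. If `y` equals
  -- the chosen root `s`, the other root serves; the two differ because `y ≠ c`.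
  obtain ⟨y', hy', hfy'⟩ : ∃ y', y ≠ y' ∧ quadMap c y' = y := by
    obtain ⟨s, hs⟩ := IsAlgClosed.exists_eq_mul_self (y - c)
    have hfs : quadMap c s = y := by rw [quadMap]; linear_combination -hs
    by_cases hsy : y = s
    · refine ⟨-s, fun h => ?_, by rw [quadMap_neg, hfs]⟩
      have hs0 : s = 0 := self_eq_neg.1 (hsy ▸ h)
      refine hyc 0 ?_
      rw [hs0, mul_zero, sub_eq_zero] at hs
      simpa using hs.symm
    · exact ⟨s, hsy, hfs⟩
  obtain ⟨w, hw, n, hn⟩ := exists_iterate_mem_pair hN hz₁ h1 hy' hr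
  obtain ⟨n, hn⟩ : ∃ n, (quadMap c)^[n] w = y := by
    rcases hn with hn | hn
    · exact ⟨n, hn⟩
    · exact ⟨n + 1, by rw [Function.iterate_succ_apply', hn, hfy']⟩
  -- A passage through `0` on the way to `y` would place `y` on the forward orbit of `c`.
  have hnd : deriv ((quadMap c)^[n]) w ≠ 0 := by
    rw [deriv_iterate_quadMap, Finset.prod_ne_zero_iff]
    intro i hi h0
    rw [Finset.mem_range] at hi
    have hi0 : (quadMap c)^[i] w = 0 := by simpa using h0
    refine hyc (n - i - 1) ?_
    have h2 : quadMap c 0 = c := by simp [quadMap]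
    nth_rewrite 2 [← h2]
    rw [← hi0, ← Function.iterate_succ_apply, ← Function.iterate_add_apply, ← hn]
    congr 1
    omega
  obtain ⟨k, hk⟩ : ∃ k, (quadMap c)^[k] ((quadMap c)^[m] y) = z₂ := by
    have := (hO.1.eq_orbitSet hym).2
    rw [this] at hz₂
    exact hz₂
  have hkd : deriv ((quadMap c)^[k]) ((quadMap c)^[m] y) ≠ 0 := by
    rw [deriv_iterate_quadMap, Finset.prod_ne_zero_iff]
    intro i _
    exact mul_ne_zero two_ne_zero (hO.ne_zero (hO.1.iterate_mem hym i))
  refine ⟨w, hw, k + (m + n), ?_, ?_⟩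
  · rw [Function.iterate_add_apply, Function.iterate_add_apply, hn, hk]
  · rw [deriv_iterate_add_quadMap, deriv_iterate_add_quadMap, Function.iterate_add_apply, hn]
    exact mul_ne_zero hkd (mul_ne_zero hyd hnd)

/-! ### Holomorphic families of contracting inverse branches -/

/-- `G (c, ·) : D → D'`, for `c` in the disc of radius `δ` about `c₀`, is a holomorphic family of
`κ`-Lipschitz inverse branches of `f_c^n`. -/
structure IsInverseBranch (c₀ : ℂ) (δ κ : ℝ) (D D' : Set ℂ) (n : ℕ) (G : ℂ × ℂ → ℂ) : Prop where
  mem : ∀ c ∈ Metric.ball c₀ δ, ∀ x ∈ D, G (c, x) ∈ D'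
  lip : ∀ c ∈ Metric.ball c₀ δ, ∀ x ∈ D, ∀ y ∈ D, ‖G (c, x) - G (c, y)‖ ≤ κ * ‖x - y‖
  inv : ∀ c ∈ Metric.ball c₀ δ, ∀ x ∈ D, (quadMap c)^[n] (G (c, x)) = x
  diff : ∀ c ∈ Metric.ball c₀ δ, ∀ x ∈ D, DifferentiableAt ℂ G (c, x)

namespace IsInverseBranch

variable {c₀ : ℂ} {δ δ' κ κ' : ℝ} {D D' D'' : Set ℂ} {m n : ℕ} {G H : ℂ × ℂ → ℂ}

lemma mono (h : IsInverseBranch c₀ δ κ D D' n G) (hδ : δ' ≤ δ) (hκ : κ ≤ κ') :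
    IsInverseBranch c₀ δ' κ' D D' n G where
  mem c hc := h.mem c (Metric.ball_subset_ball hδ hc)
  lip c hc x hx y hy := (h.lip c (Metric.ball_subset_ball hδ hc) x hx y hy).trans
    (mul_le_mul_of_nonneg_right hκ (norm_nonneg _))
  inv c hc := h.inv c (Metric.ball_subset_ball hδ hc)
  diff c hc := h.diff c (Metric.ball_subset_ball hδ hc)

lemma restrict {E E' : Set ℂ} (h : IsInverseBranch c₀ δ κ D D' n G) (hE : E ⊆ D)
    (hE' : ∀ c ∈ Metric.ball c₀ δ, ∀ x ∈ E, G (c, x) ∈ E') :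
    IsInverseBranch c₀ δ κ E E' n G where
  mem := hE'
  lip c hc x hx y hy := h.lip c hc x (hE hx) y (hE hy)
  inv c hc x hx := h.inv c hc x (hE hx)
  diff c hc x hx := h.diff c hc x (hE hx)

lemma comp (hG : IsInverseBranch c₀ δ κ D' D'' n G) (hH : IsInverseBranch c₀ δ κ' D D' m H)
    (hκ : 0 ≤ κ) :
    IsInverseBranch c₀ δ (κ * κ') D D'' (m + n) (fun p => G (p.1, H p)) where
  mem c hc x hx := hG.mem c hc _ (hH.mem c hc x hx)
  lip c hc x hx y hy := by
    refine (hG.lip c hc _ (hH.mem c hc x hx) _ (hH.mem c hc y hy)).trans ?_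
    rw [mul_assoc]
    exact mul_le_mul_of_nonneg_left (hH.lip c hc x hx y hy) hκ
  inv c hc x hx := by
    simp only
    rw [Function.iterate_add_apply, hG.inv c hc _ (hH.mem c hc x hx), hH.inv c hc x hx]
  diff c hc x hx := by
    have h1 := hG.diff c hc _ (hH.mem c hc x hx)
    exact DifferentiableAt.comp (c, x) (f := fun p : ℂ × ℂ => (p.1, H p)) h1
      (differentiableAt_fst.prodMk (hH.diff c hc x hx))

lemma iterate (hG : IsInverseBranch c₀ δ κ D D n G) (hκ : 0 ≤ κ) (a : ℕ) :
    IsInverseBranch c₀ δ (κ ^ a) D D (a * n) (fun p => (fun x => G (p.1, x))^[a] p.2) := by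
  induction a with
  | zero => exact ⟨fun _ _ x hx => hx, by simp, by simp, fun _ _ x _ => by simp⟩
  | succ a ih =>
    have := hG.comp ih hκ
    rw [pow_succ', Nat.succ_mul]
    convert! this using 2 with p
    exact Function.iterate_succ_apply' _ _ _

/-- The derivative of `f_c^n` along a contracting inverse branch. -/
lemma one_le_mul_norm_deriv {p x : ℂ} {r : ℝ}
    (h : IsInverseBranch c₀ δ κ (Metric.closedBall p r) D' n G) {c : ℂ}
    (hc : c ∈ Metric.ball c₀ δ) (hr : 0 < r) (hx : x ∈ Metric.closedBall p r) :
    1 ≤ κ * ‖deriv ((quadMap c)^[n]) (G (c, x))‖ := by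
  -- The point `x` may lie on the boundary, so `G` is compared with the identity only within the
  -- closed disc, where derivatives are unique by convexity.
  have huniq : UniqueDiffWithinAt ℂ (Metric.closedBall p r) x := by
    have h1 : UniqueDiffOn ℝ (Metric.closedBall p r) := uniqueDiffOn_convex
      (convex_closedBall p r) ((Metric.nonempty_ball.2 hr).mono Metric.ball_subset_interior_closedBall)
    exact (h1 x hx).mono_field
  have hGd : HasDerivWithinAt (fun y => G (c, y)) (deriv (fun y => G (c, y)) x)
      (Metric.closedBall p r) x := by
    have h1 := DifferentiableAt.comp x (f := fun y : ℂ => (c, y)) (h.diff c hc x hx)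
      ((differentiableAt_const c).prodMk differentiableAt_id)
    exact h1.hasDerivAt.hasDerivWithinAt
  set g := deriv (fun y => G (c, y)) x
  have hf := (differentiable_iterate_quadMap c n (G (c, x))).hasDerivAt
  have h1 : HasDerivWithinAt (fun y => (quadMap c)^[n] (G (c, y)))
      (deriv ((quadMap c)^[n]) (G (c, x)) * g) (Metric.closedBall p r) x :=
    hf.comp_hasDerivWithinAt x hGd
  have h2 : HasDerivWithinAt (fun y => (quadMap c)^[n] (G (c, y))) 1 (Metric.closedBall p r) x :=
    (hasDerivWithinAt_id x _).congr (fun y hy => h.inv c hc y hy) (h.inv c hc x hx)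
  have h3 := huniq.eq_deriv _ h1 h2
  have h4 : ‖g‖ ≤ κ := by
    have h5 := (hasDerivWithinAt_iff_tendsto_slope.1 hGd).norm
    have : NeBot (𝓝[Metric.closedBall p r \ {x}] x) :=
      accPt_principal_iff_nhdsWithin.1 huniq.accPt
    refine le_of_tendsto h5 ?_
    filter_upwards [self_mem_nhdsWithin] with y hy
    have hy0 : 0 < ‖y - x‖ := norm_pos_iff.2 (sub_ne_zero.2 hy.2)
    rw [slope_def_field, norm_div, div_le_iff₀ hy0]
    exact h.lip c hc y hy.1 x hx
  calc (1 : ℝ) = ‖deriv ((quadMap c)^[n]) (G (c, x))‖ * ‖g‖ := by rw [← norm_mul, h3, norm_one]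
    _ ≤ _ := by rw [mul_comm]; gcongr

end IsInverseBranch

/-- A contracting holomorphic family of maps of a disc has a holomorphic fixed point. -/
lemma IsInverseBranch.exists_fixedPoint {c₀ : ℂ} {δ κ : ℝ} {p : ℂ} {r : ℝ} {n : ℕ}
    {G : ℂ × ℂ → ℂ} (h : IsInverseBranch c₀ δ κ (Metric.closedBall p r) (Metric.closedBall p r) n G)
    (hr : 0 ≤ r) (hκ0 : 0 ≤ κ) (hκ : κ < 1) :
    ∃ z : ℂ → ℂ, DifferentiableOn ℂ z (Metric.ball c₀ δ) ∧
      ∀ c ∈ Metric.ball c₀ δ, z c ∈ Metric.closedBall p r ∧ G (c, z c) = z c := by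
  set X : ℕ → ℂ → ℂ := fun k c => (fun x => G (c, x))^[k] p with hX
  have hpm : p ∈ Metric.closedBall p r := Metric.mem_closedBall_self hr
  have hit := fun k => h.iterate hκ0 k
  have hXm : ∀ k, ∀ c ∈ Metric.ball c₀ δ, X k c ∈ Metric.closedBall p r := fun k c hc =>
    (hit k).mem c hc p hpm
  have hXd : ∀ k, DifferentiableOn ℂ (X k) (Metric.ball c₀ δ) := fun k c hc => by
    have h1 := (hit k).diff c hc p hpm
    exact (DifferentiableAt.comp c (f := fun c : ℂ => (c, p)) h1
      (differentiableAt_id.prodMk (differentiableAt_const p))).differentiableWithinAt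
  have hdist : ∀ c ∈ Metric.ball c₀ δ, ∀ k, dist (X k c) (X (k + 1) c) ≤ r * κ ^ k :=
    fun c hc k => by
      have h1 := (hit k).lip c hc p hpm _ (h.mem c hc p hpm)
      have h2 := h.mem c hc p hpm
      rw [dist_eq_norm]
      simp only [hX, Function.iterate_succ_apply]
      refine h1.trans ?_
      rw [mul_comm]
      rw [mem_closedBall_iff_norm, norm_sub_rev] at h2
      gcongr
  have hlim : ∀ c ∈ Metric.ball c₀ δ, ∃ l, Tendsto (fun k => X k c) atTop (𝓝 l) := fun c hc =>
    cauchySeq_tendsto_of_complete (cauchySeq_of_le_geometric κ r hκ (hdist c hc))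
  choose! z hz using hlim
  have hunif : TendstoUniformlyOn X z atTop (Metric.ball c₀ δ) := by
    rw [Metric.tendstoUniformlyOn_iff]
    intro ε hε
    have h0 : Tendsto (fun k : ℕ => r * κ ^ k / (1 - κ)) atTop (𝓝 0) := by
      have := (tendsto_pow_atTop_nhds_zero_of_lt_one hκ0 hκ).const_mul r
      simpa using this.div_const (1 - κ)
    filter_upwards [h0.eventually (gt_mem_nhds hε)] with k hk c hc
    rw [dist_comm]
    exact (dist_le_of_le_geometric_of_tendsto κ r hκ (hdist c hc) (hz c hc) k).trans_lt hk
  refine ⟨z, hunif.tendstoLocallyUniformlyOn.differentiableOn (Eventually.of_forall hXd)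
    Metric.isOpen_ball, fun c hc => ?_⟩
  have hzm : z c ∈ Metric.closedBall p r :=
    Metric.isClosed_closedBall.mem_of_tendsto (hz c hc) (Eventually.of_forall fun k => hXm k c hc)
  refine ⟨hzm, ?_⟩
  refine tendsto_nhds_unique (f := fun k => X (k + 1) c) ?_
    ((tendsto_add_atTop_iff_nat 1).2 (hz c hc))
  have hz0 := tendsto_iff_norm_sub_tendsto_zero.1 (hz c hc)
  rw [tendsto_iff_norm_sub_tendsto_zero]
  refine squeeze_zero (fun _ => norm_nonneg _) (fun k => ?_) (by simpa using hz0.const_mul κ)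
  simp only [hX, Function.iterate_succ_apply']
  exact h.lip c hc _ (hXm k c hc) _ hzm

/-- Inverse function theorem for `f_c^n`, with parameters. -/
lemma exists_isInverseBranch {c₀ p : ℂ} {n : ℕ} (hd : deriv ((quadMap c₀)^[n]) p ≠ 0) {K ε : ℝ}
    (hK : ‖deriv ((quadMap c₀)^[n]) p‖⁻¹ < K) (hε : 0 < ε) :
    ∃ (δ r : ℝ) (G : ℂ × ℂ → ℂ), 0 < δ ∧ 0 < r ∧ G (c₀, (quadMap c₀)^[n] p) = p ∧
      IsInverseBranch c₀ δ K (Metric.closedBall ((quadMap c₀)^[n] p) r) (Metric.closedBall p ε)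
        n G := by
  set d := deriv ((quadMap c₀)^[n]) p with hd'
  set F : ℂ × ℂ → ℂ := fun v => (quadMap v.1)^[n] v.2 with hF
  have hFc : ContDiff ℂ ⊤ F := contDiff_iterate_quadMap n
  have hFd : HasFDerivAt F (fderiv ℂ F (c₀, p)) (c₀, p) :=
    (hFc.differentiable (by simp)).differentiableAt.hasFDerivAt
  have hFk : ∀ k, fderiv ℂ F (c₀, p) (0, k) = d * k := by
    intro k
    have h1 : HasDerivAt (fun x : ℂ => (c₀, x)) (0, 1) p :=
      (hasDerivAt_const p c₀).prodMk (hasDerivAt_id p)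
    have h2 := hFd.comp_hasDerivAt p h1
    have h3 : fderiv ℂ F (c₀, p) (0, 1) = d := h2.deriv.symm
    have : ((0 : ℂ), k) = k • ((0 : ℂ), (1 : ℂ)) := by simp
    rw [this, map_smul, h3, smul_eq_mul, mul_comm]
  -- Inverting `(c, x) ↦ (c, f_c^n(x))` gives the inverse branches for all parameters at once.
  -- Strict differentiability yields any Lipschitz constant above `‖d‖⁻¹` in the second variable.
  set Φ : ℂ × ℂ → ℂ × ℂ := fun v => (v.1, F v) with hΦ
  have hΦc : ContDiffAt ℂ ⊤ Φ (c₀, p) := (contDiff_fst.prodMk hFc).contDiffAt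
  set A : ℂ × ℂ →L[ℂ] ℂ × ℂ := (ContinuousLinearMap.fst ℂ ℂ ℂ).prod (fderiv ℂ F (c₀, p)) with hA
  have hAd : HasFDerivAt Φ A (c₀, p) := hasFDerivAt_fst.prodMk hFd
  have hker : A.ker = ⊥ := by
    rw [LinearMap.ker_eq_bot']
    rintro ⟨h, k⟩ hk
    simp only [hA, ContinuousLinearMap.coe_coe, ContinuousLinearMap.prod_apply,
      ContinuousLinearMap.coe_fst', Prod.mk_eq_zero] at hk
    obtain ⟨rfl, hk⟩ := hk
    rw [hFk, mul_eq_zero] at hk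
    rw [Prod.mk_eq_zero]
    exact ⟨rfl, hk.resolve_left hd⟩
  have hrange : A.range = ⊤ := LinearMap.ker_eq_bot_iff_range_eq_top.1 hker
  set e : (ℂ × ℂ) ≃L[ℂ] ℂ × ℂ := ContinuousLinearEquiv.ofBijective A hker hrange with he
  have hee : (e : ℂ × ℂ →L[ℂ] ℂ × ℂ) = A := ContinuousLinearEquiv.coe_ofBijective A hker hrange
  have hed : HasFDerivAt Φ (e : ℂ × ℂ →L[ℂ] ℂ × ℂ) (c₀, p) := by rwa [hee]
  have hstrict := hΦc.hasStrictFDerivAt' hed (by simp)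
  set I : ℂ × ℂ → ℂ × ℂ := hΦc.localInverse hed (by simp) with hI
  have hIc : ContDiffAt ℂ ⊤ I (Φ (c₀, p)) := hΦc.to_localInverse hed (by simp)
  have hI0 : I (Φ (c₀, p)) = (c₀, p) := hΦc.localInverse_apply_image hed (by simp)
  have hIr : ∀ᶠ v in 𝓝 (Φ (c₀, p)), Φ (I v) = v := hstrict.eventually_right_inverse
  have hIs : HasStrictFDerivAt I (e.symm : ℂ × ℂ →L[ℂ] ℂ × ℂ) (Φ (c₀, p)) :=
    hstrict.to_localInverse
  set q := (quadMap c₀)^[n] p with hq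
  have hΦp : Φ (c₀, p) = (c₀, q) := rfl
  rw [hΦp] at hIc hI0 hIr hIs
  have hesymm : ∀ k, (e.symm (0, k)).2 = d⁻¹ * k := by
    intro k
    have h1 : e (0, d⁻¹ * k) = (0, k) := by
      have : e (0, d⁻¹ * k) = A (0, d⁻¹ * k) := by rw [← hee]; rfl
      rw [this]
      simp only [hA, ContinuousLinearMap.prod_apply, ContinuousLinearMap.coe_fst', hFk]
      rw [mul_inv_cancel_left₀ hd]
    rw [← h1, ContinuousLinearEquiv.symm_apply_apply]
  have hpos : 0 < K - ‖d‖⁻¹ := by linarith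
  obtain ⟨s, hs, happ⟩ := hIs.approximates_deriv_on_nhds (c := ⟨K - ‖d‖⁻¹, hpos.le⟩)
    (Or.inr (by exact_mod_cast hpos))
  have hdiff : ∀ᶠ v in 𝓝 (c₀, q), DifferentiableAt ℂ I v := by
    filter_upwards [hIc.eventually (by simp)] with v hv using hv.differentiableAt (by simp)
  have hclose : ∀ᶠ v in 𝓝 (c₀, q), (I v).2 ∈ Metric.closedBall p ε := by
    have h1 : ContinuousAt (fun v => (I v).2) (c₀, q) := hIc.continuousAt.snd
    refine h1.eventually ?_
    simp only [hI0]
    exact Metric.closedBall_mem_nhds p hε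
  obtain ⟨ε₀, hε₀, hball⟩ := Metric.eventually_nhds_iff_ball.1
    (hIr.and (hdiff.and (hclose.and hs)))
  have hmem : ∀ c ∈ Metric.ball c₀ ε₀, ∀ x ∈ Metric.closedBall q (ε₀ / 2),
      (c, x) ∈ Metric.ball (c₀, q) ε₀ := fun c hc x hx => by
    rw [Metric.mem_ball, Prod.dist_eq]
    exact max_lt hc (lt_of_le_of_lt hx (by linarith))
  refine ⟨ε₀, ε₀ / 2, fun v => (I v).2, hε₀, by positivity, by simp only [hI0], ?_, ?_, ?_, ?_⟩
  · exact fun c hc x hx => (hball _ (hmem c hc x hx)).2.2.1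
  · intro c hc x hx y hy
    have h1 := happ (c, x) (hball _ (hmem c hc x hx)).2.2.2 (c, y) (hball _ (hmem c hc y hy)).2.2.2
    have h2 : ((c, x) : ℂ × ℂ) - (c, y) = (0, x - y) := by simp
    rw [h2] at h1
    have h3 : ‖((0 : ℂ), x - y)‖ = ‖x - y‖ := by simp [Prod.norm_def]
    rw [h3] at h1
    have h4 := (norm_snd_le _).trans h1
    simp only [Prod.snd_sub, ContinuousLinearEquiv.coe_coe, hesymm] at h4
    have h5 := norm_add_le ((I (c, x)).2 - (I (c, y)).2 - d⁻¹ * (x - y)) (d⁻¹ * (x - y))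
    rw [sub_add_cancel, norm_mul, norm_inv] at h5
    calc _ ≤ _ := h5
      _ ≤ (K - ‖d‖⁻¹) * ‖x - y‖ + ‖d‖⁻¹ * ‖x - y‖ := by gcongr; exact h4
      _ = K * ‖x - y‖ := by ring
  · intro c hc x hx
    have h1 := (hball _ (hmem c hc x hx)).1
    have h2 : (I (c, x)).1 = c := congrArg Prod.fst h1
    have h3 : (quadMap (I (c, x)).1)^[n] (I (c, x)).2 = x := congrArg Prod.snd h1
    rwa [h2] at h3
  · exact fun c hc x hx => (hball _ (hmem c hc x hx)).2.1.snd

/-- Near a repelling periodic point, the local inverse of the return map is a contracting family of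
maps of a disc into itself. -/
lemma exists_isInverseBranch_self {c₀ z : ℂ} {n : ℕ} (hz : (quadMap c₀)^[n] z = z)
    (h1 : 1 < ‖deriv ((quadMap c₀)^[n]) z‖) {ε : ℝ} (hε : 0 < ε) :
    ∃ (δ r κ : ℝ) (G : ℂ × ℂ → ℂ), 0 < δ ∧ 0 < r ∧ r ≤ ε ∧ 0 < κ ∧ κ < 1 ∧ G (c₀, z) = z ∧
      IsInverseBranch c₀ δ κ (Metric.closedBall z r) (Metric.closedBall z r) n G := by
  obtain ⟨κ, hκ0, hκ1⟩ := exists_between (inv_lt_one_of_one_lt₀ h1)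
  have hκp : 0 < κ := (inv_pos.2 (one_pos.trans h1)).trans hκ0
  obtain ⟨δ, r, G, hδ, hr, hG0, hG⟩ := exists_isInverseBranch
    (norm_pos_iff.1 (one_pos.trans h1)) hκ0 one_pos
  rw [hz] at hG0 hG
  have hs : 0 < min r ε := lt_min hr hε
  have hcont : ContinuousAt (fun c => G (c, z)) c₀ :=
    ContinuousAt.comp (f := fun c : ℂ => (c, z))
      (hG.diff c₀ (Metric.mem_ball_self hδ) z (Metric.mem_closedBall_self hr.le)).continuousAt
      (continuousAt_id.prodMk continuousAt_const)
  -- The image of the centre moves by at most `(1 - κ)` times the radius, exactly the room that a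
  -- `κ`-contraction leaves in the disc.
  have hev := hcont.eventually (Metric.closedBall_mem_nhds (G (c₀, z))
    (mul_pos (sub_pos.2 hκ1) hs))
  obtain ⟨δ', hδ', hball⟩ := Metric.eventually_nhds_iff_ball.1 hev
  refine ⟨min δ δ', min r ε, κ, G, lt_min hδ hδ', hs, min_le_right _ _, hκp, hκ1, hG0,
    (hG.mono (min_le_left _ _) le_rfl).restrict
      (Metric.closedBall_subset_closedBall (min_le_left _ _)) fun c hc x hx => ?_⟩
  have h2 := hG.lip c (Metric.ball_subset_ball (min_le_left _ _) hc) x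
    (Metric.closedBall_subset_closedBall (min_le_left _ _) hx) z (Metric.mem_closedBall_self hr.le)
  have h3 := hball c (Metric.ball_subset_ball (min_le_right _ _) hc)
  rw [hG0, dist_eq_norm] at h3
  rw [mem_closedBall_iff_norm] at hx ⊢
  calc ‖G (c, x) - z‖ ≤ ‖G (c, x) - G (c, z)‖ + ‖G (c, z) - z‖ := norm_sub_le_norm_sub_add_norm_sub _ _ _
    _ ≤ κ * min r ε + (1 - κ) * min r ε := by
      gcongr
      exact h2.trans (by gcongr)
    _ = min r ε := by ring

/-- A contracting family of inverse branches from a disc about a repelling point to any disc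
containing one of its noncritical preimages. -/
lemma exists_isInverseBranch_connecting {c₀ z₁ z₂ w : ℂ} {δ κ r₁ r₂ : ℝ} {m n : ℕ}
    {G : ℂ × ℂ → ℂ}
    (hG : IsInverseBranch c₀ δ κ (Metric.closedBall z₂ r₂) (Metric.closedBall z₂ r₂) n G)
    (hδ : 0 < δ) (hr₂ : 0 < r₂) (hκ0 : 0 ≤ κ) (hκ1 : κ < 1) (hG0 : G (c₀, z₂) = z₂)
    (hw : w ∈ Metric.ball z₁ r₁) (hwz : (quadMap c₀)^[m] w = z₂)
    (hd : deriv ((quadMap c₀)^[m]) w ≠ 0) :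
    ∃ (δ' : ℝ) (l : ℕ) (A : ℂ × ℂ → ℂ), 0 < δ' ∧
      IsInverseBranch c₀ δ' (1 / 2) (Metric.closedBall z₂ r₂) (Metric.closedBall z₁ r₁) l A := by
  obtain ⟨ε, hε, hεw⟩ := Metric.nhds_basis_closedBall.mem_iff.1 (Metric.isOpen_ball.mem_nhds hw)
  obtain ⟨δ₁, r, H, hδ₁, hr, -, hH⟩ := exists_isInverseBranch hd
    (lt_add_one ‖deriv ((quadMap c₀)^[m]) w‖⁻¹) hε
  rw [hwz] at hH
  set K := ‖deriv ((quadMap c₀)^[m]) w‖⁻¹ + 1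
  have hK : 0 ≤ K := by positivity
  have hH' : IsInverseBranch c₀ δ₁ K (Metric.closedBall z₂ r) (Metric.closedBall z₁ r₁) m H :=
    hH.restrict subset_rfl fun c hc x hx =>
      Metric.ball_subset_closedBall (hεw (hH.mem c hc x hx))
  have hpow := tendsto_pow_atTop_nhds_zero_of_lt_one hκ0 hκ1
  -- First turn `b` times around `z₂`: this shrinks the disc into the domain of the local inverse at
  -- `w` and brings the total Lipschitz constant below `1 / 2`.
  have e1 : ∀ᶠ b : ℕ in atTop, κ ^ b * r₂ < r / 2 :=
    (by simpa using hpow.mul_const r₂ : Tendsto (fun b : ℕ => κ ^ b * r₂) atTop (𝓝 0)).eventually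
      (gt_mem_nhds (by positivity))
  have e2 : ∀ᶠ b : ℕ in atTop, K * κ ^ b < 1 / 2 :=
    (by simpa using hpow.const_mul K : Tendsto (fun b : ℕ => K * κ ^ b) atTop (𝓝 0)).eventually
      (gt_mem_nhds (by positivity))
  obtain ⟨b, hb1, hb2⟩ := (e1.and e2).exists
  have hGb := hG.iterate hκ0 b
  set Gb : ℂ × ℂ → ℂ := fun p => (fun x => G (p.1, x))^[b] p.2 with hGbdef
  have hGb0 : Gb (c₀, z₂) = z₂ := Function.iterate_fixed hG0 b
  have hz₂ : z₂ ∈ Metric.closedBall z₂ r₂ := Metric.mem_closedBall_self hr₂.le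
  have hcont : ContinuousAt (fun c => Gb (c, z₂)) c₀ :=
    ContinuousAt.comp (f := fun c : ℂ => (c, z₂))
      (hGb.diff c₀ (Metric.mem_ball_self hδ) z₂ hz₂).continuousAt
      (continuousAt_id.prodMk continuousAt_const)
  have hev := hcont.eventually (Metric.closedBall_mem_nhds (Gb (c₀, z₂)) (half_pos hr))
  obtain ⟨δ₂, hδ₂, hball⟩ := Metric.eventually_nhds_iff_ball.1 hev
  have hle1 : min δ (min δ₁ δ₂) ≤ δ := min_le_left _ _
  have hle2 : min δ (min δ₁ δ₂) ≤ δ₁ := (min_le_right _ _).trans (min_le_left _ _)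
  have hle3 : min δ (min δ₁ δ₂) ≤ δ₂ := (min_le_right _ _).trans (min_le_right _ _)
  have hGb' : IsInverseBranch c₀ (min δ (min δ₁ δ₂)) (κ ^ b) (Metric.closedBall z₂ r₂)
      (Metric.closedBall z₂ r) (b * n) Gb := by
    refine (hGb.mono hle1 le_rfl).restrict subset_rfl fun c hc x hx => ?_
    have h2 := hGb.lip c (Metric.ball_subset_ball hle1 hc) x hx z₂ hz₂
    have h3 := hball c (Metric.ball_subset_ball hle3 hc)
    rw [hGb0, dist_eq_norm] at h3
    rw [mem_closedBall_iff_norm] at hx ⊢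
    have h4 : κ ^ b * ‖x - z₂‖ ≤ κ ^ b * r₂ := by gcongr
    have h5 := norm_sub_le_norm_sub_add_norm_sub (Gb (c, x)) (Gb (c, z₂)) z₂
    linarith
  exact ⟨_, _, _, lt_min hδ (lt_min hδ₁ hδ₂),
    ((hH'.mono hle2 le_rfl).comp hGb' hK).mono le_rfl hb2.le⟩

/-! ### Distortion and Cauchy estimates. -/

/-- The derivatives of the iterates of `f_c` are Lipschitz on a disc, uniformly for bounded `c`. -/
lemma exists_lipschitz_deriv_iterate (c₀ p : ℂ) (δ r : ℝ) (n : ℕ) :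
    ∃ K : ℝ, 0 ≤ K ∧ ∀ c ∈ Metric.closedBall c₀ δ, ∀ x ∈ Metric.closedBall p r,
      ∀ y ∈ Metric.closedBall p r,
        ‖deriv ((quadMap c)^[n]) x - deriv ((quadMap c)^[n]) y‖ ≤ K * ‖x - y‖ := by
  have h1 := (contDiff_deriv_iterate_quadMap n).restrict_scalars ℝ
  obtain ⟨K, hK⟩ := (h1.contDiffOn (s := Metric.closedBall c₀ δ ×ˢ Metric.closedBall p r)).exists_lipschitzOnWith (by simp)
    ((convex_closedBall c₀ δ).prod (convex_closedBall p r))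
    ((isCompact_closedBall c₀ δ).prod (isCompact_closedBall p r))
  refine ⟨K, K.2, fun c hc x hx y hy => ?_⟩
  have h2 := hK.norm_sub_le (x := (c, x)) ⟨hc, hx⟩ (y := (c, y)) ⟨hc, hy⟩
  simpa [Prod.norm_def] using h2

lemma exists_bound_deriv_iterate (c₀ p : ℂ) (δ r : ℝ) (n : ℕ) :
    ∃ K : ℝ, 1 ≤ K ∧ ∀ c ∈ Metric.closedBall c₀ δ, ∀ x ∈ Metric.closedBall p r,
      ‖deriv ((quadMap c)^[n]) x‖ ≤ K := by
  obtain ⟨K, hK⟩ := ((isCompact_closedBall c₀ δ).prod (isCompact_closedBall p r)).exists_bound_of_continuousOn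
    (contDiff_deriv_iterate_quadMap n).continuous.continuousOn
  exact ⟨max K 1, le_max_right _ _, fun c hc x hx => (hK (c, x) ⟨hc, hx⟩).trans (le_max_left _ _)⟩

/-- Bounded distortion: along an inverse branch the derivative of an iterate is comparable with the
power of the derivative at the fixed point. -/
lemma IsInverseBranch.exists_distortion {c₀ p : ℂ} {δ κ r : ℝ} {n : ℕ} {G : ℂ × ℂ → ℂ}
    (hG : IsInverseBranch c₀ δ κ (Metric.closedBall p r) (Metric.closedBall p r) n G)
    (hr : 0 < r) (hκ0 : 0 < κ) (hκ1 : κ < 1) :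
    ∃ B : ℝ, 1 ≤ B ∧ ∀ c ∈ Metric.ball c₀ δ, ∀ z ∈ Metric.closedBall p r, G (c, z) = z →
      ∀ x ∈ Metric.closedBall p r, ∀ a : ℕ,
        ‖deriv ((quadMap c)^[a * n]) ((fun y => G (c, y))^[a] x)‖
            ≤ B * ‖deriv ((quadMap c)^[n]) z‖ ^ a ∧
        ‖deriv ((quadMap c)^[n]) z‖ ^ a
            ≤ B * ‖deriv ((quadMap c)^[a * n]) ((fun y => G (c, y))^[a] x)‖ := by
  obtain ⟨K, hK0, hK⟩ := exists_lipschitz_deriv_iterate c₀ p δ r n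
  set C := K * (2 * r)
  have hC : 0 ≤ C := by positivity
  have h1κ : 0 < 1 - κ := by linarith
  refine ⟨Real.exp (C / (1 - κ)), Real.one_le_exp (by positivity), fun c hc z hz hGz x hx => ?_⟩
  have hone : ∀ y ∈ Metric.closedBall p r, 1 ≤ ‖deriv ((quadMap c)^[n]) (G (c, y))‖ :=
    fun y hy => (hG.one_le_mul_norm_deriv hc hr hy).trans
      (mul_le_of_le_one_left (norm_nonneg _) hκ1.le)
  set R := ‖deriv ((quadMap c)^[n]) z‖ with hR
  have hR1 : 1 ≤ R := by have := hone z hz; rwa [hGz] at this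
  set X : ℕ → ℂ := fun a => (fun y => G (c, y))^[a] x with hX
  have hXm : ∀ a, X a ∈ Metric.closedBall p r := fun a => (hG.iterate hκ0.le a).mem c hc x hx
  have hXs : ∀ a, X (a + 1) = G (c, X a) := fun a => Function.iterate_succ_apply' _ _ _
  have hXz : ∀ a, ‖X a - z‖ ≤ κ ^ a * (2 * r) := fun a => by
    have h1 := (hG.iterate hκ0.le a).lip c hc x hx z hz
    simp only [Function.iterate_fixed (f := fun y => G (c, y)) hGz a] at h1
    refine h1.trans ?_
    gcongr
    rw [← dist_eq_norm]
    calc dist x z ≤ dist x p + dist z p := dist_triangle_right _ _ _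
      _ ≤ 2 * r := by rw [two_mul]; exact add_le_add hx hz
  set M : ℕ → ℝ := fun a => ‖deriv ((quadMap c)^[n]) (X (a + 1))‖ with hM
  have hM1 : ∀ a, 1 ≤ M a := fun a => by simp only [hM, hXs]; exact hone _ (hXm a)
  have hMR : ∀ a, |M a - R| ≤ C * κ ^ a := fun a => by
    refine (abs_norm_sub_norm_le _ _).trans ((hK c (Metric.ball_subset_closedBall hc) _ (hXm _) z
      hz).trans ?_)
    calc K * ‖X (a + 1) - z‖ ≤ K * (κ ^ (a + 1) * (2 * r)) := by gcongr; exact hXz _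
      _ ≤ K * (κ ^ a * (2 * r)) := by
        gcongr K * (?_ * (2 * r))
        exact pow_le_pow_of_le_one hκ0.le hκ1.le (Nat.le_succ a)
      _ = C * κ ^ a := by ring
  have hexp : ∀ s t u : ℝ, 1 ≤ t → |s - t| ≤ u → s ≤ t * Real.exp u := by
    intro s t u ht hst
    have h1 := (abs_le.1 hst).2
    have hu : 0 ≤ u := (abs_nonneg _).trans hst
    calc s ≤ t * (u + 1) := by nlinarith
      _ ≤ t * Real.exp u := by gcongr; exact Real.add_one_le_exp u
  -- Each turn changes the comparison constant by a factor `exp (C * κ ^ a)`, since the backward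
  -- orbit approaches the fixed point geometrically. The exponent is the partial sum of the
  -- geometric series.
  have hmain : ∀ a, ‖deriv ((quadMap c)^[a * n]) (X a)‖
        ≤ Real.exp (C * (1 - κ ^ a) / (1 - κ)) * R ^ a ∧
      R ^ a ≤ Real.exp (C * (1 - κ ^ a) / (1 - κ)) * ‖deriv ((quadMap c)^[a * n]) (X a)‖ := by
    intro a
    induction a with
    | zero => simp
    | succ a ih =>
      have h1 : ‖deriv ((quadMap c)^[(a + 1) * n]) (X (a + 1))‖
          = ‖deriv ((quadMap c)^[a * n]) (X a)‖ * M a := by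
        rw [Nat.succ_mul, deriv_iterate_add_quadMap, norm_mul, hXs a, hG.inv c hc _ (hXm a),
          ← hXs a]
      have h2 : Real.exp (C * (1 - κ ^ (a + 1)) / (1 - κ))
          = Real.exp (C * (1 - κ ^ a) / (1 - κ)) * Real.exp (C * κ ^ a) := by
        rw [← Real.exp_add]
        congr 1
        field_simp
        ring
      rw [h1, h2, pow_succ]
      have h3 := hexp _ _ _ hR1 (hMR a)
      have h4 := hexp _ _ _ (hM1 a) ((abs_sub_comm R (M a)).trans_le (hMR a))
      constructor
      · calc _ ≤ (Real.exp (C * (1 - κ ^ a) / (1 - κ)) * R ^ a) * (R * Real.exp (C * κ ^ a)) :=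
            mul_le_mul ih.1 h3 (norm_nonneg _) (by positivity)
          _ = _ := by ring
      · calc _ ≤ (Real.exp (C * (1 - κ ^ a) / (1 - κ)) * ‖deriv ((quadMap c)^[a * n]) (X a)‖)
              * (M a * Real.exp (C * κ ^ a)) := mul_le_mul ih.2 h4 (by positivity) (by positivity)
          _ = _ := by ring
  intro a
  have hle : Real.exp (C * (1 - κ ^ a) / (1 - κ)) ≤ Real.exp (C / (1 - κ)) := by
    gcongr
    have : 0 ≤ κ ^ a := by positivity
    nlinarith
  exact ⟨(hmain a).1.trans (by gcongr), (hmain a).2.trans (by gcongr)⟩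

/-- Cauchy estimate for a logarithmic derivative. -/
lemma norm_logDeriv_le {c₀ : ℂ} {δ B : ℝ} (hδ : 0 < δ) {E : ℂ → ℂ}
    (hE : DifferentiableOn ℂ E (Metric.ball c₀ δ)) (hB : 1 ≤ B)
    (hu : ∀ c ∈ Metric.ball c₀ δ, ‖E c‖ ≤ B) (hl : ∀ c ∈ Metric.ball c₀ δ, 1 ≤ B * ‖E c‖)
    {c : ℂ} (hc : c ∈ Metric.ball c₀ (δ / 2)) : ‖logDeriv E c‖ ≤ 4 * B ^ 2 / δ := by
  have hsub : Metric.closedBall c (δ / 4) ⊆ Metric.ball c₀ δ := by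
    intro x hx
    have := dist_triangle x c c₀
    rw [Metric.mem_ball] at *
    rw [Metric.mem_closedBall] at hx
    linarith
  have h1 : ‖deriv E c‖ ≤ B / (δ / 4) :=
    Complex.norm_deriv_le_of_forall_mem_sphere_norm_le (by positivity)
      ((hE.mono hsub).diffContOnCl_ball subset_rfl)
      fun x hx => hu x (hsub (Metric.sphere_subset_closedBall hx))
  have h2 := hl c (Metric.ball_subset_ball (by linarith) hc)
  have h3 : 0 < ‖E c‖ := by
    by_contra h
    have : ‖E c‖ = 0 := le_antisymm (not_lt.1 h) (norm_nonneg _)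
    rw [this] at h2
    linarith
  rw [logDeriv_apply, norm_div, div_le_iff₀ h3]
  calc ‖deriv E c‖ ≤ B / (δ / 4) := h1
    _ = 4 * B / δ * 1 := by field_simp
    _ ≤ 4 * B / δ * (B * ‖E c‖) := by gcongr
    _ = _ := by ring

/-! ### Horseshoes -/

lemma IsInverseBranch.iterate_orbit_mem {c₀ : ℂ} {δ κ : ℝ} {D V : Set ℂ} {n : ℕ} {G : ℂ × ℂ → ℂ}
    (hG : IsInverseBranch c₀ δ κ D D n G) (hκ : 0 ≤ κ) {c : ℂ} (hc : c ∈ Metric.ball c₀ δ)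
    (hn : 0 < n) (hV : ∀ x ∈ D, ∀ k < n, (quadMap c)^[k] x ∈ V) {x : ℂ} (hx : x ∈ D) (a : ℕ) :
    ∀ k ≤ a * n, (quadMap c)^[k] ((fun y => G (c, y))^[a] x) ∈ V := by
  induction a with
  | zero =>
    intro k hk
    obtain rfl : k = 0 := by simpa using hk
    exact hV x hx 0 hn
  | succ a ih =>
    intro k hk
    have hm : (fun y => G (c, y))^[a] x ∈ D := (hG.iterate hκ a).mem c hc x hx
    rw [Function.iterate_succ_apply']
    rcases lt_or_ge k n with h | h
    · exact hV _ (hG.mem c hc _ hm) k h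
    · obtain ⟨j, rfl⟩ := Nat.exists_eq_add_of_le' h
      rw [Function.iterate_add_apply, hG.inv c hc _ hm]
      exact ih j (by rw [Nat.succ_mul] at hk; omega)

/-- A disc about a point of a repelling orbit, whose first return stays near the orbit. -/
lemma IsRepellingOrbit.exists_isInverseBranch {c₀ z : ℂ} {O V : Set ℂ}
    (hO : IsRepellingOrbit c₀ O) (hz : z ∈ O) (hV : IsOpen V) (hOV : O ⊆ V) :
    ∃ (δ r κ : ℝ) (G : ℂ × ℂ → ℂ), 0 < δ ∧ 0 < r ∧ 0 < κ ∧ κ < 1 ∧ G (c₀, z) = z ∧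
      IsInverseBranch c₀ δ κ (Metric.closedBall z r) (Metric.closedBall z r) O.ncard G ∧
      ∀ x ∈ Metric.closedBall z r, ∀ k < O.ncard, (quadMap c₀)^[k] x ∈ V := by
  have h1 : ∀ᶠ x in 𝓝 z, ∀ k < O.ncard, (quadMap c₀)^[k] x ∈ V := by
    refine (eventually_all_finite (Set.finite_Iio O.ncard)).2 fun k _ => ?_
    exact (differentiable_iterate_quadMap c₀ k).continuous.continuousAt.eventually
      (hV.mem_nhds (hOV (hO.1.iterate_mem hz k)))
  obtain ⟨ε, hε, hεV⟩ := Metric.nhds_basis_closedBall.eventually_iff.1 h1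
  obtain ⟨δ, r, κ, G, hδ, hr, hrε, hκ0, hκ1, hG0, hG⟩ :=
    exists_isInverseBranch_self (hO.1.iterate_ncard hz) (hO.2 z hz) hε
  exact ⟨δ, r, κ, G, hδ, hr, hκ0, hκ1, hG0, hG, fun x hx =>
    hεV (Metric.closedBall_subset_closedBall hrε hx)⟩

lemma differentiableOn_multiplier {U : Set ℂ} (n : ℕ) {z : ℂ → ℂ} (hz : DifferentiableOn ℂ z U) :
    DifferentiableOn ℂ (fun c => deriv ((quadMap c)^[n]) (z c)) U :=
  ((contDiff_deriv_iterate_quadMap n).differentiable (by simp)).comp_differentiableOn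
    (differentiableOn_id.prodMk hz)

lemma isNuMap_of_differentiableOn {c₀ : ℂ} {O U : Set ℂ} (hU : IsOpen U) {z : ℂ → ℂ}
    (hz : DifferentiableOn ℂ z U) (h0 : z c₀ ∈ O)
    (hfix : ∀ c ∈ U, (quadMap c)^[O.ncard] (z c) = z c)
    (hρ : ∀ c ∈ U, deriv ((quadMap c)^[O.ncard]) (z c) ≠ 0) :
    IsNuMap c₀ O U
      (fun c => logDeriv (fun c => deriv ((quadMap c)^[O.ncard]) (z c)) c / O.ncard) := by
  have hd := differentiableOn_multiplier O.ncard hz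
  refine ⟨?_, _, ⟨z, hz.analyticOnNhd hU, h0, fun c hc => ⟨hfix c hc, rfl⟩⟩, fun c hc =>
    ⟨hρ c hc, ?_⟩⟩
  · refine DifferentiableOn.analyticOnNhd (DifferentiableOn.div_const ?_ _) hU
    exact (hd.deriv hU).div hd hρ
  · simp only [logDeriv_apply, div_div, mul_comm]

section Horseshoe

variable {c₀ z₁ z₂ : ℂ} {δ κ₁ κ₂ r₁ r₂ : ℝ} {n₁ n₂ l l' : ℕ} {G₁ G₂ A A' : ℂ × ℂ → ℂ}

/-- The periodic points of a horseshoe made of two discs with their return branches and two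
connecting branches. -/
lemma exists_horseshoe_point
    (hG₁ : IsInverseBranch c₀ δ κ₁ (Metric.closedBall z₁ r₁) (Metric.closedBall z₁ r₁) n₁ G₁)
    (hG₂ : IsInverseBranch c₀ δ κ₂ (Metric.closedBall z₂ r₂) (Metric.closedBall z₂ r₂) n₂ G₂)
    (hA : IsInverseBranch c₀ δ (1 / 2) (Metric.closedBall z₂ r₂) (Metric.closedBall z₁ r₁) l A)
    (hA' : IsInverseBranch c₀ δ (1 / 2) (Metric.closedBall z₁ r₁) (Metric.closedBall z₂ r₂) l' A')
    (hκ₁ : 0 ≤ κ₁) (hκ₁' : κ₁ < 1) (hκ₂ : 0 ≤ κ₂) (hκ₂' : κ₂ < 1) (hr₁ : 0 < r₁) (a b : ℕ) :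
    ∃ x : ℂ → ℂ, DifferentiableOn ℂ x (Metric.ball c₀ δ) ∧ ∀ c ∈ Metric.ball c₀ δ,
      x c ∈ Metric.closedBall z₁ r₁ ∧ (fun y => G₁ (c, y))^[a]
        (A (c, (fun y => G₂ (c, y))^[b] (A' (c, x c)))) = x c := by
  have h := (hG₁.iterate hκ₁ a).comp (hA.comp ((hG₂.iterate hκ₂ b).comp hA' (pow_nonneg hκ₂ b))
    (by norm_num)) (pow_nonneg hκ₁ a)
  have ha := pow_le_one₀ hκ₁ hκ₁'.le (n := a)
  have ha' := pow_nonneg hκ₁ a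
  have hb := pow_le_one₀ hκ₂ hκ₂'.le (n := b)
  have hb' := pow_nonneg hκ₂ b
  exact h.exists_fixedPoint hr₁.le (by positivity) (by nlinarith)

/-- The orbit of a periodic point of a horseshoe. -/
lemma horseshoe_orbit
    (hG₁ : IsInverseBranch c₀ δ κ₁ (Metric.closedBall z₁ r₁) (Metric.closedBall z₁ r₁) n₁ G₁)
    (hG₂ : IsInverseBranch c₀ δ κ₂ (Metric.closedBall z₂ r₂) (Metric.closedBall z₂ r₂) n₂ G₂)
    (hA : IsInverseBranch c₀ δ (1 / 2) (Metric.closedBall z₂ r₂) (Metric.closedBall z₁ r₁) l A)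
    (hA' : IsInverseBranch c₀ δ (1 / 2) (Metric.closedBall z₁ r₁) (Metric.closedBall z₂ r₂) l' A')
    (hκ₁ : 0 ≤ κ₁) (hκ₂ : 0 ≤ κ₂) {a b : ℕ} {c x : ℂ} (hc : c ∈ Metric.ball c₀ δ)
    (hx : x ∈ Metric.closedBall z₁ r₁)
    (hfix : (fun y => G₁ (c, y))^[a] (A (c, (fun y => G₂ (c, y))^[b] (A' (c, x)))) = x) :
    (quadMap c)^[l + a * n₁] x = (fun y => G₂ (c, y))^[b] (A' (c, x)) ∧
    (quadMap c)^[l' + (b * n₂ + (l + a * n₁))] x = x ∧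
    deriv ((quadMap c)^[l' + (b * n₂ + (l + a * n₁))]) x =
      deriv ((quadMap c)^[l']) (A' (c, x)) *
      (deriv ((quadMap c)^[b * n₂]) ((fun y => G₂ (c, y))^[b] (A' (c, x))) *
      (deriv ((quadMap c)^[l]) (A (c, (fun y => G₂ (c, y))^[b] (A' (c, x)))) *
      deriv ((quadMap c)^[a * n₁]) ((fun y => G₁ (c, y))^[a]
        (A (c, (fun y => G₂ (c, y))^[b] (A' (c, x))))))) := by
  have hv : A' (c, x) ∈ Metric.closedBall z₂ r₂ := hA'.mem c hc x hx
  have hu : (fun y => G₂ (c, y))^[b] (A' (c, x)) ∈ Metric.closedBall z₂ r₂ :=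
    (hG₂.iterate hκ₂ b).mem c hc _ hv
  have hy := hA.mem c hc _ hu
  -- Read forward, the orbit makes `a` turns at `z₁`, goes over in `l` steps, makes `b` turns at
  -- `z₂` and returns in `l'` steps.
  have e1 : (quadMap c)^[a * n₁] x = A (c, (fun y => G₂ (c, y))^[b] (A' (c, x))) := by
    conv_lhs => rw [← hfix]
    exact (hG₁.iterate hκ₁ a).inv c hc _ hy
  have e2 : (quadMap c)^[l + a * n₁] x = (fun y => G₂ (c, y))^[b] (A' (c, x)) := by
    rw [Function.iterate_add_apply, e1, hA.inv c hc _ hu]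
  have e3 : (quadMap c)^[b * n₂ + (l + a * n₁)] x = A' (c, x) := by
    rw [Function.iterate_add_apply, e2]
    exact (hG₂.iterate hκ₂ b).inv c hc _ hv
  refine ⟨e2, ?_, ?_⟩
  · rw [Function.iterate_add_apply, e3, hA'.inv c hc _ hx]
  · rw [deriv_iterate_add_quadMap, e3, deriv_iterate_add_quadMap, e2, deriv_iterate_add_quadMap,
      e1, hfix]

/-- Multipliers in a horseshoe are comparable with products of powers of the multipliers of the two
fixed points of the return branches. -/
lemma exists_horseshoe_bound
    (hG₁ : IsInverseBranch c₀ δ κ₁ (Metric.closedBall z₁ r₁) (Metric.closedBall z₁ r₁) n₁ G₁)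
    (hG₂ : IsInverseBranch c₀ δ κ₂ (Metric.closedBall z₂ r₂) (Metric.closedBall z₂ r₂) n₂ G₂)
    (hA : IsInverseBranch c₀ δ (1 / 2) (Metric.closedBall z₂ r₂) (Metric.closedBall z₁ r₁) l A)
    (hA' : IsInverseBranch c₀ δ (1 / 2) (Metric.closedBall z₁ r₁) (Metric.closedBall z₂ r₂) l' A')
    (hκ₁ : 0 < κ₁) (hκ₁' : κ₁ < 1) (hκ₂ : 0 < κ₂) (hκ₂' : κ₂ < 1) (hr₁ : 0 < r₁) (hr₂ : 0 < r₂) :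
    ∃ B : ℝ, 1 ≤ B ∧ ∀ c ∈ Metric.ball c₀ δ, ∀ p₁ ∈ Metric.closedBall z₁ r₁, G₁ (c, p₁) = p₁ →
      ∀ p₂ ∈ Metric.closedBall z₂ r₂, G₂ (c, p₂) = p₂ → ∀ a b : ℕ,
      ∀ x ∈ Metric.closedBall z₁ r₁,
      (fun y => G₁ (c, y))^[a] (A (c, (fun y => G₂ (c, y))^[b] (A' (c, x)))) = x →
      1 < ‖deriv ((quadMap c)^[l' + (b * n₂ + (l + a * n₁))]) x‖ ∧
      ‖deriv ((quadMap c)^[l' + (b * n₂ + (l + a * n₁))]) x‖ ≤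
        B * (‖deriv ((quadMap c)^[n₁]) p₁‖ ^ a * ‖deriv ((quadMap c)^[n₂]) p₂‖ ^ b) ∧
      ‖deriv ((quadMap c)^[n₁]) p₁‖ ^ a * ‖deriv ((quadMap c)^[n₂]) p₂‖ ^ b ≤
        B * ‖deriv ((quadMap c)^[l' + (b * n₂ + (l + a * n₁))]) x‖ := by
  obtain ⟨B₁, hB₁, hd₁⟩ := hG₁.exists_distortion hr₁ hκ₁ hκ₁'
  obtain ⟨B₂, hB₂, hd₂⟩ := hG₂.exists_distortion hr₂ hκ₂ hκ₂'
  obtain ⟨K, hK1, hK⟩ := exists_bound_deriv_iterate c₀ z₁ δ r₁ l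
  obtain ⟨K', hK1', hK'⟩ := exists_bound_deriv_iterate c₀ z₂ δ r₂ l'
  have hone : 1 ≤ B₁ * B₂ := one_le_mul_of_one_le_of_one_le hB₁ hB₂
  have honeK : 1 ≤ K * K' := one_le_mul_of_one_le_of_one_le hK1 hK1'
  refine ⟨B₁ * B₂ * (K * K'), one_le_mul_of_one_le_of_one_le hone honeK,
    fun c hc p₁ hp₁ hf₁ p₂ hp₂ hf₂ a b x hx hfix => ?_⟩
  obtain ⟨-, -, hder⟩ := horseshoe_orbit hG₁ hG₂ hA hA' hκ₁.le hκ₂.le hc hx hfix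
  have hv : A' (c, x) ∈ Metric.closedBall z₂ r₂ := hA'.mem c hc x hx
  have hu : (fun y => G₂ (c, y))^[b] (A' (c, x)) ∈ Metric.closedBall z₂ r₂ :=
    (hG₂.iterate hκ₂.le b).mem c hc _ hv
  have hy := hA.mem c hc _ hu
  have s1 := hA'.one_le_mul_norm_deriv hc hr₁ hx
  have s2 := (hG₂.iterate hκ₂.le b).one_le_mul_norm_deriv hc hr₂ hv
  have s3 := hA.one_le_mul_norm_deriv hc hr₂ hu
  have s4 := (hG₁.iterate hκ₁.le a).one_le_mul_norm_deriv hc hr₁ hy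
  have t1 := hK' c (Metric.ball_subset_closedBall hc) _ hv
  have t3 := hK c (Metric.ball_subset_closedBall hc) _ hy
  obtain ⟨q2, q2'⟩ := hd₂ c hc p₂ hp₂ hf₂ _ hv b
  obtain ⟨q1, q1'⟩ := hd₁ c hc p₁ hp₁ hf₁ _ hy a
  rw [hder]
  simp only [norm_mul] at *
  set d1 := ‖deriv ((quadMap c)^[l']) (A' (c, x))‖
  set d2 := ‖deriv ((quadMap c)^[b * n₂]) ((fun y => G₂ (c, y))^[b] (A' (c, x)))‖
  set d3 := ‖deriv ((quadMap c)^[l]) (A (c, (fun y => G₂ (c, y))^[b] (A' (c, x))))‖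
  set d4 := ‖deriv ((quadMap c)^[a * n₁]) ((fun y => G₁ (c, y))^[a]
        (A (c, (fun y => G₂ (c, y))^[b] (A' (c, x)))))‖
  set R1 := ‖deriv ((quadMap c)^[n₁]) p₁‖ ^ a
  set R2 := ‖deriv ((quadMap c)^[n₂]) p₂‖ ^ b
  have hR1 : 0 ≤ R1 := by positivity
  have hR2 : 0 ≤ R2 := by positivity
  -- The connecting branches have Lipschitz constant `1 / 2`, so the multiplier has modulus at least
  -- `4`, even for `a = b = 0`.
  have u1 : 2 ≤ d1 := by linarith
  have u3 : 2 ≤ d3 := by linarith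
  have u2 : 1 ≤ d2 := s2.trans (mul_le_of_le_one_left (norm_nonneg _)
    (pow_le_one₀ hκ₂.le hκ₂'.le))
  have u4 : 1 ≤ d4 := s4.trans (mul_le_of_le_one_left (norm_nonneg _)
    (pow_le_one₀ hκ₁.le hκ₁'.le))
  have u24 : 1 ≤ d2 * d4 := one_le_mul_of_one_le_of_one_le u2 u4
  have u13 : 4 ≤ d1 * d3 := by nlinarith
  have hprod : d1 * (d2 * (d3 * d4)) = (d1 * d3) * (d2 * d4) := by ring
  have hd24 : 0 ≤ d2 * d4 := by linarith
  rw [hprod]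
  refine ⟨by nlinarith, ?_, ?_⟩
  · calc d1 * d3 * (d2 * d4) ≤ (K' * K) * ((B₂ * R2) * (B₁ * R1)) := by gcongr
      _ = _ := by ring
  · calc R1 * R2 ≤ (B₁ * d4) * (B₂ * d2) := by gcongr
      _ = (B₁ * B₂ * (1 * (d2 * d4))) := by ring
      _ ≤ B₁ * B₂ * (((K * K') * (d1 * d3)) * (d2 * d4)) := by
        gcongr
        nlinarith
      _ = _ := by ring

end Horseshoe

/-- A proper divisor of `N` is at most `N / 2`, so the longer of the two stretches would cover a
whole period and keep the entire orbit in one of the disjoint sets, while the orbit visits both. -/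
lemma minimalPeriod_eq_of_itinerary {X : Type*} {f : X → X} {x : X} {V₁ V₂ : Set X}
    (hV : Disjoint V₁ V₂) {N s t q : ℕ} (hN : 0 < N) (hx : f^[N] x = x)
    (h1 : ∀ k ≤ s, f^[k] x ∈ V₁) (h2 : ∀ k ≤ t, f^[k] (f^[q] x) ∈ V₂)
    (hst : N ≤ 2 * s ∨ N ≤ 2 * t) : Function.minimalPeriod f x = N := by
  have hper : Function.IsPeriodicPt f N x := hx
  set d := Function.minimalPeriod f x with hd
  have hdp : 0 < d := hper.minimalPeriod_pos hN
  have hxd : Function.IsPeriodicPt f d x := Function.isPeriodicPt_minimalPeriod f x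
  obtain ⟨e, he⟩ := hper.minimalPeriod_dvd
  rw [← hd] at he
  by_contra hne
  have he2 : 2 ≤ e := by
    rcases e with - | - | e
    · omega
    · simp at he; omega
    · omega
  have hdN : 2 * d ≤ N := by nlinarith
  have hcontra : ∀ {y}, y ∈ V₁ → y ∈ V₂ → False := fun ha hb => Set.disjoint_left.1 hV ha hb
  rcases hst with h | h
  · refine hcontra (h1 (q % d) ?_) ?_
    · have := Nat.mod_lt q hdp
      omega
    · rw [hxd.iterate_mod_apply q]
      exact h2 0 (Nat.zero_le _)
  · have hyd : Function.IsPeriodicPt f d (f^[q] x) := hxd.apply_iterate q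
    have h3 : f^[q * (d - 1)] (f^[q] x) = x := by
      rw [← Function.iterate_add_apply, ← Nat.mul_succ, Nat.succ_eq_add_one, Nat.sub_add_cancel hdp]
      exact hxd.const_mul q
    refine hcontra (h1 0 (Nat.zero_le _)) ?_
    rw [Function.iterate_zero_apply, ← h3, ← hyd.iterate_mod_apply]
    refine h2 _ ?_
    have := Nat.mod_lt (q * (d - 1)) hdp
    omega

/-! ### Continuation of repelling orbits and shadowing. -/

lemma IsNuMap.mono {c₀ : ℂ} {O U V : Set ℂ} {ν : ℂ → ℂ} (h : IsNuMap c₀ O U ν) (hVU : V ⊆ U) :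
    IsNuMap c₀ O V ν := by
  obtain ⟨h1, ρ, ⟨z, hz, hz0, h2⟩, h3⟩ := h
  exact ⟨h1.mono hVU, ρ, ⟨z, hz.mono hVU, hz0, fun c hc => h2 c (hVU hc)⟩,
    fun c hc => h3 c (hVU hc)⟩

lemma IsInverseBranch.eq_of_fixed {c₀ c x y : ℂ} {δ κ : ℝ} {D D' : Set ℂ} {n : ℕ} {G : ℂ × ℂ → ℂ}
    (hG : IsInverseBranch c₀ δ κ D D' n G) (hκ : κ < 1) (hc : c ∈ Metric.ball c₀ δ) (hx : x ∈ D)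
    (hy : y ∈ D) (hGx : G (c, x) = x) (hGy : G (c, y) = y) : x = y := by
  have h := hG.lip c hc x hx y hy
  rw [hGx, hGy] at h
  have h1 := norm_nonneg (x - y)
  have h2 : ‖x - y‖ = 0 := by nlinarith
  exact sub_eq_zero.1 (norm_eq_zero.1 h2)

/-- Continuation of a repelling orbit by the fixed points of a contracting inverse branch. -/
lemma IsInverseBranch.exists_isNuMap {c₀ z : ℂ} {δ κ r : ℝ} {O : Set ℂ} {G : ℂ × ℂ → ℂ}
    (hG : IsInverseBranch c₀ δ κ (Metric.closedBall z r) (Metric.closedBall z r) O.ncard G)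
    (hδ : 0 < δ) (hr : 0 < r) (hκ0 : 0 < κ) (hκ1 : κ < 1) (hG0 : G (c₀, z) = z) (hz : z ∈ O) :
    ∃ p : ℂ → ℂ, DifferentiableOn ℂ p (Metric.ball c₀ δ) ∧
      (∀ c ∈ Metric.ball c₀ δ, p c ∈ Metric.closedBall z r ∧ G (c, p c) = p c ∧
        1 ≤ ‖deriv ((quadMap c)^[O.ncard]) (p c)‖) ∧
      IsNuMap c₀ O (Metric.ball c₀ δ)
        (fun c => logDeriv (fun c => deriv ((quadMap c)^[O.ncard]) (p c)) c / O.ncard) := by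
  obtain ⟨p, hp, hpf⟩ := hG.exists_fixedPoint hr.le hκ0.le hκ1
  have hc₀ := Metric.mem_ball_self (x := c₀) hδ
  have hp0 : p c₀ = z := hG.eq_of_fixed hκ1 hc₀ (hpf c₀ hc₀).1 (Metric.mem_closedBall_self hr.le)
    (hpf c₀ hc₀).2 hG0
  have hone : ∀ c ∈ Metric.ball c₀ δ, 1 ≤ ‖deriv ((quadMap c)^[O.ncard]) (p c)‖ := fun c hc => by
    have h1 := (hG.one_le_mul_norm_deriv hc hr (hpf c hc).1).trans
      (mul_le_of_le_one_left (norm_nonneg _) hκ1.le)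
    rwa [(hpf c hc).2] at h1
  refine ⟨p, hp, fun c hc => ⟨(hpf c hc).1, (hpf c hc).2, hone c hc⟩,
    isNuMap_of_differentiableOn Metric.isOpen_ball hp (hp0 ▸ hz) (fun c hc => ?_)
    fun c hc => norm_pos_iff.1 (one_pos.trans_le (hone c hc))⟩
  have h1 := hG.inv c hc _ (hpf c hc).1
  rwa [(hpf c hc).2] at h1

lemma IsRepellingOrbit.exists_isNuMap {c₀ : ℂ} {O : Set ℂ} (hO : IsRepellingOrbit c₀ O) :
    ∃ δ > 0, ∃ ν, IsNuMap c₀ O (Metric.ball c₀ δ) ν := by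
  obtain ⟨z, hz⟩ : O.Nonempty := nonempty_of_ncard_ne_zero hO.1.ncard_pos.ne'
  obtain ⟨δ, r, κ, G, hδ, hr, hκ0, hκ1, hG0, hG, -⟩ :=
    hO.exists_isInverseBranch hz isOpen_univ (subset_univ O)
  obtain ⟨p, -, -, h⟩ := hG.exists_isNuMap hδ hr hκ0 hκ1 hG0 hz
  exact ⟨δ, hδ, _, h⟩

lemma logDeriv_div_mul_pow {f g h : ℂ → ℂ} {c : ℂ} (hf : DifferentiableAt ℂ f c)
    (hg : DifferentiableAt ℂ g c) (hh : DifferentiableAt ℂ h c) (hf0 : f c ≠ 0) (hg0 : g c ≠ 0)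
    (hh0 : h c ≠ 0) (a b : ℕ) :
    logDeriv (fun c => f c / (g c ^ a * h c ^ b)) c
      = logDeriv f c - a * logDeriv g c - b * logDeriv h c := by
  rw [logDeriv_div (f := f) (g := fun c => g c ^ a * h c ^ b) c hf0
    (mul_ne_zero (pow_ne_zero _ hg0) (pow_ne_zero _ hh0)) hf ((hg.pow a).mul (hh.pow b)),
    logDeriv_mul (f := fun c => g c ^ a) (g := fun c => h c ^ b) c (pow_ne_zero _ hg0)
    (pow_ne_zero _ hh0) (hg.pow a) (hh.pow b), logDeriv_fun_pow hg, logDeriv_fun_pow hh]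
  ring

/-- Repelling orbits which follow one repelling orbit `a` times and then another one `b` times. -/
theorem exists_shadowing_orbits {c₀ : ℂ} {O₁ O₂ : Set ℂ} (hO₁ : IsRepellingOrbit c₀ O₁)
    (hO₂ : IsRepellingOrbit c₀ O₂) (hne : O₁ ≠ O₂) (hexc : c₀ = -2 → O₁ ≠ {2} ∧ O₂ ≠ {2}) :
    ∃ (δ C : ℝ) (ℓ : ℕ) (ν₁ ν₂ : ℂ → ℂ), 0 < δ ∧ IsNuMap c₀ O₁ (Metric.ball c₀ δ) ν₁ ∧
      IsNuMap c₀ O₂ (Metric.ball c₀ δ) ν₂ ∧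
      (∀ c ∈ Metric.ball c₀ δ, ‖ν₁ c‖ ≤ C ∧ ‖ν₂ c‖ ≤ C) ∧
      ∀ a b N : ℕ, N = a * O₁.ncard + b * O₂.ncard + ℓ → 0 < N →
        (N ≤ 2 * (a * O₁.ncard) ∨ N ≤ 2 * (b * O₂.ncard)) →
        ∃ (O : Set ℂ) (ν : ℂ → ℂ), IsRepellingOrbit c₀ O ∧ O.ncard = N ∧
          IsNuMap c₀ O (Metric.ball c₀ δ) ν ∧ ∀ c ∈ Metric.ball c₀ δ,
            ‖N * ν c - a * O₁.ncard * ν₁ c - b * O₂.ncard * ν₂ c‖ ≤ C := by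
  have hpos₁ := hO₁.1.ncard_pos
  have hpos₂ := hO₂.1.ncard_pos
  obtain ⟨z₁, hz₁⟩ : O₁.Nonempty := nonempty_of_ncard_ne_zero hpos₁.ne'
  obtain ⟨z₂, hz₂⟩ : O₂.Nonempty := nonempty_of_ncard_ne_zero hpos₂.ne'
  have hdisj : Disjoint O₁ O₂ := Set.disjoint_left.2 fun z h h' => hne (hO₁.1.eq_of_mem hO₂.1 h h')
  obtain ⟨V₁, V₂, hV₁, hV₂, hOV₁, hOV₂, hV⟩ := SeparatedNhds.of_finite
    (finite_of_ncard_pos hpos₁) (finite_of_ncard_pos hpos₂) hdisj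
  obtain ⟨δ₁, r₁, κ₁, G₁, hδ₁, hr₁, hκ₁, hκ₁', hG₁0, hG₁, hGV₁⟩ :=
    hO₁.exists_isInverseBranch hz₁ hV₁ hOV₁
  obtain ⟨δ₂, r₂, κ₂, G₂, hδ₂, hr₂, hκ₂, hκ₂', hG₂0, hG₂, hGV₂⟩ :=
    hO₂.exists_isInverseBranch hz₂ hV₂ hOV₂
  obtain ⟨w, hw, m, hm, hmd⟩ := exists_connecting_point hpos₁ (hO₁.1.iterate_ncard hz₁)
    (hO₁.2 z₁ hz₁) hO₂ (fun h => (hexc h).2) hz₂ hr₁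
  obtain ⟨w', hw', m', hm', hmd'⟩ := exists_connecting_point hpos₂ (hO₂.1.iterate_ncard hz₂)
    (hO₂.2 z₂ hz₂) hO₁ (fun h => (hexc h).1) hz₁ hr₂
  obtain ⟨δ₃, l, A, hδ₃, hA⟩ := exists_isInverseBranch_connecting hG₂ hδ₂ hr₂ hκ₂.le hκ₂' hG₂0 hw hm
    hmd
  obtain ⟨δ₄, l', A', hδ₄, hA'⟩ := exists_isInverseBranch_connecting hG₁ hδ₁ hr₁ hκ₁.le hκ₁' hG₁0
    hw' hm' hmd'
  obtain ⟨δ, hδ, hle₁, hle₂, hle₃, hle₄⟩ : ∃ δ > 0, δ ≤ δ₁ ∧ δ ≤ δ₂ ∧ δ ≤ δ₃ ∧ δ ≤ δ₄ :=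
    ⟨min (min δ₁ δ₂) (min δ₃ δ₄), lt_min (lt_min hδ₁ hδ₂) (lt_min hδ₃ hδ₄),
      (min_le_left _ _).trans (min_le_left _ _), (min_le_left _ _).trans (min_le_right _ _),
      (min_le_right _ _).trans (min_le_left _ _), (min_le_right _ _).trans (min_le_right _ _)⟩
  replace hG₁ := hG₁.mono hle₁ le_rfl
  replace hG₂ := hG₂.mono hle₂ le_rfl
  replace hA := hA.mono hle₃ le_rfl
  replace hA' := hA'.mono hle₄ le_rfl
  obtain ⟨p₁, hp₁, hpf₁, hν₁⟩ := hG₁.exists_isNuMap hδ hr₁ hκ₁ hκ₁' hG₁0 hz₁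
  obtain ⟨p₂, hp₂, hpf₂, hν₂⟩ := hG₂.exists_isNuMap hδ hr₂ hκ₂ hκ₂' hG₂0 hz₂
  set n₁ := O₁.ncard
  set n₂ := O₂.ncard
  obtain ⟨B, hB, hbound⟩ := exists_horseshoe_bound hG₁ hG₂ hA hA' hκ₁ hκ₁' hκ₂ hκ₂' hr₁ hr₂
  obtain ⟨K₁, hK₁, hKb₁⟩ := exists_bound_deriv_iterate c₀ z₁ δ r₁ n₁
  obtain ⟨K₂, hK₂, hKb₂⟩ := exists_bound_deriv_iterate c₀ z₂ δ r₂ n₂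
  set ρ₁ : ℂ → ℂ := fun c => deriv ((quadMap c)^[n₁]) (p₁ c) with hρ₁
  set ρ₂ : ℂ → ℂ := fun c => deriv ((quadMap c)^[n₂]) (p₂ c) with hρ₂
  have hd₁ : DifferentiableOn ℂ ρ₁ (Metric.ball c₀ δ) := differentiableOn_multiplier n₁ hp₁
  have hd₂ : DifferentiableOn ℂ ρ₂ (Metric.ball c₀ δ) := differentiableOn_multiplier n₂ hp₂
  have hsub : Metric.ball c₀ (δ / 2) ⊆ Metric.ball c₀ δ := Metric.ball_subset_ball (by linarith)
  have hbν : ∀ {K : ℝ} {ρ : ℂ → ℂ} {n : ℕ}, 1 ≤ K → DifferentiableOn ℂ ρ (Metric.ball c₀ δ) →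
      (∀ c ∈ Metric.ball c₀ δ, ‖ρ c‖ ≤ K) → (∀ c ∈ Metric.ball c₀ δ, 1 ≤ ‖ρ c‖) → 0 < n →
      ∀ c ∈ Metric.ball c₀ (δ / 2), ‖logDeriv ρ c / n‖ ≤ 4 * K ^ 2 / δ := by
    intro K ρ n hK hd hu hl hn c hc
    have h1 := norm_logDeriv_le hδ hd hK hu (fun c hc => (hl c hc).trans
      (le_mul_of_one_le_left (norm_nonneg _) hK)) hc
    rw [norm_div, Complex.norm_natCast]
    exact (div_le_self (norm_nonneg _) (by exact_mod_cast hn)).trans h1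
  set M := max B (max K₁ K₂)
  have hM : ∀ {K : ℝ}, 1 ≤ K → K ≤ M → 4 * K ^ 2 / δ ≤ 4 * M ^ 2 / δ := fun h1 h2 => by gcongr
  -- The radius is halved for the Cauchy estimate; `l' + l` is the total transit time.
  refine ⟨δ / 2, 4 * M ^ 2 / δ, l' + l, _, _, half_pos hδ, hν₁.mono hsub, hν₂.mono hsub,
    fun c hc => ⟨?_, ?_⟩, ?_⟩
  · exact (hbν hK₁ hd₁ (fun c hc => hKb₁ c (Metric.ball_subset_closedBall hc) _ (hpf₁ c hc).1)
      (fun c hc => (hpf₁ c hc).2.2) hpos₁ c hc).trans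
      (hM hK₁ ((le_max_left _ _).trans (le_max_right _ _)))
  · exact (hbν hK₂ hd₂ (fun c hc => hKb₂ c (Metric.ball_subset_closedBall hc) _ (hpf₂ c hc).1)
      (fun c hc => (hpf₂ c hc).2.2) hpos₂ c hc).trans
      (hM hK₂ ((le_max_right _ _).trans (le_max_right _ _)))
  intro a b N hN hN0 hNab
  obtain ⟨x, hx, hxf⟩ := exists_horseshoe_point hG₁ hG₂ hA hA' hκ₁.le hκ₁' hκ₂.le hκ₂' hr₁ a b
  have hN' : l' + (b * n₂ + (l + a * n₁)) = N := by omega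
  have hb : ∀ c ∈ Metric.ball c₀ δ, 1 < ‖deriv ((quadMap c)^[N]) (x c)‖ ∧
      ‖deriv ((quadMap c)^[N]) (x c)‖ ≤ B * (‖ρ₁ c‖ ^ a * ‖ρ₂ c‖ ^ b) ∧
      ‖ρ₁ c‖ ^ a * ‖ρ₂ c‖ ^ b ≤ B * ‖deriv ((quadMap c)^[N]) (x c)‖ := fun c hc => by
    rw [← hN']
    exact hbound c hc (p₁ c) (hpf₁ c hc).1 (hpf₁ c hc).2.1 (p₂ c) (hpf₂ c hc).1 (hpf₂ c hc).2.1 a b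
      (x c) (hxf c hc).1 (hxf c hc).2
  have hfix : ∀ c ∈ Metric.ball c₀ δ, (quadMap c)^[N] (x c) = x c := fun c hc => by
    rw [← hN']
    exact (horseshoe_orbit hG₁ hG₂ hA hA' hκ₁.le hκ₂.le hc (hxf c hc).1 (hxf c hc).2).2.1
  have hc₀ := Metric.mem_ball_self (x := c₀) hδ
  have hmin : Function.minimalPeriod (quadMap c₀) (x c₀) = N := by
    have hv := hA'.mem c₀ hc₀ _ (hxf c₀ hc₀).1
    have hy := hA.mem c₀ hc₀ _ ((hG₂.iterate hκ₂.le b).mem c₀ hc₀ _ hv)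
    refine minimalPeriod_eq_of_itinerary hV (s := a * n₁) (t := b * n₂) (q := l + a * n₁) hN0
      (hfix c₀ hc₀) ?_ ?_ hNab
    · have h1 := hG₁.iterate_orbit_mem hκ₁.le hc₀ hpos₁ hGV₁ hy a
      have h2 := (hxf c₀ hc₀).2
      simp only at h1
      rwa [h2] at h1
    · rw [(horseshoe_orbit hG₁ hG₂ hA hA' hκ₁.le hκ₂.le hc₀ (hxf c₀ hc₀).1 (hxf c₀ hc₀).2).1]
      exact hG₂.iterate_orbit_mem hκ₂.le hc₀ hpos₂ hGV₂ hv b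
  obtain ⟨hO, hcard⟩ := isRepellingOrbit_orbitSet hN0 hmin (hb c₀ hc₀).1
  have hne0 : ∀ c ∈ Metric.ball c₀ δ, deriv ((quadMap c)^[N]) (x c) ≠ 0 := fun c hc =>
    norm_pos_iff.1 (one_pos.trans (hb c hc).1)
  have hν := isNuMap_of_differentiableOn (O := orbitSet c₀ (x c₀)) Metric.isOpen_ball hx
    (mem_orbitSet_self _ _) (by rwa [hcard]) (by rwa [hcard])
  rw [hcard] at hν
  refine ⟨_, _, hO, hcard, hν.mono hsub, fun c hc => ?_⟩
  set ρ : ℂ → ℂ := fun c => deriv ((quadMap c)^[N]) (x c) with hρ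
  have hd : DifferentiableOn ℂ ρ (Metric.ball c₀ δ) := differentiableOn_multiplier N hx
  have hne₁ : ∀ c ∈ Metric.ball c₀ δ, ρ₁ c ≠ 0 := fun c hc =>
    norm_pos_iff.1 (one_pos.trans_le (hpf₁ c hc).2.2)
  have hne₂ : ∀ c ∈ Metric.ball c₀ δ, ρ₂ c ≠ 0 := fun c hc =>
    norm_pos_iff.1 (one_pos.trans_le (hpf₂ c hc).2.2)
  have hnhds := Metric.isOpen_ball.mem_nhds (hsub hc)
  have hlog := logDeriv_div_mul_pow (hd.differentiableAt hnhds) (hd₁.differentiableAt hnhds)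
    (hd₂.differentiableAt hnhds) (hne0 c (hsub hc)) (hne₁ c (hsub hc)) (hne₂ c (hsub hc)) a b
  have hNc : (N : ℂ) ≠ 0 := by exact_mod_cast hN0.ne'
  have hn₁c : (n₁ : ℂ) ≠ 0 := by exact_mod_cast hpos₁.ne'
  have hn₂c : (n₂ : ℂ) ≠ 0 := by exact_mod_cast hpos₂.ne'
  -- The error is the logarithmic derivative of a function with modulus between `B⁻¹` and `B`,
  -- whatever `a` and `b` are.
  have heq : (N : ℂ) * (logDeriv ρ c / N) - a * n₁ * (logDeriv ρ₁ c / n₁)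
      - b * n₂ * (logDeriv ρ₂ c / n₂) = logDeriv (fun c => ρ c / (ρ₁ c ^ a * ρ₂ c ^ b)) c := by
    rw [hlog]
    field_simp
  rw [heq]
  refine (norm_logDeriv_le hδ (E := fun c => ρ c / (ρ₁ c ^ a * ρ₂ c ^ b))
    (hd.div ((hd₁.pow a).mul (hd₂.pow b)) fun c hc =>
      mul_ne_zero (pow_ne_zero _ (hne₁ c hc)) (pow_ne_zero _ (hne₂ c hc))) hB (fun c hc => ?_)
    (fun c hc => ?_) hc).trans (hM hB (le_max_left _ _))
  · have h3 : 0 < ‖ρ₁ c‖ ^ a * ‖ρ₂ c‖ ^ b := mul_pos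
      (pow_pos (norm_pos_iff.2 (hne₁ c hc)) _) (pow_pos (norm_pos_iff.2 (hne₂ c hc)) _)
    rw [norm_div, norm_mul, norm_pow, norm_pow, div_le_iff₀ h3]
    exact (hb c hc).2.1
  · have h3 : 0 < ‖ρ₁ c‖ ^ a * ‖ρ₂ c‖ ^ b := mul_pos
      (pow_pos (norm_pos_iff.2 (hne₁ c hc)) _) (pow_pos (norm_pos_iff.2 (hne₂ c hc)) _)
    rw [norm_div, norm_mul, norm_pow, norm_pow, mul_div_assoc', le_div_iff₀ h3, one_mul]
    exact (hb c hc).2.2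

/-! ### The averaging lemma -/

/-- Bézout, with the coefficient of `n` reduced modulo `m`. -/
lemma Nat.exists_lt_dvd_sub {m n M : ℕ} (hm : 0 < m) (h : m.gcd n ∣ M) :
    ∃ b < m, (m : ℤ) ∣ (M : ℤ) - b * n := by
  obtain ⟨u, v, huv⟩ := Int.gcd_dvd_iff.1
    (show Int.gcd (m : ℤ) (n : ℤ) ∣ M by simpa [Int.gcd_natCast_natCast] using h)
  have hm' : (0 : ℤ) < m := by exact_mod_cast hm
  refine ⟨(v % m).toNat, ?_, ?_⟩
  · zify
    rw [Int.toNat_of_nonneg (Int.emod_nonneg _ hm'.ne')]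
    exact Int.emod_lt_of_pos _ hm'
  · rw [Int.toNat_of_nonneg (Int.emod_nonneg _ hm'.ne')]
    refine ⟨u + n * (v / m), ?_⟩
    have := Int.emod_add_mul_ediv v m
    rw [huv]
    linear_combination (n : ℤ) * (-1) * this

/-- Representing a large integer as `a m + b n + ℓ` with prescribed proportions. -/
lemma exists_proportional_representation {α : ℝ} (hα : 1 / 2 ≤ α) (hα1 : α ≤ 1) {m n : ℕ}
    (hm : 0 < m) (hn : 0 < n) (ℓ : ℕ) :
    ∃ (C : ℝ) (N₀ : ℕ), 0 ≤ C ∧ ℓ ≤ N₀ ∧ ∀ N, N₀ ≤ N → m.gcd n ∣ N - ℓ → ∃ a b : ℕ,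
      N = a * m + b * n + ℓ ∧ N ≤ 2 * (a * m) ∧ |(a * m : ℝ) - α * N| ≤ C ∧
      |(b * n : ℝ) - (1 - α) * N| ≤ C := by
  set P := m * n with hP
  have hPp : 0 < P := Nat.mul_pos hm hn
  have hP0 : (0 : ℝ) < P := by exact_mod_cast hPp
  refine ⟨2 * ℓ + 2 * P, 2 * (P + ℓ), by positivity, by omega, fun N hN hdvd => ?_⟩
  obtain ⟨b₀, hb₀, k, hk⟩ := Nat.exists_lt_dvd_sub hm hdvd
  have hNℓ : ((N - ℓ : ℕ) : ℤ) = N - ℓ := by push_cast [show ℓ ≤ N by omega]; ring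
  rw [hNℓ] at hk
  have hNR : (2 * (P + ℓ) : ℝ) ≤ N := by exact_mod_cast hN
  -- The target for `b * n` is lowered by `ℓ + P`: the correction `b₀ * n ≤ P` then keeps `2 * (b *
  -- n) + 2 * ℓ ≤ N`, hence `N ≤ 2 * (a * m)`. Changing `b` in steps of `m` preserves the
  -- congruence.
  set x : ℝ := (1 - α) * N - ℓ - P with hx
  set q := ⌊x / P⌋₊ with hq
  have hq1 : x < (q + 1) * P := (div_lt_iff₀ hP0).1 (Nat.lt_floor_add_one _)
  have hq2 : (q : ℝ) * P ≤ max 0 x := by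
    rcases le_or_gt 0 x with h | h
    · exact ((le_div_iff₀ hP0).1 (Nat.floor_le (div_nonneg h hP0.le))).trans (le_max_right _ _)
    · have : q = 0 := Nat.floor_of_nonpos (div_nonpos_of_nonpos_of_nonneg h.le hP0.le)
      simp [this]
  set b := b₀ + q * m with hb
  have hbn : b * n = b₀ * n + q * P := by rw [hb, hP]; ring
  have hb₀n : b₀ * n ≤ P := Nat.mul_le_mul_right n hb₀.le
  have hbnR : (b * n : ℝ) = b₀ * n + q * P := by exact_mod_cast hbn
  have hb₀nR : (b₀ * n : ℝ) ≤ P := by exact_mod_cast hb₀n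
  have hb₀0 : (0 : ℝ) ≤ b₀ * n := by positivity
  have hαN : (1 - α) * N ≤ 1 / 2 * N := by gcongr; linarith
  have hαN0 : 0 ≤ (1 - α) * N := mul_nonneg (by linarith) (by positivity)
  have hup : 2 * (b * n : ℝ) ≤ N - 2 * ℓ := by
    rw [hbnR]
    rcases le_total x 0 with h | h
    · rw [max_eq_left h] at hq2
      linarith
    · rw [max_eq_right h] at hq2
      linarith
  have hupN : 2 * (b * n) + 2 * ℓ ≤ N := by
    have : (2 * (b * n) + 2 * ℓ : ℝ) ≤ N := by linarith
    exact_mod_cast this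
  have hk' : (m : ℤ) * (k - q * n) = N - ℓ - b * n := by
    have : (b * n : ℤ) = b₀ * n + q * (m * n) := by exact_mod_cast hbn
    rw [this]
    linear_combination -hk
  have hk0 : 0 ≤ k - q * n := by
    have h1 : (0 : ℤ) ≤ m * (k - q * n) := by rw [hk']; zify at hupN; linarith [show (0 : ℤ) ≤ b * n by positivity]
    exact nonneg_of_mul_nonneg_right h1 (by exact_mod_cast hm)
  obtain ⟨a, ha⟩ := Int.eq_ofNat_of_zero_le hk0
  have hN' : N = a * m + b * n + ℓ := by
    zify
    rw [ha] at hk'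
    linear_combination -hk'
  have hNR' : (N : ℝ) = a * m + b * n + ℓ := by exact_mod_cast hN'
  have hmax : max 0 x ≤ (1 - α) * N := max_le hαN0 (by rw [hx]; linarith [show (0 : ℝ) ≤ ℓ by positivity])
  have hℓ0 : (0 : ℝ) ≤ ℓ := by positivity
  refine ⟨a, b, hN', by omega, ?_, ?_⟩
  · rw [abs_le]; constructor <;> linarith
  · rw [abs_le]; constructor <;> linarith

/-- For `α ≥ 1/2` the stretch near `O₁` can be made to fill at least half of the period, as
exactness of the period requires. The bounded rounding and distortion errors become `O(1/N)` after
division. -/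
lemma exists_approximating_orbits_of_half_le {α : ℝ} (hα : 1 / 2 ≤ α) (hα1 : α ≤ 1) {c₀ : ℂ}
    {O₁ O₂ : Set ℂ} (hO₁ : IsRepellingOrbit c₀ O₁) (hO₂ : IsRepellingOrbit c₀ O₂) (hne : O₁ ≠ O₂)
    (hexc : c₀ = -2 → O₁ ≠ {2} ∧ O₂ ≠ {2}) :
    ∃ (δ C : ℝ) (ℓ N₀ : ℕ) (ν₁ ν₂ : ℂ → ℂ), 0 < δ ∧ IsNuMap c₀ O₁ (Metric.ball c₀ δ) ν₁ ∧
      IsNuMap c₀ O₂ (Metric.ball c₀ δ) ν₂ ∧ ℓ ≤ N₀ ∧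
      ∀ N, N₀ ≤ N → O₁.ncard.gcd O₂.ncard ∣ N - ℓ →
        ∃ (O : Set ℂ) (ν : ℂ → ℂ), IsRepellingOrbit c₀ O ∧ O.ncard = N ∧
          IsNuMap c₀ O (Metric.ball c₀ δ) ν ∧ ∀ c ∈ Metric.ball c₀ δ,
            ‖ν c - (α * ν₁ c + (1 - α) * ν₂ c)‖ ≤ C / N := by
  obtain ⟨δ, C, ℓ, ν₁, ν₂, hδ, hν₁, hν₂, hC, hmain⟩ := exists_shadowing_orbits hO₁ hO₂ hne hexc
  obtain ⟨K, N₀, hK, hℓ, hrep⟩ := exists_proportional_representation hα hα1 hO₁.1.ncard_pos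
    hO₂.1.ncard_pos ℓ
  refine ⟨δ, C + K * C + K * C, ℓ, N₀ + 1, ν₁, ν₂, hδ, hν₁, hν₂, hℓ.trans (Nat.le_succ _),
    fun N hN hdvd => ?_⟩
  obtain ⟨a, b, hNab, hle, ha, hb⟩ := hrep N (by omega) hdvd
  have hN0 : 0 < N := by omega
  obtain ⟨O, ν, hO, hcard, hν, hest⟩ := hmain a b N hNab hN0 (Or.inl hle)
  refine ⟨O, ν, hO, hcard, hν, fun c hc => ?_⟩
  have hNR : (0 : ℝ) < N := by exact_mod_cast hN0
  rw [le_div_iff₀ hNR, mul_comm, ← Complex.norm_natCast, ← norm_mul]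
  set n₁ := O₁.ncard
  set n₂ := O₂.ncard
  have heq : (N : ℂ) * (ν c - (α * ν₁ c + (1 - α) * ν₂ c))
      = (N * ν c - a * n₁ * ν₁ c - b * n₂ * ν₂ c) + ((a * n₁ - α * N : ℝ) : ℂ) * ν₁ c
        + ((b * n₂ - (1 - α) * N : ℝ) : ℂ) * ν₂ c := by
    push_cast
    ring
  rw [heq]
  refine (norm_add₃_le).trans (add_le_add_three (hest c hc) ?_ ?_)
  · rw [norm_mul, Complex.norm_real]
    exact mul_le_mul ha (hC c hc).1 (norm_nonneg _) hK
  · rw [norm_mul, Complex.norm_real]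
    exact mul_le_mul hb (hC c hc).2 (norm_nonneg _) hK

lemma exists_approximating_orbits {α : ℝ} (hα : α ∈ Icc (0 : ℝ) 1) {c₀ : ℂ}
    {O₁ O₂ : Set ℂ} (hO₁ : IsRepellingOrbit c₀ O₁) (hO₂ : IsRepellingOrbit c₀ O₂) (hne : O₁ ≠ O₂)
    (hexc : c₀ = -2 → O₁ ≠ {2} ∧ O₂ ≠ {2}) :
    ∃ (δ C : ℝ) (ℓ N₀ : ℕ) (ν₁ ν₂ : ℂ → ℂ), 0 < δ ∧ IsNuMap c₀ O₁ (Metric.ball c₀ δ) ν₁ ∧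
      IsNuMap c₀ O₂ (Metric.ball c₀ δ) ν₂ ∧ ℓ ≤ N₀ ∧
      ∀ N, N₀ ≤ N → O₁.ncard.gcd O₂.ncard ∣ N - ℓ →
        ∃ (O : Set ℂ) (ν : ℂ → ℂ), IsRepellingOrbit c₀ O ∧ O.ncard = N ∧
          IsNuMap c₀ O (Metric.ball c₀ δ) ν ∧ ∀ c ∈ Metric.ball c₀ δ,
            ‖ν c - (α * ν₁ c + (1 - α) * ν₂ c)‖ ≤ C / N := by
  rcases le_total (1 / 2) α with h | h
  · exact exists_approximating_orbits_of_half_le h hα.2 hO₁ hO₂ hne hexc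
  · obtain ⟨δ, C, ℓ, N₀, ν₂, ν₁, hδ, hν₂, hν₁, hℓ, hmain⟩ :=
      exists_approximating_orbits_of_half_le (α := 1 - α) (by linarith) (by linarith [hα.1]) hO₂ hO₁
        hne.symm fun hc => (hexc hc).symm
    refine ⟨δ, C, ℓ, N₀, ν₁, ν₂, hδ, hν₁, hν₂, hℓ, fun N hN hdvd => ?_⟩
    obtain ⟨O, ν, hO, hcard, hν, hest⟩ := hmain N hN (by rwa [Nat.gcd_comm])
    refine ⟨O, ν, hO, hcard, hν, fun c hc => ?_⟩
    have h1 := hest c hc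
    push_cast at h1
    rwa [sub_sub_cancel, add_comm] at h1

lemma tendstoUniformlyOn_of_le_div {ν : ℕ → ℂ → ℂ} {g : ℂ → ℂ} {U : Set ℂ} {C : ℝ} {N : ℕ → ℕ}
    (hN : Tendsto N atTop atTop) (h : ∀ᶠ j in atTop, ∀ c ∈ U, ‖ν j c - g c‖ ≤ C / N j) :
    TendstoUniformlyOn ν g atTop U := by
  rw [Metric.tendstoUniformlyOn_iff]
  intro ε hε
  have h1 : Tendsto (fun j => C / (N j : ℝ)) atTop (𝓝 0) :=
    (tendsto_const_div_atTop_nhds_zero_nat C).comp hN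
  filter_upwards [h, h1.eventually (gt_mem_nhds hε)] with j hj hj' c hc
  rw [dist_comm, dist_eq_norm]
  exact (hj c hc).trans_lt hj'

/-- A substitute for the missing orbit of period three. Its period `1` keeps it distinct from the
orbits of period at least four. -/
lemma exists_isRepellingOrbit_fixed :
    ∃ O, IsRepellingOrbit (-7 / 4) O ∧ O.ncard = 1 := by
  set β : ℂ := ((1 / 2 + √2 : ℝ) : ℂ) with hβ
  have h2 : (√2 : ℝ) ^ 2 = 2 := Real.sq_sqrt (by norm_num)
  have hfix : quadMap (-7 / 4) β = β := by
    have : ((√2 : ℝ) : ℂ) ^ 2 = 2 := by exact_mod_cast h2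
    rw [quadMap, hβ]
    push_cast
    linear_combination this
  refine ⟨_, isRepellingOrbit_orbitSet (c := -7 / 4) (z := β) one_pos
    (Function.minimalPeriod_eq_one_iff_isFixedPt.2 hfix) ?_⟩
  rw [Function.iterate_one, (hasDerivAt_quadMap _ _).deriv, norm_mul, hβ, Complex.norm_real]
  rw [Real.norm_of_nonneg (by positivity)]
  have : 0 < √(2 : ℝ) := by positivity
  norm_num
  linarith

theorem mainTheorem3 (α : ℝ) (hα : α ∈ Set.Icc (0 : ℝ) 1) (c₀ : ℂ) (O₁ O₂ : Set ℂ)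
    (hO₁ : IsRepellingOrbit c₀ O₁) (hO₂ : IsRepellingOrbit c₀ O₂) (hne : O₁ ≠ O₂)
    (hexc : c₀ = -2 → O₁ ≠ {2} ∧ O₂ ≠ {2}) :
    (∃ (U : Set ℂ) (O : ℕ → Set ℂ),
      IsOpen U ∧ IsConnected U ∧ c₀ ∈ U ∧ IsAveragingSequence α c₀ O₁ O₂ U O) ∧
    (Nat.Coprime O₁.ncard O₂.ncard →
      ∃ (U : Set ℂ) (O : ℕ → Set ℂ),
        IsOpen U ∧ IsConnected U ∧ c₀ ∈ U ∧ IsAveragingSequence α c₀ O₁ O₂ U O ∧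
        ∀ j, 3 ≤ j → ¬(c₀ = -7 / 4 ∧ j = 3) → (O j).ncard = j) := by
  obtain ⟨δ, C, ℓ, N₀, ν₁, ν₂, hδ, hν₁, hν₂, hℓ, hmain⟩ :=
    exists_approximating_orbits hα hO₁ hO₂ hne hexc
  have hconn : ∀ r > 0, IsConnected (Metric.ball c₀ r) := fun r hr =>
    (convex_ball c₀ r).isConnected (Metric.nonempty_ball.2 hr)
  constructor
  · set g := O₁.ncard.gcd O₂.ncard with hg
    have hgpos : 0 < g := Nat.gcd_pos_of_pos_left _ hO₁.1.ncard_pos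
    have hge : ∀ j, N₀ + j ≤ ℓ + g * (N₀ + j) := fun j =>
      (Nat.le_mul_of_pos_left _ hgpos).trans (Nat.le_add_left _ _)
    -- Periods congruent to `ℓ` modulo the gcd are available. They strictly increase with `j`, which
    -- makes the orbits distinct.
    choose O ν hO hcard hν hest using fun j : ℕ => hmain (ℓ + g * (N₀ + j))
      ((Nat.le_add_right _ _).trans (hge j)) (by simp)
    refine ⟨Metric.ball c₀ δ, O, Metric.isOpen_ball, hconn δ hδ, Metric.mem_ball_self hδ,
      fun j _ => hO j, fun i _ j _ hij => ?_, ν₁, ν₂, ν, hν₁, hν₂, fun j _ => hν j,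
      tendstoUniformlyOn_of_le_div (N := fun j => ℓ + g * (N₀ + j)) ?_
        (Eventually.of_forall hest)⟩
    · have h1 := congrArg Set.ncard hij
      rw [hcard, hcard] at h1
      have h2 := Nat.eq_of_mul_eq_mul_left hgpos (Nat.add_left_cancel h1)
      exact Nat.add_left_cancel h2
    · exact tendsto_atTop_mono (fun j => (Nat.le_add_left _ _).trans (hge j)) tendsto_id
  · intro hcop
    -- The threshold `N₀ + 4` exceeds `3`, so the exceptional index is among the finitely many that
    -- do not affect the limit.
    have hexists : ∀ j, ∃ O, 3 ≤ j → IsRepellingOrbit c₀ O ∧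
        (¬(c₀ = -7 / 4 ∧ j = 3) → O.ncard = j) ∧ (c₀ = -7 / 4 ∧ j = 3 → O.ncard = 1) ∧
        (N₀ + 4 ≤ j → ∃ ν, IsNuMap c₀ O (Metric.ball c₀ δ) ν ∧ ∀ c ∈ Metric.ball c₀ δ,
          ‖ν c - (α * ν₁ c + (1 - α) * ν₂ c)‖ ≤ C / j) := by
      intro j
      rcases le_or_gt (N₀ + 4) j with hj | hj
      · obtain ⟨O, ν, hO, hcard, hν, hest⟩ := hmain j (by omega) (by rw [hcop]; exact one_dvd _)
        exact ⟨O, fun _ => ⟨hO, fun _ => hcard, fun h => by omega, fun _ => ⟨ν, hν, hest⟩⟩⟩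
      by_cases hex : c₀ = -7 / 4 ∧ j = 3
      · obtain ⟨O, hO, hcard⟩ := exists_isRepellingOrbit_fixed
        exact ⟨O, fun _ => ⟨hex.1 ▸ hO, fun h => absurd hex h, fun _ => hcard, fun h => by omega⟩⟩
      · by_cases hj3 : 3 ≤ j
        · obtain ⟨O, hO, hcard⟩ := exists_isRepellingOrbit c₀ hj3 hex
          exact ⟨O, fun _ => ⟨hO, fun _ => hcard, fun h => absurd h hex, fun h => by omega⟩⟩
        · exact ⟨∅, fun h => absurd h hj3⟩
    choose O hO using hexists
    -- The orbits of small index are unrelated to `δ`, so the disc is shrunk until all of their maps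
    -- `ν` are defined on it.
    have hδj : ∀ᶠ r in 𝓝[>] (0 : ℝ), ∀ j ∈ Ico 3 (N₀ + 4),
        ∃ ν, IsNuMap c₀ (O j) (Metric.ball c₀ r) ν := by
      refine (eventually_all_finite (Set.finite_Ico 3 (N₀ + 4))).2 fun j hj => ?_
      obtain ⟨r, hr, ν, hν⟩ := (hO j hj.1).1.exists_isNuMap
      filter_upwards [Ioc_mem_nhdsGT hr] with s hs using ⟨ν, hν.mono (Metric.ball_subset_ball hs.2)⟩
    obtain ⟨r, hr, hr0, hrδ⟩ := (hδj.and (Ioc_mem_nhdsGT hδ)).exists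
    have hsub : Metric.ball c₀ r ⊆ Metric.ball c₀ δ := Metric.ball_subset_ball hrδ
    have hν : ∀ j, ∃ ν, 3 ≤ j → IsNuMap c₀ (O j) (Metric.ball c₀ r) ν ∧
        (N₀ + 4 ≤ j → ∀ c ∈ Metric.ball c₀ r, ‖ν c - (α * ν₁ c + (1 - α) * ν₂ c)‖ ≤ C / j) := by
      intro j
      rcases le_or_gt (N₀ + 4) j with hj | hj
      · obtain ⟨ν, hν, hest⟩ := (hO j (by omega)).2.2.2 hj
        exact ⟨ν, fun _ => ⟨hν.mono hsub, fun _ c hc => hest c (hsub hc)⟩⟩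
      · by_cases hj3 : 3 ≤ j
        · obtain ⟨ν, hν⟩ := hr j ⟨hj3, hj⟩
          exact ⟨ν, fun _ => ⟨hν, fun h => by omega⟩⟩
        · exact ⟨0, fun h => absurd h hj3⟩
    choose ν hν using hν
    refine ⟨Metric.ball c₀ r, O, Metric.isOpen_ball, hconn r hr0, Metric.mem_ball_self hr0,
      ⟨fun j hj => (hO j hj).1, fun i hi j hj hij => ?_, ν₁, ν₂, ν, hν₁.mono hsub, hν₂.mono hsub,
        fun j hj => (hν j hj).1, tendstoUniformlyOn_of_le_div (N := id) (C := C) tendsto_id ?_⟩,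
      fun j hj h => (hO j hj).2.1 h⟩
    · have h1 := congrArg Set.ncard hij
      have hi' := (hO i hi).2
      have hj' := (hO j hj).2
      rw [mem_Ici] at hi hj
      by_cases hei : c₀ = -7 / 4 ∧ i = 3 <;> by_cases hej : c₀ = -7 / 4 ∧ j = 3
      · rw [hei.2, hej.2]
      · rw [hi'.2.1 hei, hj'.1 hej] at h1
        omega
      · rw [hi'.1 hei, hj'.2.1 hej] at h1
        omega
      · rwa [hi'.1 hei, hj'.1 hej] at h1
    · filter_upwards [eventually_ge_atTop (N₀ + 4)] with j hj
      exact (hν j (by omega)).2 hj
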